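/- Let $d\ge 3$, and let $V\in L^\infty(\mathbb{R}^d;\mathbb{R})$ and $b\in L^\infty(\mathbb{R}^d;\mathbb{R}^d)$ satisfy $|V(x)|+|b(x)|\le C_0\langle x\rangle^{-\rho}$ for almost every $x$, with constants $C_0>0$ and $\rho>1$, where $\langle x\rangle=(|x|^2+1)^{1/2}$. Let $P$ be the self-adjoint realization of $(i\nabla+b)^2+V$ on $L^2(\mathbb{R}^d)$ defined by the sesquilinear form $$q(u,v)=\int_{\mathbb{R}^d}\overline{(i\nabla+b)u}\cdot(i\nabla+b)v+V\,\overline{u}\,v\,dx,\qquad u,v\in H^1(\mathbb{R}^d),$$ that is, $u\in D(P)$ and $Pu=f$ if and only if $u\in H^1(\mathbb{R}^d)$, $f\in L^2(\mathbb{R}^d)$ and $q(u,v)=\langle f,v\rangle_{L^2}$ for all $v\in H^1(\mathbb{R}^d)$, where $\langle f,v\rangle_{L^2}=\int\overline{f}\,v\,dx$. Then for every $\delta>0$ and every $s>1/2$ there is a constant $C>0$ such that, for all $\lambda\ge\delta$, all $0<\varepsilon<1$, both choices of the sign $\pm$, and all multi-indices $\alpha,\beta$ with $|\alpha|\le1$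 and $|\beta|\le1$, the resolvent $(P-\lambda^2\pm i\varepsilon)^{-1}$ exists as a bounded operator on $L^2(\mathbb{R}^d)$, and the operator $\langle x\rangle^{-s}\partial_x^\alpha(P-\lambda^2\pm i\varepsilon)^{-1}\partial_x^\beta\langle x\rangle^{-s}$, defined on the dense subspace $\{f\in L^2(\mathbb{R}^d):\partial_x^\beta(\langle x\rangle^{-s}f)\in L^2(\mathbb{R}^d)\}$ (derivatives in the sense of distributions), extends to a bounded operator on $L^2(\mathbb{R}^d)$ with $$\left\|\langle x\rangle^{-s}\partial_x^\alpha(P-\lambda^2\pm i\varepsilon)^{-1}\partial_x^\beta\langle x\rangle^{-s}\right\|_{L^2\to L^2}\le C\,\lambda^{|\alpha|+|\beta|-1}.$$ -/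

import Mathlib

open MeasureTheory
open scoped SchwartzMap LineDeriv

namespace MagneticSchrodinger

/-- Euclidean space `ℝ^d`. -/
abbrev Space (d : ℕ) : Type := EuclideanSpace ℝ (Fin d)

/-- The complex Hilbert space `L²(ℝ^d)` (its inner product is conjugate linear in the first
argument). -/
noncomputable abbrev L2 (d : ℕ) : Type := Lp ℂ 2 (volume : Measure (Space d))

/-- `⟨x⟩ = (|x|² + 1)^{1/2}`. -/
noncomputable def japaneseBracket {d : ℕ} (x : Space d) : ℝ := Real.sqrt (‖x‖ ^ 2 + 1)

/-- The distributional derivative `∂^α T` of a tempered distribution, for a multi-index `α`. -/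
noncomputable def multiDeriv {d : ℕ} (α : Fin d → ℕ) (T : 𝓢'(Space d, ℂ)) : 𝓢'(Space d, ℂ) :=
  (List.finRange d).foldr
    (fun j S => (fun S' : 𝓢'(Space d, ℂ) => ∂_{EuclideanSpace.single j (1 : ℝ)} S')^[α j] S) T

theorem multiDeriv_zero {d : ℕ} (T : 𝓢'(Space d, ℂ)) : multiDeriv 0 T = T := by
  unfold multiDeriv
  induction List.finRange d with
  | nil => rfl
  | cons a l ih => simp [ih]

theorem multiDeriv_single {d : ℕ} (i : Fin d) (T : 𝓢'(Space d, ℂ)) :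
    multiDeriv (Pi.single i 1) T = ∂_{EuclideanSpace.single i (1 : ℝ)} T := by
  have key : ∀ l : List (Fin d), l.Nodup →
      l.foldr (fun j S => (fun S' : 𝓢'(Space d, ℂ) =>
        ∂_{EuclideanSpace.single j (1 : ℝ)} S')^[(Pi.single i 1 : Fin d → ℕ) j] S) T
      = if i ∈ l then ∂_{EuclideanSpace.single i (1 : ℝ)} T else T := by
    intro l
    induction l with
    | nil => intro _; simp
    | cons a l ih =>
      intro hl
      rw [List.nodup_cons] at hl
      rw [List.foldr_cons, ih hl.2]
      by_cases h : i = a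
      · subst h
        simp [hl.1]
      · have h' : (Pi.single i 1 : Fin d → ℕ) a = 0 := by
          rw [Pi.single_apply, if_neg (fun e => h e.symm)]
        simp [h]
  have := key (List.finRange d) (List.nodup_finRange d)
  simpa [multiDeriv] using this

/-- `u ∈ L²` has the distributional derivative `∂^α u = w` in `L²`. -/
def IsWeakDeriv {d : ℕ} (α : Fin d → ℕ) (u w : L2 d) : Prop :=
  multiDeriv α (u : 𝓢'(Space d, ℂ)) = (w : 𝓢'(Space d, ℂ))

/-- `u ∈ H¹(ℝ^d)` with weak gradient `∇u = G`; thus `u ∈ H¹(ℝ^d)` means that such a `G` exists. -/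
def IsWeakGrad {d : ℕ} (u : L2 d) (G : Fin d → L2 d) : Prop :=
  ∀ j, IsWeakDeriv (Pi.single j 1) u (G j)

/-- The sesquilinear form of `(i∇ + b)² + V` on `H¹(ℝ^d)`,
`q(u, v) = ∫ conj((i∇ + b)u) · (i∇ + b)v + V conj(u) v`,
for `u`, `v` with weak gradients `Gu`, `Gv`. -/
noncomputable def form {d : ℕ} (b : Space d → Space d) (V : Space d → ℝ)
    (u : L2 d) (Gu : Fin d → L2 d) (v : L2 d) (Gv : Fin d → L2 d) : ℂ :=
  (∑ j, ∫ x, (starRingEnd ℂ) (Complex.I * Gu j x + (b x j : ℂ) * u x)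
      * (Complex.I * Gv j x + (b x j : ℂ) * v x))
    + ∫ x, (V x : ℂ) * (starRingEnd ℂ) (u x) * v x

/-- The graph of the self-adjoint realization `P` of `(i∇ + b)² + V` on `L²(ℝ^d)` given by the
form `q`: `u ∈ D(P)` and `P u = f` iff `u ∈ H¹` and `q(u, v) = ⟨f, v⟩` for all `v ∈ H¹`. -/
def operatorGraph {d : ℕ} (b : Space d → Space d) (V : Space d → ℝ) : Set (L2 d × L2 d) :=
  {p | ∃ Gu : Fin d → L2 d, IsWeakGrad p.1 Gu ∧
    ∀ (v : L2 d) (Gv : Fin d → L2 d), IsWeakGrad v Gv →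
      form b V p.1 Gu v Gv = inner ℂ p.2 v}

/-- `R = (A - z)⁻¹` for the operator `A` with the given graph: the bounded operator `R` maps
into the domain of `A` and is a two-sided inverse of `A - z`. -/
def IsResolvent {H : Type*} [NormedAddCommGroup H] [InnerProductSpace ℂ H]
    (A : Set (H × H)) (z : ℂ) (R : H →L[ℂ] H) : Prop :=
  (∀ f : H, (R f, f + z • R f) ∈ A) ∧ ∀ u f : H, (u, f) ∈ A → R (f - z • u) = u

/-- `g = ⟨x⟩^{-s} f` in `L²`. -/
def IsWeighted {d : ℕ} (s : ℝ) (f g : L2 d) : Prop :=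
  ∀ᵐ x, g x = ((japaneseBracket x ^ (-s) : ℝ) : ℂ) * f x

/-- `T` is the bounded operator on `L²` that extends `⟨x⟩^{-s} ∂^α R ∂^β ⟨x⟩^{-s}` from its natural
domain `{f ∈ L² : ∂^β (⟨x⟩^{-s} f) ∈ L²}`. This domain contains the Schwartz functions, so it is
dense and `T` is unique. Every `f` in it (with `g = ⟨x⟩^{-s} f` and `h = ∂^β g`) is required to be
mapped by `R` to a function with `∂^α R h ∈ L²`. -/
def IsWeightedResolvent {d : ℕ} (s : ℝ) (R : L2 d →L[ℂ] L2 d) (α β : Fin d → ℕ)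
    (T : L2 d →L[ℂ] L2 d) : Prop :=
  ∀ f g h : L2 d, IsWeighted s f g → IsWeakDeriv β g h →
    ∃ k : L2 d, IsWeakDeriv α (R h) k ∧ IsWeighted s k (T f)

end MagneticSchrodinger

open MagneticSchrodinger

/-!
All the bounds follow from one a priori estimate. If `u ∈ H¹` solves `(P - z) u = f₀ - div f` with
`Re z = λ² ≥ δ²` and `|Im z| ≤ 1`, then, for small `p > 0` and a constant depending on `δ` but not on
`z`,

`∫ ⟨x⟩^(-1-p) (|∇u|² + λ²|u|²) ≤ C (∫ ⟨x⟩^(1+p) |f₀|² + λ² ∫ ⟨x⟩^(1+p) |f|²)`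

(`exists_apriori_estimate`). The derivative `∂^β` on the right of the resolvent gives data in
divergence form and the derivative `∂^α` on the left is contained in the energy, so that the powers of
`λ` can be read off (`exists_isWeightedResolvent`). The resolvent itself comes from inverting the form
on `H¹`, which is coercive when `Im z ≠ 0` (`formOp_coercive`).

The a priori estimate is a Carleman estimate with a weight `exp φ` which is radial, smooth and bounded
above and below, so that no separate treatment of compact sets is needed. With `∇φ = θ x`, the operator
`exp φ (-Δ - λ²) exp (-φ)` is tested against `g (x · ∇ + (d - 1)/2)`. The Rellich identity
(`integral_lap_mul_eulerN`) and a weighted Hardy inequality give a lower bound with two scales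
(`CarlemanWeight.integral_defect_nonneg`), where `E = 1 + e|x|²` and `T = 1 + t|x|²`:

* `g = 2 T^(-1/2) - T^(-(1+p)/2)` is nearly `1` for `|x|² ≪ 1/t` and decays like `1/|x|` further out,
  and yields the energy with weight `T^(-(1+p)/2)`;
* `θ` is a multiple of `e E^(-(1+p)/2) T^(-1/2)` and yields the additional term `e E^(-p) |u|²`, which
  is large for large `e`. The derivative of `θ` enters with the wrong sign near the origin, where the
  Hardy inequality compensates it; this needs `d ≥ 3`.

The lower bound reduces to the pointwise inequality `weight_inequality`. The parameter `e` is chosen large so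
that the first order perturbation, whose coefficients decay like `⟨x⟩^(-1-3p)` but need not be small,
is absorbed (`WeightParams.carleman_estimate_magnetic`); then `t` is chosen small compared to `e` and
`δ`, so that `λ²` dominates the errors which `φ` causes where `|x|² ≳ 1/t`.

A right hand side in divergence form is removed beforehand by subtracting the solution `v` of
`-Δv + κ²v = -div F` with `κ² = 512 (λ² + e)`, for which a weighted energy estimate holds because the
logarithmic derivatives of the weights are small compared to `κ` (`WeightParams.screened`). The terms
with `Im z`, which carry no decaying weight, are controlled by `|Im z| ‖u‖² = |Im ⟨(P - z)u, u⟩|`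
(`imaginary_part_le`) and absorbed after pairing the data with the solution in dual weighted spaces.
-/

open MagneticSchrodinger
open scoped ENNReal InnerProductSpace Laplacian

/-! ### The Sobolev space `H¹` and multiplication operators -/

/-- Multiplication by a bounded real function, as an operator on `L²(ℝ^d)`. -/
noncomputable def mulOp {d : ℕ} {a : Space d → ℝ} (ha : MemLp a ⊤ (volume : Measure (Space d))) :
    L2 d →L[ℂ] L2 d :=
  (ContinuousLinearMap.mul ℂ ℂ).holderL volume ⊤ 2 2 (ha.ofReal (K := ℂ)).toLp

theorem mulOp_coeFn {d : ℕ} {a : Space d → ℝ} (ha : MemLp a ⊤ (volume : Measure (Space d)))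
    (u : L2 d) : mulOp ha u =ᵐ[volume] fun x => (a x : ℂ) * u x := by
  have h1 := (ContinuousLinearMap.mul ℂ ℂ).coeFn_holder (r := 2) (ha.ofReal (K := ℂ)).toLp u
  filter_upwards [h1, (ha.ofReal (K := ℂ)).coeFn_toLp] with x hx hx'
  refine hx.trans ?_
  rw [hx']
  rfl

theorem inner_mulOp_left {d : ℕ} {a : Space d → ℝ} (ha : MemLp a ⊤ (volume : Measure (Space d)))
    (u v : L2 d) : ⟪mulOp ha u, v⟫_ℂ = ⟪u, mulOp ha v⟫_ℂ := by
  rw [L2.inner_def, L2.inner_def]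
  refine integral_congr_ae ?_
  filter_upwards [mulOp_coeFn ha u, mulOp_coeFn ha v] with x h1 h2
  rw [h1, h2]
  simp
  ring

/-- The `j`-th standard basis vector of `ℝ^d`. -/
noncomputable abbrev stdVec {d : ℕ} (j : Fin d) : Space d := EuclideanSpace.single j (1 : ℝ)

/-- The partial derivative `∂_j` on Schwartz functions. -/
noncomputable def pderiv {d : ℕ} {F : Type*} [NormedAddCommGroup F] [NormedSpace ℝ F] (j : Fin d)
    (ψ : 𝓢(Space d, F)) : 𝓢(Space d, F) := ∂_{stdVec j} ψ

theorem pderiv_apply {d : ℕ} {F : Type*} [NormedAddCommGroup F] [NormedSpace ℝ F] (j : Fin d)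
    (ψ : 𝓢(Space d, F)) (x : Space d) : pderiv j ψ x = fderiv ℝ ψ x (stdVec j) :=
  SchwartzMap.lineDerivOp_apply_eq_fderiv _ _ _

theorem isWeakDeriv_single_iff {d : ℕ} (j : Fin d) (u w : L2 d) :
    IsWeakDeriv (Pi.single j 1) u w ↔
      ∀ ψ : 𝓢(Space d, ℂ), ∫ x, (pderiv j ψ) x * u x = - ∫ x, ψ x * w x := by
  unfold IsWeakDeriv
  rw [multiDeriv_single]
  constructor
  · intro h ψ
    have := DFunLike.congr_fun h ψ
    rw [TemperedDistribution.lineDerivOp_apply_apply] at this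
    simp only [Lp.toTemperedDistribution_apply, smul_eq_mul, neg_apply, neg_mul,
      integral_neg] at this
    rw [← this, neg_neg]
    rfl
  · intro h
    ext ψ
    rw [TemperedDistribution.lineDerivOp_apply_apply]
    simp only [Lp.toTemperedDistribution_apply, smul_eq_mul, neg_apply, neg_mul, integral_neg]
    exact neg_eq_iff_eq_neg.2 (h ψ)

theorem toTemperedDistribution_injective {d : ℕ} :
    Function.Injective (fun u : L2 d => (u : 𝓢'(Space d, ℂ))) := by
  intro u v h
  have h2 : u - v ∈ (Lp.toTemperedDistributionCLM ℂ (volume : Measure (Space d)) 2).ker := by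
    rw [LinearMap.mem_ker]
    simp only [ContinuousLinearMap.coe_coe, map_sub, Lp.toTemperedDistributionCLM_apply]
    exact sub_eq_zero.2 h
  rw [Lp.ker_toTemperedDistributionCLM_eq_bot] at h2
  exact sub_eq_zero.1 ((Submodule.mem_bot ℂ).1 h2)

theorem IsWeakDeriv.unique {d : ℕ} {α : Fin d → ℕ} {u w w' : L2 d} (h : IsWeakDeriv α u w)
    (h' : IsWeakDeriv α u w') : w = w' :=
  toTemperedDistribution_injective (h.symm.trans h')

theorem isWeakDeriv_zero_iff {d : ℕ} {u w : L2 d} : IsWeakDeriv 0 u w ↔ u = w := by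
  unfold IsWeakDeriv
  rw [multiDeriv_zero]
  exact toTemperedDistribution_injective.eq_iff

/-- The pointwise complex conjugate of a Schwartz function. -/
noncomputable def conjSchwartz {d : ℕ} (ψ : 𝓢(Space d, ℂ)) : 𝓢(Space d, ℂ) :=
  SchwartzMap.postcompCLM (𝕜 := ℝ) (Complex.conjCLE : ℂ →L[ℝ] ℂ) ψ

theorem conjSchwartz_apply {d : ℕ} (ψ : 𝓢(Space d, ℂ)) (x : Space d) :
    conjSchwartz ψ x = (starRingEnd ℂ) (ψ x) := rfl

theorem pderiv_conjSchwartz {d : ℕ} (ψ : 𝓢(Space d, ℂ)) (j : Fin d) (x : Space d) :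
    pderiv j (conjSchwartz ψ) x = (starRingEnd ℂ) (pderiv j ψ x) := by
  rw [pderiv_apply, pderiv_apply]
  have h : HasFDerivAt (conjSchwartz ψ) ((Complex.conjCLE : ℂ →L[ℝ] ℂ).comp (fderiv ℝ ψ x)) x :=
    (Complex.conjCLE : ℂ →L[ℝ] ℂ).hasFDerivAt.comp x (ψ.hasFDerivAt x)
  rw [h.fderiv]
  simp

theorem inner_toLp_left {d : ℕ} (ψ : 𝓢(Space d, ℂ)) (u : L2 d) :
    ⟪(ψ.toLp 2 : L2 d), u⟫_ℂ = ∫ x, (starRingEnd ℂ) (ψ x) * u x := by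
  rw [L2.inner_def]
  refine integral_congr_ae ?_
  filter_upwards [ψ.coeFn_toLp 2 volume] with x hx
  rw [hx]
  simp [mul_comm]

theorem isWeakDeriv_single_iff_inner {d : ℕ} (j : Fin d) (u w : L2 d) :
    IsWeakDeriv (Pi.single j 1) u w ↔
      ∀ ψ : 𝓢(Space d, ℂ),
        ⟪(ψ.toLp 2 : L2 d), w⟫_ℂ = - ⟪((pderiv j ψ).toLp 2 : L2 d), u⟫_ℂ := by
  rw [isWeakDeriv_single_iff]
  simp only [inner_toLp_left]
  constructor
  · intro h ψ
    have := h (conjSchwartz ψ)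
    simp only [conjSchwartz_apply, pderiv_conjSchwartz] at this
    rw [this, neg_neg]
  · intro h ψ
    have := h (conjSchwartz ψ)
    simp only [conjSchwartz_apply, pderiv_conjSchwartz, Complex.conj_conj] at this
    rw [this, neg_neg]

/-- The space in which a function and its gradient are collected: the entry at `none` is the
function, the entries at `some j` are its first derivatives. -/
abbrev Jet (d : ℕ) : Type := PiLp 2 (fun _ : Option (Fin d) => L2 d)

/-- The Sobolev space `H¹(ℝ^d)`, as the closed subspace of the pairs `(u, ∇u)`. -/
noncomputable def sobolev (d : ℕ) : Submodule ℂ (Jet d) where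
  carrier := {U | IsWeakGrad (U none) fun j => U (some j)}
  zero_mem' := by
    intro j
    rw [isWeakDeriv_single_iff_inner]
    simp
  add_mem' := by
    intro U W hU hW j
    have h1 := (isWeakDeriv_single_iff_inner j _ _).1 (hU j)
    have h2 := (isWeakDeriv_single_iff_inner j _ _).1 (hW j)
    rw [isWeakDeriv_single_iff_inner]
    intro ψ
    simp only [PiLp.add_apply, inner_add_right, h1 ψ, h2 ψ]
    ring
  smul_mem' := by
    intro c U hU j
    have h1 := (isWeakDeriv_single_iff_inner j _ _).1 (hU j)
    rw [isWeakDeriv_single_iff_inner]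
    intro ψ
    simp only [PiLp.smul_apply, inner_smul_right, h1 ψ]
    ring

theorem mem_sobolev {d : ℕ} {U : Jet d} :
    U ∈ sobolev d ↔ IsWeakGrad (U none) fun j => U (some j) := Iff.rfl

theorem isClosed_sobolev (d : ℕ) : IsClosed (sobolev d : Set (Jet d)) := by
  have : (sobolev d : Set (Jet d)) = ⋂ j : Fin d, ⋂ ψ : 𝓢(Space d, ℂ),
      {U : Jet d | ⟪(ψ.toLp 2 : L2 d), U (some j)⟫_ℂ
        = - ⟪((pderiv j ψ).toLp 2 : L2 d), U none⟫_ℂ} := by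
    ext U
    simp only [Set.mem_iInter, Set.mem_ofPred_eq, SetLike.mem_coe, mem_sobolev, IsWeakGrad,
      isWeakDeriv_single_iff_inner]
  rw [this]
  refine isClosed_iInter fun j => isClosed_iInter fun ψ => isClosed_eq ?_ ?_
  · exact continuous_const.inner (PiLp.continuous_apply 2 _ (some j))
  · exact (continuous_const.inner (PiLp.continuous_apply 2 _ none)).neg

instance (d : ℕ) : CompleteSpace (sobolev d) :=
  (isClosed_sobolev d).completeSpace_coe

/-- The inclusion `H¹ → L²`. -/
noncomputable def val (d : ℕ) : sobolev d →L[ℂ] L2 d :=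
  (PiLp.proj 2 (fun _ : Option (Fin d) => L2 d) none : Jet d →L[ℂ] L2 d) ∘L (sobolev d).subtypeL

/-- The partial derivative `∂_j : H¹ → L²`. -/
noncomputable def grad {d : ℕ} (j : Fin d) : sobolev d →L[ℂ] L2 d :=
  (PiLp.proj 2 (fun _ : Option (Fin d) => L2 d) (some j) : Jet d →L[ℂ] L2 d) ∘L
    (sobolev d).subtypeL

theorem isWeakGrad_sobolev {d : ℕ} (U : sobolev d) : IsWeakGrad (val d U) fun j => grad j U :=
  U.2

theorem exists_sobolev_of_isWeakGrad {d : ℕ} {u : L2 d} {G : Fin d → L2 d} (h : IsWeakGrad u G) :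
    ∃ U : sobolev d, val d U = u ∧ ∀ j, grad j U = G j :=
  ⟨⟨WithLp.toLp 2 (fun o => o.elim u G), h⟩, rfl, fun _ => rfl⟩

theorem sobolev_inner {d : ℕ} (U W : sobolev d) :
    ⟪U, W⟫_ℂ = ⟪val d U, val d W⟫_ℂ + ∑ j, ⟪grad j U, grad j W⟫_ℂ := by
  rw [Submodule.coe_inner, PiLp.inner_apply, Fintype.sum_option]
  rfl

theorem sobolev_norm_sq {d : ℕ} (U : sobolev d) :
    ‖U‖ ^ 2 = ‖val d U‖ ^ 2 + ∑ j, ‖grad j U‖ ^ 2 := by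
  have h : ‖U‖ = ‖(U : Jet d)‖ := rfl
  rw [h, PiLp.norm_sq_eq_of_L2, Fintype.sum_option]
  rfl

theorem sobolev_ext {d : ℕ} {U W : sobolev d} (h : val d U = val d W) : U = W := by
  have h0 : ∀ j, grad j U = grad j W := fun j => by
    have h1 : IsWeakDeriv (Pi.single j 1) (val d U) (grad j U) := isWeakGrad_sobolev U j
    rw [h] at h1
    exact IsWeakDeriv.unique h1 (isWeakGrad_sobolev W j)
  refine Subtype.ext (PiLp.ext fun o => ?_)
  cases o with
  | none => exact h
  | some j => exact h0 j

/-- A Schwartz function as an element of `H¹`. -/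
noncomputable def schwartzJet {d : ℕ} (ψ : 𝓢(Space d, ℂ)) : sobolev d :=
  ⟨WithLp.toLp 2 (fun o : Option (Fin d) =>
    o.elim (ψ.toLp 2 : L2 d) fun j => (pderiv j ψ).toLp 2), by
    intro j
    rw [isWeakDeriv_single_iff]
    intro χ
    have h := SchwartzMap.integral_mul_lineDerivOp_right_eq_neg_left (μ := volume) ψ χ (stdVec j)
    calc ∫ x, (pderiv j χ) x * (ψ.toLp 2 : L2 d) x
        = ∫ x, ψ x * (pderiv j χ) x := by
          refine integral_congr_ae ?_
          filter_upwards [ψ.coeFn_toLp 2 volume] with x hx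
          rw [hx, mul_comm]
      _ = - ∫ x, (pderiv j ψ) x * χ x := h
      _ = - ∫ x, χ x * ((pderiv j ψ).toLp 2 : L2 d) x := by
          congr 1
          refine integral_congr_ae ?_
          filter_upwards [(pderiv j ψ).coeFn_toLp 2 volume] with x hx
          rw [hx, mul_comm]⟩

theorem val_schwartzJet {d : ℕ} (ψ : 𝓢(Space d, ℂ)) : val d (schwartzJet ψ) = ψ.toLp 2 := rfl

theorem grad_schwartzJet {d : ℕ} (ψ : 𝓢(Space d, ℂ)) (j : Fin d) :
    grad j (schwartzJet ψ) = (pderiv j ψ).toLp 2 := rfl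

theorem pderiv_real_smul {d : ℕ} {a : Space d → ℝ} (ha : a.HasTemperateGrowth)
    (ψ : 𝓢(Space d, ℂ)) (j : Fin d) (x : Space d) :
    pderiv j (SchwartzMap.smulLeftCLM ℂ a ψ) x
      = (a x : ℂ) * pderiv j ψ x + (fderiv ℝ a x (stdVec j) : ℂ) * ψ x := by
  rw [pderiv_apply, pderiv_apply,
    SchwartzMap.smulLeftCLM_apply ha]
  have h1 : HasFDerivAt a (fderiv ℝ a x) x :=
    (ha.1.differentiable (by simp) x).hasFDerivAt
  have h2 : HasFDerivAt (fun x => a x • ψ x) _ x := h1.smul (ψ.hasFDerivAt x)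
  rw [h2.fderiv]
  simp

theorem integrable_schwartz_mul {d : ℕ} (ψ : 𝓢(Space d, ℂ)) (u : L2 d) :
    Integrable (fun x => ψ x * u x) (volume : Measure (Space d)) :=
  MemLp.integrable_mul (p := 2) (q := 2) (ψ.memLp 2 volume) (Lp.memLp u)

/-- The product rule: `∇(a u) = a ∇u + u ∇a` for `u ∈ H¹` and a smooth real function `a` which
is bounded together with its gradient. -/
theorem isWeakGrad_mul {d : ℕ} {a : Space d → ℝ} {a' : Fin d → Space d → ℝ}
    (hag : a.HasTemperateGrowth) (hderiv : ∀ j x, fderiv ℝ a x (stdVec j) = a' j x)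
    (ha : MemLp a ⊤ (volume : Measure (Space d)))
    (ha' : ∀ j, MemLp (a' j) ⊤ (volume : Measure (Space d)))
    {u : L2 d} {G : Fin d → L2 d} (h : IsWeakGrad u G) :
    IsWeakGrad (mulOp ha u) fun j => mulOp ha (G j) + mulOp (ha' j) u := by
  intro j
  rw [isWeakDeriv_single_iff]
  intro ψ
  have h0 := (isWeakDeriv_single_iff j u (G j)).1 (h j) (SchwartzMap.smulLeftCLM ℂ a ψ)
  have i1 := integrable_schwartz_mul (pderiv j (SchwartzMap.smulLeftCLM ℂ a ψ)) u
  have i2 := integrable_schwartz_mul (SchwartzMap.smulLeftCLM ℂ a (pderiv j ψ)) u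
  have i3 := integrable_schwartz_mul (SchwartzMap.smulLeftCLM ℂ a ψ) (G j)
  have i4 := i1.sub i2
  have e1 : ∫ x, (pderiv j ψ) x * mulOp ha u x
      = ∫ x, (SchwartzMap.smulLeftCLM ℂ a (pderiv j ψ)) x * u x := by
    refine integral_congr_ae ?_
    filter_upwards [mulOp_coeFn ha u] with x hx
    rw [hx, SchwartzMap.smulLeftCLM_apply_apply hag, Complex.real_smul]
    ring
  have e2 : ∫ x, ψ x * (mulOp ha (G j) + mulOp (ha' j) u : L2 d) x
      = ∫ x, ((SchwartzMap.smulLeftCLM ℂ a ψ) x * G j x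
        + ((pderiv j (SchwartzMap.smulLeftCLM ℂ a ψ)) x * u x
            - (SchwartzMap.smulLeftCLM ℂ a (pderiv j ψ)) x * u x)) := by
    refine integral_congr_ae ?_
    filter_upwards [mulOp_coeFn ha (G j), mulOp_coeFn (ha' j) u,
      Lp.coeFn_add (mulOp ha (G j)) (mulOp (ha' j) u)] with x h1 h2 h3
    rw [h3, Pi.add_apply, h1, h2, pderiv_real_smul hag, hderiv,
      SchwartzMap.smulLeftCLM_apply_apply hag, SchwartzMap.smulLeftCLM_apply_apply hag,
      Complex.real_smul, Complex.real_smul]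
    ring
  have e3 := integral_add i3 i4
  simp only [Pi.sub_apply] at e3
  rw [e1, e2, e3, integral_sub i1 i2, h0]
  ring

theorem exists_sobolev_mul {d : ℕ} {a : Space d → ℝ} {a' : Fin d → Space d → ℝ}
    (hag : a.HasTemperateGrowth) (hderiv : ∀ j x, fderiv ℝ a x (stdVec j) = a' j x)
    (ha : MemLp a ⊤ (volume : Measure (Space d)))
    (ha' : ∀ j, MemLp (a' j) ⊤ (volume : Measure (Space d))) (U : sobolev d) :
    ∃ W : sobolev d, val d W = mulOp ha (val d U) ∧
      ∀ j, grad j W = mulOp ha (grad j U) + mulOp (ha' j) (val d U) :=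
  exists_sobolev_of_isWeakGrad (isWeakGrad_mul hag hderiv ha ha' (isWeakGrad_sobolev U))

theorem hasTemperateGrowth_one_add_const_mul_norm_sq_rpow (d : ℕ) (c r : ℝ) (hc : 0 ≤ c) :
    (fun x : Space d => (1 + c * ‖x‖ ^ 2) ^ r).HasTemperateGrowth := by
  have h := (Function.hasTemperateGrowth_one_add_norm_sq_rpow (Space d) r).comp
    ((Real.sqrt c • ContinuousLinearMap.id ℝ (Space d)).hasTemperateGrowth)
  have h0 : (fun x : Space d => (1 + c * ‖x‖ ^ 2) ^ r) = (fun x : Space d => (1 + ‖x‖ ^ 2) ^ r) ∘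
      (Real.sqrt c • ContinuousLinearMap.id ℝ (Space d)) := by
    funext x
    have h1 : (Real.sqrt c • ContinuousLinearMap.id ℝ (Space d)) x = Real.sqrt c • x := rfl
    rw [Function.comp_apply, h1, norm_smul, mul_pow, Real.norm_eq_abs, sq_abs, Real.sq_sqrt hc]
  rw [h0]
  exact h

/-- The operator `1 - Δ` maps the Schwartz space onto itself. -/
theorem exists_sub_laplacian_eq {d : ℕ} (h : 𝓢(Space d, ℂ)) :
    ∃ y : 𝓢(Space d, ℂ), y - ∑ j, pderiv j (pderiv j y) = h := by
  let m : Space d → ℂ := fun ξ => (((1 + (2 * Real.pi) ^ 2 * ‖ξ‖ ^ 2) ^ (-1 : ℝ) : ℝ) : ℂ)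
  have hm : m.HasTemperateGrowth :=
    Function.Complex.hasTemperateGrowth_ofReal.comp
      (hasTemperateGrowth_one_add_const_mul_norm_sq_rpow d ((2 * Real.pi) ^ 2) (-1) (by positivity))
  refine ⟨SchwartzMap.fourierMultiplierCLM ℂ m h, ?_⟩
  have h1 : ∑ j, pderiv j (pderiv j (SchwartzMap.fourierMultiplierCLM ℂ m h))
      = Δ (SchwartzMap.fourierMultiplierCLM ℂ m h) := by
    rw [SchwartzMap.laplacian_eq_sum (EuclideanSpace.basisFun (Fin d) ℝ)]
    simp
    rfl
  have h2 : (fun ξ : Space d => ((‖ξ‖ ^ 2 : ℝ) : ℂ)).HasTemperateGrowth :=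
    Function.Complex.hasTemperateGrowth_ofReal.comp (Function.hasTemperateGrowth_norm_sq (H := Space d))
  let q : Space d → ℂ := fun ξ => ((‖ξ‖ ^ 2 : ℝ) : ℂ)
  have h8 : Δ (SchwartzMap.fourierMultiplierCLM ℂ m h)
      = -(2 * Real.pi) ^ 2 • SchwartzMap.fourierMultiplierCLM ℂ (q * m) h := by
    rw [← SchwartzMap.fourierMultiplierCLM_fourierMultiplierCLM_apply h2 hm,
      SchwartzMap.laplacian_eq_fourierMultiplierCLM]
    congr 1
    exact (SchwartzMap.fourierMultiplierCLM_ofReal ℂ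
      (Function.hasTemperateGrowth_norm_sq (H := Space d)) _).symm
  have h3 : (q * m).HasTemperateGrowth := h2.mul hm
  have h4 : SchwartzMap.smulLeftCLM ℂ m (FourierTransform.fourier h) + ((2 * Real.pi) ^ 2 : ℝ) •
      SchwartzMap.smulLeftCLM ℂ (q * m)
        (FourierTransform.fourier h) = FourierTransform.fourier h := by
    ext ξ
    simp only [add_apply, smul_apply, SchwartzMap.smulLeftCLM_apply_apply hm,
      SchwartzMap.smulLeftCLM_apply_apply h3, Pi.mul_apply, smul_eq_mul, Complex.real_smul, m, q]
    have h5 : (1 + (2 * Real.pi) ^ 2 * ‖ξ‖ ^ 2 : ℝ) ≠ 0 := by positivity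
    have h6 : ((1 + (2 * Real.pi) ^ 2 * ‖ξ‖ ^ 2 : ℝ) : ℂ) *
        (((1 + (2 * Real.pi) ^ 2 * ‖ξ‖ ^ 2) ^ (-1 : ℝ) : ℝ) : ℂ) = 1 := by
      rw [← Complex.ofReal_mul, Real.rpow_neg_one, mul_inv_cancel₀ h5, Complex.ofReal_one]
    have h7 : ((1 + (2 * Real.pi) ^ 2 * ‖ξ‖ ^ 2 : ℝ) : ℂ)
        = 1 + (((2 * Real.pi) ^ 2 : ℝ) : ℂ) * ((‖ξ‖ ^ 2 : ℝ) : ℂ) := by push_cast; ring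
    rw [h7] at h6
    linear_combination (FourierTransform.fourier h ξ) * h6
  rw [h1, h8, neg_smul, sub_neg_eq_add, SchwartzMap.fourierMultiplierCLM_apply,
    SchwartzMap.fourierMultiplierCLM_apply, ← FourierTransform.fourierInv_smul,
    ← FourierTransform.fourierInv_add, h4, FourierTransform.fourierInv_fourier_eq]

/-! ### Density of Schwartz functions and coercive operators -/

theorem norm_val_le {d : ℕ} (U : sobolev d) : ‖val d U‖ ≤ ‖U‖ := by
  refine abs_le_of_sq_le_sq' ?_ (norm_nonneg _) |>.2
  rw [sobolev_norm_sq]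
  exact le_add_of_nonneg_right (Finset.sum_nonneg fun j _ => sq_nonneg _)

theorem inner_grad_schwartz {d : ℕ} (j : Fin d) (ψ : 𝓢(Space d, ℂ)) (U : sobolev d) :
    ⟪((pderiv j ψ).toLp 2 volume : L2 d), grad j U⟫_ℂ
      = -⟪((pderiv j (pderiv j ψ)).toLp 2 volume : L2 d), val d U⟫_ℂ :=
  (isWeakDeriv_single_iff_inner j _ _).1 (isWeakGrad_sobolev U j) _

theorem toLp_add {d : ℕ} (ψ χ : 𝓢(Space d, ℂ)) :
    ((ψ + χ).toLp 2 volume : L2 d) = ψ.toLp 2 volume + χ.toLp 2 volume :=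
  map_add (SchwartzMap.toLpCLM ℂ ℂ 2 (volume : Measure (Space d))) ψ χ

theorem toLp_sub {d : ℕ} (ψ χ : 𝓢(Space d, ℂ)) :
    ((ψ - χ).toLp 2 volume : L2 d) = ψ.toLp 2 volume - χ.toLp 2 volume :=
  map_sub (SchwartzMap.toLpCLM ℂ ℂ 2 (volume : Measure (Space d))) ψ χ

theorem toLp_smul {d : ℕ} (c : ℂ) (ψ : 𝓢(Space d, ℂ)) :
    ((c • ψ).toLp 2 volume : L2 d) = c • ψ.toLp 2 volume :=
  map_smul (SchwartzMap.toLpCLM ℂ ℂ 2 (volume : Measure (Space d))) c ψ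

theorem toLp_sum {d : ℕ} (ψ : Fin d → 𝓢(Space d, ℂ)) :
    ((∑ j, ψ j).toLp 2 volume : L2 d) = ∑ j, (ψ j).toLp 2 volume :=
  map_sum (SchwartzMap.toLpCLM ℂ ℂ 2 (volume : Measure (Space d))) ψ Finset.univ

/-- The Laplacian on Schwartz functions, as a sum of second partial derivatives. -/
noncomputable def lap {d : ℕ} {F : Type*} [NormedAddCommGroup F] [NormedSpace ℝ F]
    (ψ : 𝓢(Space d, F)) : 𝓢(Space d, F) := ∑ j, pderiv j (pderiv j ψ)

theorem sobolev_inner_schwartzJet {d : ℕ} (ψ : 𝓢(Space d, ℂ)) (U : sobolev d) :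
    ⟪schwartzJet ψ, U⟫_ℂ = ⟪((ψ - lap ψ).toLp 2 volume : L2 d), val d U⟫_ℂ := by
  rw [sobolev_inner, toLp_sub, lap, toLp_sum, inner_sub_left, sum_inner, val_schwartzJet,
    sub_eq_add_neg, ← Finset.sum_neg_distrib]
  congr 1
  exact Finset.sum_congr rfl fun j _ => by rw [grad_schwartzJet, inner_grad_schwartz]

theorem pderiv_add {d : ℕ} (j : Fin d) (ψ χ : 𝓢(Space d, ℂ)) :
    pderiv j (ψ + χ) = pderiv j ψ + pderiv j χ := LineDeriv.lineDerivOp_add _ _ _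

/-- The inclusion of the Schwartz space into `H¹` as a linear map. -/
noncomputable def schwartzJetLin (d : ℕ) : 𝓢(Space d, ℂ) →ₗ[ℂ] sobolev d where
  toFun := schwartzJet
  map_add' ψ χ := sobolev_ext (by simp only [map_add, val_schwartzJet, toLp_add])
  map_smul' c ψ := sobolev_ext (by simp only [map_smul, val_schwartzJet, toLp_smul, RingHom.id_apply])

theorem denseRange_schwartzJet (d : ℕ) : DenseRange (schwartzJet (d := d)) := by
  have h : (LinearMap.range (schwartzJetLin d)).topologicalClosure = ⊤ := by
    rw [Submodule.topologicalClosure_eq_top_iff, Submodule.eq_bot_iff]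
    intro U hU
    rw [Submodule.mem_orthogonal] at hU
    have h1 : ∀ f : 𝓢(Space d, ℂ), ⟪(f.toLp 2 volume : L2 d), val d U⟫_ℂ = 0 := fun f => by
      obtain ⟨y, rfl⟩ := exists_sub_laplacian_eq f
      have := hU (schwartzJet y) ⟨y, rfl⟩
      rwa [sobolev_inner_schwartzJet] at this
    have h2 : val d U = 0 := by
      have hd : DenseRange (SchwartzMap.toLpCLM ℝ ℂ 2 (volume : Measure (Space d))) :=
        SchwartzMap.denseRange_toLpCLM (by simp)
      refine hd.eq_zero_of_inner_right ℂ fun f => ?_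
      exact h1 f
    exact sobolev_ext (by rw [h2, map_zero])
  rw [← Submodule.dense_iff_topologicalClosure_eq_top] at h
  exact h

/-- Integration by parts between a function with one `L²` derivative and an `H¹` function. -/
theorem inner_weakDeriv {d : ℕ} {j : Fin d} {g h : L2 d} (hg : IsWeakDeriv (Pi.single j 1) g h)
    (U : sobolev d) : ⟪h, val d U⟫_ℂ = -⟪g, grad j U⟫_ℂ := by
  refine (denseRange_schwartzJet d).induction_on
    (p := fun U => ⟪h, val d U⟫_ℂ = -⟪g, grad j U⟫_ℂ) U ?_ ?_
  · exact isClosed_eq (continuous_const.inner (val d).continuous)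
      (continuous_const.inner (grad j).continuous).neg
  · intro ψ
    have h1 := (isWeakDeriv_single_iff_inner j _ _).1 hg ψ
    rw [val_schwartzJet, grad_schwartzJet, ← inner_conj_symm, h1, map_neg, inner_conj_symm]

/-- Schwartz functions are dense in the space of `U ∈ H¹` with `ΔU ∈ L²`, for the graph norm:
`1 - Δ` maps the Schwartz space onto itself and is bounded below. -/
theorem mem_closure_schwartz_graph {d : ℕ} (U : sobolev d) (h : L2 d)
    (hU : ∀ W : sobolev d, ∑ j, ⟪grad j U, grad j W⟫_ℂ = ⟪h, val d W⟫_ℂ) :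
    (U, h) ∈ closure (Set.range fun ψ : 𝓢(Space d, ℂ) =>
      ((schwartzJet ψ, -(lap ψ).toLp 2 volume) : sobolev d × L2 d)) := by
  have hd : DenseRange (SchwartzMap.toLpCLM ℝ ℂ 2 (volume : Measure (Space d))) :=
    SchwartzMap.denseRange_toLpCLM (by simp)
  rw [Metric.mem_closure_iff]
  intro ε hε
  obtain ⟨f, hf⟩ := hd.exists_dist_lt (h + val d U) (half_pos hε)
  obtain ⟨y, hy⟩ := exists_sub_laplacian_eq f
  change y - lap y = f at hy
  have hf' : ‖h + val d U - f.toLp 2 volume‖ < ε / 2 := by rw [← dist_eq_norm]; exact hf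
  set Y := schwartzJet y with hY
  have h1 : ‖U - Y‖ ^ 2 ≤ ‖h + val d U - f.toLp 2 volume‖ * ‖U - Y‖ := by
    have h2 : ⟪U - Y, U - Y⟫_ℂ = ⟪h + val d U - f.toLp 2 volume, val d (U - Y)⟫_ℂ := by
      rw [inner_sub_left, hY, sobolev_inner_schwartzJet, hy, ← hY, inner_sub_left, inner_add_left,
        ← hU, sobolev_inner]
      ring
    calc ‖U - Y‖ ^ 2 = ‖⟪U - Y, U - Y⟫_ℂ‖ := by
          have h7 : ⟪U - Y, U - Y⟫_ℂ = (‖U - Y‖ : ℂ) ^ 2 := inner_self_eq_norm_sq_to_K (U - Y)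
          rw [h7]; simp
      _ ≤ ‖h + val d U - f.toLp 2 volume‖ * ‖val d (U - Y)‖ := by rw [h2]; exact norm_inner_le_norm _ _
      _ ≤ _ := mul_le_mul_of_nonneg_left (norm_val_le _) (norm_nonneg _)
  have h3 : ‖U - Y‖ ≤ ‖h + val d U - f.toLp 2 volume‖ := by
    rcases (norm_nonneg (U - Y)).eq_or_lt with h0 | h0
    · rw [← h0]; exact norm_nonneg _
    · rw [sq] at h1; exact le_of_mul_le_mul_right h1 h0
  refine ⟨_, ⟨y, rfl⟩, ?_⟩
  rw [Prod.dist_eq, max_lt_iff, dist_eq_norm, dist_eq_norm]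
  constructor
  · exact lt_of_le_of_lt h3 (by linarith)
  · have h4 : h - -((lap y).toLp 2 volume : L2 d) = (h + val d U - f.toLp 2 volume) - val d (U - Y) := by
      have : (f.toLp 2 volume : L2 d) = y.toLp 2 volume - (lap y).toLp 2 volume := by rw [← toLp_sub, hy]
      rw [map_sub, hY, val_schwartzJet, this]
      abel
    dsimp only
    rw [h4]
    have h5 := norm_sub_le (h + val d U - f.toLp 2 volume) (val d (U - Y))
    have h6 := norm_val_le (U - Y)
    linarith

/-- The Lax-Milgram theorem, with coercivity of the modulus of the form. -/
theorem ContinuousLinearMap.exists_inverse_of_coercive {H : Type*} [NormedAddCommGroup H]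
    [InnerProductSpace ℂ H] [CompleteSpace H] (A : H →L[ℂ] H) {c : ℝ} (hc : 0 < c)
    (h : ∀ u, c * ‖u‖ ^ 2 ≤ ‖⟪A u, u⟫_ℂ‖) :
    ∃ B : H →L[ℂ] H, (∀ u, A (B u) = u) ∧ ∀ u, B (A u) = u := by
  obtain ⟨B, hB⟩ := A.isUnit_of_forall_le_norm_inner_map (c := ⟨c, hc.le⟩) hc
    (fun x => by rw [mul_comm]; exact h x)
  refine ⟨(↑B⁻¹ : H →L[ℂ] H), fun u => ?_, fun u => ?_⟩
  · rw [← hB]; exact DFunLike.congr_fun B.mul_inv u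
  · rw [← hB]; exact DFunLike.congr_fun B.inv_mul u

/-! ### Radial multipliers and the Rellich identity -/

/-- `c` is a smooth radial function of temperate growth and `c'` is its derivative with respect
to `|x|²`, so that `∂_j c = 2 x_j c'`. -/
structure RadialDeriv {d : ℕ} (c c' : Space d → ℝ) : Prop where
  temperate : c.HasTemperateGrowth
  fderiv_eq : ∀ j x, fderiv ℝ c x (stdVec j) = 2 * x j * c' x

theorem hasTemperateGrowth_coord {d : ℕ} (j : Fin d) :
    (fun x : Space d => x j).HasTemperateGrowth :=
  (EuclideanSpace.proj j : Space d →L[ℝ] ℝ).hasTemperateGrowth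

theorem fderiv_coord {d : ℕ} (j k : Fin d) (x : Space d) :
    fderiv ℝ (fun x : Space d => x k) x (stdVec j) = if k = j then 1 else 0 := by
  have h : HasFDerivAt (fun x : Space d => x k)
      (EuclideanSpace.proj k : Space d →L[ℝ] ℝ) x :=
    (EuclideanSpace.proj k : Space d →L[ℝ] ℝ).hasFDerivAt
  rw [h.fderiv]
  simp [stdVec]

theorem temperate_differentiableAt {d : ℕ} {c : Space d → ℝ} (hc : c.HasTemperateGrowth)
    (x : Space d) : DifferentiableAt ℝ c x := hc.1.differentiable (by simp) x

theorem fderiv_mul_apply {d : ℕ} {a b : Space d → ℝ} (ha : a.HasTemperateGrowth)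
    (hb : b.HasTemperateGrowth) (x v : Space d) :
    fderiv ℝ (fun x => a x * b x) x v = a x * fderiv ℝ b x v + b x * fderiv ℝ a x v := by
  have h : HasFDerivAt (fun x => a x * b x) _ x :=
    (temperate_differentiableAt ha x).hasFDerivAt.mul
      (temperate_differentiableAt hb x).hasFDerivAt
  rw [h.fderiv]
  simp

theorem RadialDeriv.mul {d : ℕ} {a a' b b' : Space d → ℝ} (ha : RadialDeriv a a')
    (hb : RadialDeriv b b') :
    RadialDeriv (fun x => a x * b x) (fun x => a' x * b x + a x * b' x) where
  temperate := ha.temperate.mul hb.temperate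
  fderiv_eq j x := by
    rw [fderiv_mul_apply ha.temperate hb.temperate, ha.fderiv_eq, hb.fderiv_eq]
    ring

theorem integrable_temperate_mul {d : ℕ} {a : Space d → ℝ} (ha : a.HasTemperateGrowth)
    (f h : 𝓢(Space d, ℝ)) : Integrable (fun x => a x * f x * h x) volume := by
  have h1 : MemLp (SchwartzMap.smulLeftCLM ℝ a f) 2 (volume : Measure (Space d)) :=
    SchwartzMap.memLp _ 2 _
  have h2 := MemLp.integrable_mul (p := 2) (q := 2) h1 (h.memLp 2 volume)
  refine h2.congr (Filter.Eventually.of_forall fun x => ?_)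
  simp [SchwartzMap.smulLeftCLM_apply_apply ha]

theorem pderiv_smulLeft {d : ℕ} {a : Space d → ℝ} (ha : a.HasTemperateGrowth)
    (f : 𝓢(Space d, ℝ)) (j : Fin d) (x : Space d) :
    pderiv j (SchwartzMap.smulLeftCLM ℝ a f) x
      = a x * pderiv j f x + fderiv ℝ a x (stdVec j) * f x := by
  rw [pderiv_apply, pderiv_apply, SchwartzMap.smulLeftCLM_apply ha]
  have h2 : HasFDerivAt (fun x => a x • f x) _ x :=
    (temperate_differentiableAt ha x).hasFDerivAt.smul (f.hasFDerivAt x)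
  rw [h2.fderiv]
  simp

theorem integral_mul_pderiv {d : ℕ} {a : Space d → ℝ} (ha : a.HasTemperateGrowth)
    (f h : 𝓢(Space d, ℝ)) (j : Fin d) :
    ∫ x, a x * pderiv j f x * h x
      = -∫ x, f x * (a x * pderiv j h x + fderiv ℝ a x (stdVec j) * h x) := by
  have h1 := SchwartzMap.integral_mul_lineDerivOp_right_eq_neg_left (μ := volume)
    (SchwartzMap.smulLeftCLM ℝ a h) f (stdVec j)
  calc ∫ x, a x * pderiv j f x * h x
      = ∫ x, SchwartzMap.smulLeftCLM ℝ a h x * pderiv j f x := by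
        refine integral_congr_ae (Filter.Eventually.of_forall fun x => ?_)
        simp only [SchwartzMap.smulLeftCLM_apply_apply ha, smul_eq_mul]
        ring
    _ = -∫ x, pderiv j (SchwartzMap.smulLeftCLM ℝ a h) x * f x := h1
    _ = _ := by
        congr 1
        refine integral_congr_ae (Filter.Eventually.of_forall fun x => ?_)
        simp only [pderiv_smulLeft ha]
        ring

theorem pderiv_comm {d : ℕ} (f : 𝓢(Space d, ℝ)) (j k : Fin d) (x : Space d) :
    pderiv j (pderiv k f) x = pderiv k (pderiv j f) x := by
  have hs : IsSymmSndFDerivAt ℝ f x :=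
    (f.smooth 2).contDiffAt.isSymmSndFDerivAt (by simp)
  have h1 : ∀ i l : Fin d, pderiv i (pderiv l f) x
      = fderiv ℝ (fderiv ℝ f) x (stdVec i) (stdVec l) := by
    intro i l
    rw [pderiv_apply]
    have h2 : (pderiv l f : Space d → ℝ) = fun x => fderiv ℝ f x (stdVec l) :=
      funext fun x => pderiv_apply l f x
    have h3 : DifferentiableAt ℝ (fderiv ℝ f) x :=
      ((f.smooth 2).fderiv_right (m := 1) le_rfl).differentiable (by simp) x
    rw [h2, (h3.hasFDerivAt.clm_apply (hasFDerivAt_const (stdVec l) x)).fderiv]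
    simp
  rw [h1, h1]
  exact hs _ _

/-- The Euler operator `x · ∇` on Schwartz functions. -/
noncomputable def euler {d : ℕ} (f : 𝓢(Space d, ℝ)) : 𝓢(Space d, ℝ) :=
  ∑ k, SchwartzMap.smulLeftCLM ℝ (fun x : Space d => x k) (pderiv k f)

theorem schwartz_sum_apply {d : ℕ} {F : Type*} [NormedAddCommGroup F] [NormedSpace ℝ F]
    {ι : Type*} (s : Finset ι) (f : ι → 𝓢(Space d, F)) (x : Space d) :
    (∑ i ∈ s, f i) x = ∑ i ∈ s, f i x := by
  classical
  induction s using Finset.induction_on with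
  | empty => simp
  | insert a s ha ih => rw [Finset.sum_insert ha, Finset.sum_insert ha, add_apply, ih]

theorem euler_apply {d : ℕ} (f : 𝓢(Space d, ℝ)) (x : Space d) :
    euler f x = ∑ k, x k * pderiv k f x := by
  rw [euler, schwartz_sum_apply]
  refine Finset.sum_congr rfl fun k _ => ?_
  rw [SchwartzMap.smulLeftCLM_apply_apply (hasTemperateGrowth_coord k), smul_eq_mul]

theorem lap_apply {d : ℕ} {F : Type*} [NormedAddCommGroup F] [NormedSpace ℝ F]
    (f : 𝓢(Space d, F)) (x : Space d) : lap f x = ∑ k, pderiv k (pderiv k f) x :=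
  schwartz_sum_apply _ _ _

theorem pderiv_sum {d : ℕ} {ι : Type*} (s : Finset ι) (f : ι → 𝓢(Space d, ℝ)) (j : Fin d) :
    pderiv j (∑ i ∈ s, f i) = ∑ i ∈ s, pderiv j (f i) :=
  map_sum (LineDeriv.lineDerivOpCLM ℝ 𝓢(Space d, ℝ) (stdVec j)) f s

theorem pderiv_euler {d : ℕ} (f : 𝓢(Space d, ℝ)) (j : Fin d) (x : Space d) :
    pderiv j (euler f) x = euler (pderiv j f) x + pderiv j f x := by
  rw [euler, pderiv_sum, schwartz_sum_apply, euler_apply]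
  simp only [pderiv_smulLeft (hasTemperateGrowth_coord _), fderiv_coord]
  rw [Finset.sum_add_distrib]
  congr 1
  · exact Finset.sum_congr rfl fun k _ => by rw [pderiv_comm]
  · simp

theorem norm_sq_eq_sum {d : ℕ} (x : Space d) : ‖x‖ ^ 2 = ∑ k, x k * x k := by
  rw [EuclideanSpace.norm_sq_eq]
  exact Finset.sum_congr rfl fun k _ => by rw [Real.norm_eq_abs, sq_abs, sq]

/-- `∫ c (x · ∇f) f = -½ ∫ div(c x) f²`. -/
theorem integral_radial_euler {d : ℕ} {c c' : Space d → ℝ} (hc : RadialDeriv c c')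
    (f : 𝓢(Space d, ℝ)) :
    2 * ∫ x, c x * euler f x * f x = -∫ x, (d * c x + 2 * ‖x‖ ^ 2 * c' x) * f x * f x := by
  have hck : ∀ k : Fin d, (fun x : Space d => c x * x k).HasTemperateGrowth := fun k =>
    hc.temperate.mul (hasTemperateGrowth_coord k)
  have hdk : ∀ (k : Fin d) (x : Space d), fderiv ℝ (fun x : Space d => c x * x k) x (stdVec k)
      = c x + 2 * (x k * x k) * c' x := fun k x => by
    rw [fderiv_mul_apply hc.temperate (hasTemperateGrowth_coord k), fderiv_coord, hc.fderiv_eq]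
    simp
    ring
  have i1 : ∀ k : Fin d, Integrable (fun x => c x * x k * pderiv k f x * f x) volume := fun k =>
    integrable_temperate_mul (hck k) (pderiv k f) f
  have i2 : ∀ k : Fin d,
      Integrable (fun x => (c x + 2 * (x k * x k) * c' x) * f x * f x) volume := by
    intro k
    have i5 := MemLp.integrable_mul (p := 2) (q := 2)
      ((pderiv k (SchwartzMap.smulLeftCLM ℝ (fun x : Space d => c x * x k) f)).memLp 2 volume)
      (f.memLp 2 volume)
    refine (i5.sub (i1 k)).congr (Filter.Eventually.of_forall fun x => ?_)
    simp only [Pi.sub_apply, Pi.mul_apply, pderiv_smulLeft (hck k), hdk]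
    ring
  have h1 : ∀ k : Fin d, 2 * ∫ x, c x * x k * pderiv k f x * f x
      = -∫ x, (c x + 2 * (x k * x k) * c' x) * f x * f x := by
    intro k
    have h2 := integral_mul_pderiv (hck k) f f k
    have h3 : ∫ x, f x * (c x * x k * pderiv k f x
          + fderiv ℝ (fun x : Space d => c x * x k) x (stdVec k) * f x)
        = (∫ x, c x * x k * pderiv k f x * f x)
          + ∫ x, (c x + 2 * (x k * x k) * c' x) * f x * f x := by
      rw [← integral_add (i1 k) (i2 k)]
      refine integral_congr_ae (Filter.Eventually.of_forall fun x => ?_)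
      simp only [hdk]
      ring
    rw [h3] at h2
    linarith
  calc 2 * ∫ x, c x * euler f x * f x
      = 2 * ∫ x, ∑ k, c x * x k * pderiv k f x * f x := by
        congr 1
        refine integral_congr_ae (Filter.Eventually.of_forall fun x => ?_)
        simp only [euler_apply, Finset.mul_sum, Finset.sum_mul]
        exact Finset.sum_congr rfl fun k _ => by ring
    _ = ∑ k, 2 * ∫ x, c x * x k * pderiv k f x * f x := by
        rw [integral_finsetSum _ fun k _ => i1 k, Finset.mul_sum]
    _ = -∫ x, ∑ k, (c x + 2 * (x k * x k) * c' x) * f x * f x := by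
        rw [integral_finsetSum _ fun k _ => i2 k, ← Finset.sum_neg_distrib]
        exact Finset.sum_congr rfl fun k _ => h1 k
    _ = _ := by
        congr 1
        refine integral_congr_ae (Filter.Eventually.of_forall fun x => ?_)
        simp only [norm_sq_eq_sum, ← Finset.sum_mul, Finset.sum_add_distrib, ← Finset.mul_sum,
          Finset.sum_const, Finset.card_univ, Fintype.card_fin, nsmul_eq_mul]

theorem hasTemperateGrowth_norm_sq {d : ℕ} :
    (fun x : Space d => ‖x‖ ^ 2).HasTemperateGrowth :=
  Function.hasTemperateGrowth_norm_sq (H := Space d)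

/-- The squared length of the gradient of a Schwartz function. -/
noncomputable def gradSq {d : ℕ} (w : 𝓢(Space d, ℝ)) (x : Space d) : ℝ :=
  ∑ j, pderiv j w x * pderiv j w x

theorem integrable_gradSq {d : ℕ} {a : Space d → ℝ} (ha : a.HasTemperateGrowth)
    (w : 𝓢(Space d, ℝ)) : Integrable (fun x => a x * gradSq w x) volume := by
  have h := integrable_finsetSum (μ := volume) Finset.univ (f := fun (j : Fin d) (x : Space d) =>
    a x * pderiv j w x * pderiv j w x) fun j _ => integrable_temperate_mul ha _ _
  refine h.congr (Filter.Eventually.of_forall fun x => ?_)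
  simp only [gradSq, Finset.mul_sum]
  exact Finset.sum_congr rfl fun j _ => by ring

theorem euler_sq_le {d : ℕ} (w : 𝓢(Space d, ℝ)) (x : Space d) :
    euler w x ^ 2 ≤ ‖x‖ ^ 2 * gradSq w x := by
  rw [euler_apply, norm_sq_eq_sum, gradSq]
  have h := Finset.sum_mul_sq_le_sq_mul_sq Finset.univ (fun k => x k) fun k => pderiv k w x
  simpa only [sq] using h

/-- The self-adjoint normalisation `x · ∇ + (d - 1) / 2` of the Euler operator. -/
noncomputable def eulerN {d : ℕ} (w : 𝓢(Space d, ℝ)) : 𝓢(Space d, ℝ) :=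
  euler w + (((d : ℝ) - 1) / 2) • w

theorem eulerN_apply {d : ℕ} (w : 𝓢(Space d, ℝ)) (x : Space d) :
    eulerN w x = euler w x + ((d : ℝ) - 1) / 2 * w x := rfl

theorem pderiv_eulerN {d : ℕ} (w : 𝓢(Space d, ℝ)) (j : Fin d) (x : Space d) :
    pderiv j (eulerN w) x = euler (pderiv j w) x + (1 + ((d : ℝ) - 1) / 2) * pderiv j w x := by
  have h : pderiv j (eulerN w) = pderiv j (euler w) + (((d : ℝ) - 1) / 2) • pderiv j w := by
    rw [eulerN]
    exact (LineDeriv.lineDerivOp_add _ _ _).trans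
      (congrArg _ (LineDeriv.lineDerivOp_smul _ _ _))
  rw [h, add_apply, smul_apply, pderiv_euler, smul_eq_mul]
  ring

/-- The Rellich-type identity for `-Δ` and the radial multiplier `g (x · ∇ + (d - 1) / 2)`.
The summand `(d - 1) / 2` turns the coefficient `(1 - d / 2) g` of `|∇w|²` into `g / 2`. -/
theorem integral_lap_mul_eulerN {d : ℕ} {g g₁ g₂ : Space d → ℝ} (hg : RadialDeriv g g₁)
    (hg₁ : RadialDeriv g₁ g₂) (hg₂ : g₂.HasTemperateGrowth) (w : 𝓢(Space d, ℝ)) :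
    -∫ x, g x * lap w x * eulerN w x
      = ∫ x, (2 * g₁ x * (euler w x * euler w x)
        + (g x / 2 - ‖x‖ ^ 2 * g₁ x) * gradSq w x
        - ((d : ℝ) - 1) / 2 * (d * g₁ x + 2 * ‖x‖ ^ 2 * g₂ x) * w x * w x) := by
  set ν : ℝ := ((d : ℝ) - 1) / 2 with hν
  have tg := hg.temperate
  have tg₁ := hg₁.temperate
  have tr := hasTemperateGrowth_norm_sq (d := d)
  have hj : ∀ j : Fin d, ∫ x, g x * pderiv j (pderiv j w) x * eulerN w x
      = -((∫ x, g x * euler (pderiv j w) x * pderiv j w x)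
        + (1 + ν) * (∫ x, g x * pderiv j w x * pderiv j w x)
        + ∫ x, g₁ x * (2 * x j) * pderiv j w x * eulerN w x) := by
    intro j
    have i1 := integrable_temperate_mul tg (euler (pderiv j w)) (pderiv j w)
    have i2 := integrable_temperate_mul tg (pderiv j w) (pderiv j w)
    have i3 : Integrable (fun x => g₁ x * (2 * x j) * pderiv j w x * eulerN w x) volume :=
      integrable_temperate_mul (tg₁.mul ((Function.HasTemperateGrowth.const 2).mul
      (hasTemperateGrowth_coord j))) (pderiv j w) (eulerN w)
    rw [integral_mul_pderiv tg, ← integral_const_mul, ← integral_add i1 (i2.const_mul _),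
      ← integral_add (i1.fun_add (i2.const_mul _)) i3]
    congr 1
    refine integral_congr_ae (Filter.Eventually.of_forall fun x => ?_)
    simp only [pderiv_eulerN, hg.fderiv_eq]
    ring
  have h1 : ∫ x, g x * lap w x * eulerN w x
      = ∑ j, ∫ x, g x * pderiv j (pderiv j w) x * eulerN w x := by
    rw [← integral_finsetSum _ fun j _ => integrable_temperate_mul tg _ _]
    refine integral_congr_ae (Filter.Eventually.of_forall fun x => ?_)
    simp only [lap_apply, Finset.mul_sum, Finset.sum_mul]
  have h2 : ∑ j, ∫ x, g x * euler (pderiv j w) x * pderiv j w x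
      = -(1 / 2) * ∫ x, (d * g x + 2 * ‖x‖ ^ 2 * g₁ x) * gradSq w x := by
    have tc : (fun x : Space d => (d : ℝ) * g x + 2 * ‖x‖ ^ 2 * g₁ x).HasTemperateGrowth :=
      ((Function.HasTemperateGrowth.const (d : ℝ)).mul tg).add
        (((Function.HasTemperateGrowth.const (2 : ℝ)).mul tr).mul tg₁)
    have h3 : ∫ x, (d * g x + 2 * ‖x‖ ^ 2 * g₁ x) * gradSq w x
        = ∑ j, ∫ x, (d * g x + 2 * ‖x‖ ^ 2 * g₁ x) * pderiv j w x * pderiv j w x := by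
      rw [← integral_finsetSum _ fun j _ => integrable_temperate_mul tc _ _]
      refine integral_congr_ae (Filter.Eventually.of_forall fun x => ?_)
      simp only [gradSq, Finset.mul_sum]
      exact Finset.sum_congr rfl fun j _ => by ring
    rw [h3, Finset.mul_sum]
    refine Finset.sum_congr rfl fun j _ => ?_
    have := integral_radial_euler hg (pderiv j w)
    linarith
  have h4 : ∑ j, ∫ x, g x * pderiv j w x * pderiv j w x = ∫ x, g x * gradSq w x := by
    rw [← integral_finsetSum _ fun j _ => integrable_temperate_mul tg _ _]
    refine integral_congr_ae (Filter.Eventually.of_forall fun x => ?_)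
    simp only [gradSq, Finset.mul_sum]
    exact Finset.sum_congr rfl fun j _ => by ring
  have tg2 : (fun x : Space d => 2 * g₁ x).HasTemperateGrowth :=
    (Function.HasTemperateGrowth.const (2 : ℝ)).mul tg₁
  have iA := integrable_temperate_mul tg2 (euler w) (euler w)
  have iB := integrable_temperate_mul tg₁ (euler w) w
  have h5 : ∑ j : Fin d, ∫ x, g₁ x * (2 * x j) * pderiv j w x * eulerN w x
      = (∫ x, 2 * g₁ x * euler w x * euler w x) + 2 * ν * ∫ x, g₁ x * euler w x * w x := by
    have i3 : ∀ j : Fin d, Integrable (fun x => g₁ x * (2 * x j) * pderiv j w x * eulerN w x)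
      volume := fun j => integrable_temperate_mul (tg₁.mul ((Function.HasTemperateGrowth.const 2).mul
      (hasTemperateGrowth_coord j))) (pderiv j w) (eulerN w)
    rw [← integral_finsetSum _ fun j _ => i3 j, ← integral_const_mul,
      ← integral_add iA (iB.const_mul _)]
    refine integral_congr_ae (Filter.Eventually.of_forall fun x => ?_)
    have h6 : ∑ j : Fin d, g₁ x * (2 * x j) * pderiv j w x * eulerN w x
        = 2 * g₁ x * euler w x * eulerN w x := by
      rw [euler_apply, Finset.mul_sum, Finset.sum_mul]
      exact Finset.sum_congr rfl fun j _ => by ring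
    simp only [h6]
    rw [eulerN_apply]
    ring
  have h7 := integral_radial_euler hg₁ w
  have tc₁ : (fun x : Space d => (d : ℝ) * g₁ x + 2 * ‖x‖ ^ 2 * g₂ x).HasTemperateGrowth :=
    ((Function.HasTemperateGrowth.const (d : ℝ)).mul tg₁).add
      (((Function.HasTemperateGrowth.const (2 : ℝ)).mul tr).mul hg₂)
  have tc : (fun x : Space d => (d : ℝ) * g x + 2 * ‖x‖ ^ 2 * g₁ x).HasTemperateGrowth :=
    ((Function.HasTemperateGrowth.const (d : ℝ)).mul tg).add
      (((Function.HasTemperateGrowth.const (2 : ℝ)).mul tr).mul tg₁)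
  have iC := integrable_temperate_mul tc₁ w w
  have iD := integrable_gradSq tg w
  have iE := integrable_gradSq tc w
  rw [h1, Finset.sum_congr rfl fun j _ => hj j, Finset.sum_neg_distrib, neg_neg,
    Finset.sum_add_distrib, Finset.sum_add_distrib, ← Finset.mul_sum, h2, h4, h5]
  have h8 : ν * (2 * ∫ x, g₁ x * euler w x * w x)
      = -ν * ∫ x, (d * g₁ x + 2 * ‖x‖ ^ 2 * g₂ x) * w x * w x := by rw [h7]; ring
  have h9 : 2 * ν * ∫ x, g₁ x * euler w x * w x
      = -ν * ∫ x, (d * g₁ x + 2 * ‖x‖ ^ 2 * g₂ x) * w x * w x := by rw [← h8]; ring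
  rw [h9, ← integral_const_mul, ← integral_const_mul, ← integral_const_mul,
    ← integral_add (iE.const_mul _) (iD.const_mul _), ← integral_add iA (iC.const_mul _),
    ← integral_add ((iE.const_mul _).fun_add (iD.const_mul _)) (iA.fun_add (iC.const_mul _))]
  refine integral_congr_ae (Filter.Eventually.of_forall fun x => ?_)
  simp only [hν]
  ring

/-! ### The Carleman inequality for real Schwartz functions -/

/-- The radial functions which enter the Carleman estimate at energy `lam ^ 2`. A subscript counts
derivatives with respect to `|x|²`. The weight is `exp φ` with `∇φ = θ x`, the multiplier is
`g (x · ∇ + (d - 1) / 2)`, `m` and `q` are the coefficients of `|∇w|²` and `|w|²` in the lower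
bound, and `mγ x` is the vector field of a weighted Hardy inequality. -/
structure CarlemanWeight (d : ℕ) (lam : ℝ) where
  (φ g g₁ g₂ θ θ₁ θ₂ m q γ β₁ : Space d → ℝ)
  exp_φ : (fun x => Real.exp (φ x)).HasTemperateGrowth
  fderiv_φ : ∀ j x, fderiv ℝ (fun x => Real.exp (φ x)) x (stdVec j)
    = Real.exp (φ x) * (θ x * x j)
  radial_g : RadialDeriv g g₁
  radial_g₁ : RadialDeriv g₁ g₂
  temperate_g₂ : g₂.HasTemperateGrowth
  radial_θ : RadialDeriv θ θ₁
  radial_θ₁ : RadialDeriv θ₁ θ₂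
  temperate_θ₂ : θ₂.HasTemperateGrowth
  temperate_m : m.HasTemperateGrowth
  temperate_q : q.HasTemperateGrowth
  temperate_γ : γ.HasTemperateGrowth
  radial_mγ : RadialDeriv (fun x => m x * γ x) β₁
  temperate_β₁ : β₁.HasTemperateGrowth
  g_pos : ∀ x, 0 < g x
  g₁_nonpos : ∀ x, g₁ x ≤ 0
  m_nonneg : ∀ x, 0 ≤ m x
  m_le : ∀ x, m x ≤ g x + 2 * ‖x‖ ^ 2 * g₁ x
  q_le : ∀ x, q x ≤ -(((d : ℝ) - 1) / 2 * (d * g₁ x + 2 * ‖x‖ ^ 2 * g₂ x))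
    - 1 / 2 * ((θ x + 2 * ‖x‖ ^ 2 * θ₁ x - θ x ^ 2 * ‖x‖ ^ 2 - lam ^ 2)
        * (g x + 2 * ‖x‖ ^ 2 * g₁ x)
      + 2 * ‖x‖ ^ 2 * (3 * θ₁ x + 2 * ‖x‖ ^ 2 * θ₂ x - θ x ^ 2 - 2 * ‖x‖ ^ 2 * θ x * θ₁ x) * g x)
    + 1 / 4 * (d * (m x * γ x) + 2 * ‖x‖ ^ 2 * β₁ x - m x * γ x ^ 2 * ‖x‖ ^ 2)

namespace CarlemanWeight

/-- The potential of the conjugated operator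
`exp φ (-Δ - lam²) exp (-φ) = -Δ + 2θ(x · ∇ + (d - 1) / 2) + A`. -/
noncomputable def potential {d : ℕ} {lam : ℝ} (W : CarlemanWeight d lam) (x : Space d) : ℝ :=
  W.θ x + 2 * ‖x‖ ^ 2 * W.θ₁ x - W.θ x ^ 2 * ‖x‖ ^ 2 - lam ^ 2

theorem radial_norm_sq {d : ℕ} : RadialDeriv (fun x : Space d => ‖x‖ ^ 2) fun _ => 1 where
  temperate := hasTemperateGrowth_norm_sq
  fderiv_eq j x := by
    rw [fderiv_norm_sq_apply]
    simp [stdVec, EuclideanSpace.inner_single_right]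

theorem radial_const {d : ℕ} (c : ℝ) : RadialDeriv (fun _ : Space d => c) fun _ => 0 where
  temperate := Function.HasTemperateGrowth.const c
  fderiv_eq j x := by simp

theorem _root_.RadialDeriv.add {d : ℕ} {a a' b b' : Space d → ℝ} (ha : RadialDeriv a a')
    (hb : RadialDeriv b b') : RadialDeriv (fun x => a x + b x) (fun x => a' x + b' x) where
  temperate := ha.temperate.add hb.temperate
  fderiv_eq j x := by
    have h : HasFDerivAt (fun x => a x + b x) _ x :=
      (temperate_differentiableAt ha.temperate x).hasFDerivAt.add
        (temperate_differentiableAt hb.temperate x).hasFDerivAt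
    rw [h.fderiv, add_apply, ha.fderiv_eq, hb.fderiv_eq]
    ring

theorem radial_potential {d : ℕ} {lam : ℝ} (W : CarlemanWeight d lam) :
    RadialDeriv W.potential fun x => 3 * W.θ₁ x + 2 * ‖x‖ ^ 2 * W.θ₂ x - W.θ x ^ 2
      - 2 * ‖x‖ ^ 2 * W.θ x * W.θ₁ x := by
  have h := ((W.radial_θ.add (((radial_const 2).mul radial_norm_sq).mul W.radial_θ₁)).add
    (((radial_const (-1)).mul (W.radial_θ.mul W.radial_θ)).mul radial_norm_sq)).add
    (radial_const (-lam ^ 2))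
  convert h using 2
  · simp only [potential]
    ring
  · ring

/-- The difference of the two sides of the Carleman inequality, before integration. -/
noncomputable def defect {d : ℕ} {lam : ℝ} (W : CarlemanWeight d lam)
    (w : 𝓢(Space d, ℝ)) (x : Space d) : ℝ :=
  (-lap w x + 2 * W.θ x * eulerN w x + W.potential x * w x) * (W.g x * eulerN w x)
    - (W.m x / 4 * gradSq w x + 2 * W.θ x * W.g x * (eulerN w x * eulerN w x)
      + W.q x * (w x * w x))

/-- The Carleman inequality for the conjugated operator and a real Schwartz function. Integration by
parts and a Hardy inequality turn the two sides into integrals which are compared pointwise. -/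
theorem integral_defect_nonneg {d : ℕ} {lam : ℝ} (W : CarlemanWeight d lam)
    (w : 𝓢(Space d, ℝ)) : Integrable (W.defect w) volume ∧ 0 ≤ ∫ x, W.defect w x := by
  have tg := W.radial_g.temperate
  have tg₁ := W.radial_g₁.temperate
  have tg₂ := W.temperate_g₂
  have tθ := W.radial_θ.temperate
  have tθ₁ := W.radial_θ₁.temperate
  have tθ₂ := W.temperate_θ₂
  have tm := W.temperate_m
  have tq := W.temperate_q
  have tγ := W.temperate_γ
  have tβ₁ := W.temperate_β₁
  have tA := W.radial_potential.temperate
  have tr := hasTemperateGrowth_norm_sq (d := d)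
  have hB := W.radial_potential.mul W.radial_g
  have e1 := integral_lap_mul_eulerN W.radial_g W.radial_g₁ W.temperate_g₂ w
  have e2 := integral_radial_euler hB w
  have e3 := integral_radial_euler W.radial_mγ w
  have tC : ∀ c : ℝ, (fun _ : Space d => c).HasTemperateGrowth := fun c => .const c
  have i1 : Integrable (fun x => W.g x * lap w x * eulerN w x) volume :=
    integrable_temperate_mul tg _ _
  have i2 : Integrable (fun x => 2 * W.θ x * W.g x * eulerN w x * eulerN w x) volume :=
    integrable_temperate_mul (((tC 2).mul tθ).mul tg) _ _
  have i3 : Integrable (fun x => W.potential x * W.g x * euler w x * w x) volume :=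
    integrable_temperate_mul (tA.mul tg) _ _
  have i4 : Integrable (fun x => W.potential x * W.g x * w x * w x) volume :=
    integrable_temperate_mul (tA.mul tg) _ _
  have i5 : Integrable (fun x => W.m x * W.γ x * euler w x * w x) volume :=
    integrable_temperate_mul (tm.mul tγ) _ _
  have j1 : Integrable (fun x => 2 * W.g₁ x * euler w x * euler w x) volume :=
    integrable_temperate_mul ((tC 2).mul tg₁) _ _
  have j2 : Integrable (fun x => (W.g x * (1 / 2) + -1 * ‖x‖ ^ 2 * W.g₁ x) * gradSq w x) volume :=
    integrable_gradSq ((tg.mul (tC (1 / 2))).add (((tC (-1)).mul tr).mul tg₁)) _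
  have j3 : Integrable (fun x => (d * W.g₁ x + 2 * ‖x‖ ^ 2 * W.g₂ x) * w x * w x) volume :=
    integrable_temperate_mul (((tC d).mul tg₁).add (((tC 2).mul tr).mul tg₂)) _ _
  have j4 : Integrable (fun x => (d * (W.potential x * W.g x) + 2 * ‖x‖ ^ 2 *
      ((3 * W.θ₁ x + 2 * ‖x‖ ^ 2 * W.θ₂ x + -1 * (W.θ x * W.θ x)
        + -2 * ‖x‖ ^ 2 * W.θ x * W.θ₁ x) * W.g x + W.potential x * W.g₁ x)) * w x * w x) volume :=
    integrable_temperate_mul (((tC d).mul (tA.mul tg)).add (((tC 2).mul tr).mul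
      (((((((tC 3).mul tθ₁).add (((tC 2).mul tr).mul tθ₂)).add ((tC (-1)).mul (tθ.mul tθ))).add
        ((((tC (-2)).mul tr).mul tθ).mul tθ₁)).mul tg).add (tA.mul tg₁)))) _ _
  have j5 : Integrable (fun x => (d * (W.m x * W.γ x) + 2 * ‖x‖ ^ 2 * W.β₁ x) * w x * w x)
      volume :=
    integrable_temperate_mul (((tC d).mul (tm.mul tγ)).add (((tC 2).mul tr).mul tβ₁)) _ _
  have j6 : Integrable (fun x => W.m x * (W.γ x * W.γ x) * ‖x‖ ^ 2 * w x * w x) volume :=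
    integrable_temperate_mul ((tm.mul (tγ.mul tγ)).mul tr) _ _
  have j7 : Integrable (fun x => W.m x * gradSq w x) volume := integrable_gradSq tm _
  have j8 : Integrable (fun x => W.q x * w x * w x) volume := integrable_temperate_mul tq _ _
  have hL : ∫ x, (W.m x / 4 * gradSq w x + 2 * W.θ x * W.g x * (eulerN w x * eulerN w x)
        + W.q x * (w x * w x))
      = 1 / 4 * (∫ x, W.m x * gradSq w x) + (∫ x, 2 * W.θ x * W.g x * eulerN w x * eulerN w x)
        + ∫ x, W.q x * w x * w x := by
    rw [← integral_const_mul, ← integral_add (j7.const_mul _) i2,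
      ← integral_add ((j7.const_mul _).fun_add i2) j8]
    refine integral_congr_ae (Filter.Eventually.of_forall fun x => ?_)
    ring
  have hR : ∫ x, (-lap w x + 2 * W.θ x * eulerN w x + W.potential x * w x) * (W.g x * eulerN w x)
      = -(∫ x, W.g x * lap w x * eulerN w x)
        + (∫ x, 2 * W.θ x * W.g x * eulerN w x * eulerN w x)
        + ((∫ x, W.potential x * W.g x * euler w x * w x)
          + ((d : ℝ) - 1) / 2 * ∫ x, W.potential x * W.g x * w x * w x) := by
    rw [← integral_neg, ← integral_const_mul, ← integral_add i1.fun_neg i2,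
      ← integral_add i3 (i4.const_mul _),
      ← integral_add (i1.fun_neg.fun_add i2) (i3.fun_add (i4.const_mul _))]
    refine integral_congr_ae (Filter.Eventually.of_forall fun x => ?_)
    simp only [eulerN_apply]
    ring
  have hE1 : -(∫ x, W.g x * lap w x * eulerN w x)
      = (∫ x, 2 * W.g₁ x * euler w x * euler w x)
        + (∫ x, (W.g x * (1 / 2) + -1 * ‖x‖ ^ 2 * W.g₁ x) * gradSq w x)
        + -(((d : ℝ) - 1) / 2) * ∫ x, (d * W.g₁ x + 2 * ‖x‖ ^ 2 * W.g₂ x) * w x * w x := by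
    rw [e1, ← integral_const_mul, ← integral_add j1 j2,
      ← integral_add (j1.fun_add j2) (j3.const_mul _)]
    refine integral_congr_ae (Filter.Eventually.of_forall fun x => ?_)
    ring
  have hE2 : 2 * ∫ x, W.potential x * W.g x * euler w x * w x
      = -∫ x, (d * (W.potential x * W.g x) + 2 * ‖x‖ ^ 2 *
      ((3 * W.θ₁ x + 2 * ‖x‖ ^ 2 * W.θ₂ x + -1 * (W.θ x * W.θ x)
        + -2 * ‖x‖ ^ 2 * W.θ x * W.θ₁ x) * W.g x + W.potential x * W.g₁ x)) * w x * w x := by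
    rw [e2]
    congr 1
    refine integral_congr_ae (Filter.Eventually.of_forall fun x => ?_)
    ring
  -- integrating `m |∇w + γ w x|² ≥ 0` gives the Hardy inequality
  have hH : 0 ≤ (∫ x, W.m x * gradSq w x)
      + (2 * (∫ x, W.m x * W.γ x * euler w x * w x)
        + ∫ x, W.m x * (W.γ x * W.γ x) * ‖x‖ ^ 2 * w x * w x) := by
    rw [← integral_const_mul, ← integral_add (i5.const_mul _) j6,
      ← integral_add j7 ((i5.const_mul _).fun_add j6)]
    refine integral_nonneg fun x => ?_
    have h1 : ∑ j, (pderiv j w x + W.γ x * w x * x j) ^ 2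
        = gradSq w x + 2 * W.γ x * w x * euler w x + (W.γ x * w x) ^ 2 * ‖x‖ ^ 2 := by
      rw [gradSq, euler_apply, norm_sq_eq_sum, Finset.mul_sum, Finset.mul_sum,
        ← Finset.sum_add_distrib, ← Finset.sum_add_distrib]
      exact Finset.sum_congr rfl fun j _ => by ring
    have h2 : 0 ≤ ∑ j, (pderiv j w x + W.γ x * w x * x j) ^ 2 :=
      Finset.sum_nonneg fun j _ => sq_nonneg _
    have h3 := mul_nonneg (W.m_nonneg x) h2
    rw [h1] at h3
    change 0 ≤ W.m x * gradSq w x + _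
    linarith
  have hP : 0 ≤ ((∫ x, 2 * W.g₁ x * euler w x * euler w x)
        + (∫ x, (W.g x * (1 / 2) + -1 * ‖x‖ ^ 2 * W.g₁ x) * gradSq w x))
      + ((-(((d : ℝ) - 1) / 2) * (∫ x, (d * W.g₁ x + 2 * ‖x‖ ^ 2 * W.g₂ x) * w x * w x)
        + -(1 / 2) * (∫ x, (d * (W.potential x * W.g x) + 2 * ‖x‖ ^ 2 *
      ((3 * W.θ₁ x + 2 * ‖x‖ ^ 2 * W.θ₂ x + -1 * (W.θ x * W.θ x)
        + -2 * ‖x‖ ^ 2 * W.θ x * W.θ₁ x) * W.g x + W.potential x * W.g₁ x)) * w x * w x))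
      + ((((d : ℝ) - 1) / 2 * (∫ x, W.potential x * W.g x * w x * w x)
        + -(1 / 2) * (∫ x, W.m x * gradSq w x))
      + ((-1 * (∫ x, W.q x * w x * w x)
        + 1 / 4 * (∫ x, (d * (W.m x * W.γ x) + 2 * ‖x‖ ^ 2 * W.β₁ x) * w x * w x))
        + -(1 / 4) * (∫ x, W.m x * (W.γ x * W.γ x) * ‖x‖ ^ 2 * w x * w x)))) := by
    simp only [← integral_const_mul]
    rw [← integral_add j1 j2, ← integral_add (j3.const_mul _) (j4.const_mul _),
      ← integral_add (i4.const_mul _) (j7.const_mul _),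
      ← integral_add (j8.const_mul _) (j5.const_mul _),
      ← integral_add ((j8.const_mul _).fun_add (j5.const_mul _)) (j6.const_mul _),
      ← integral_add ((i4.const_mul _).fun_add (j7.const_mul _))
        (((j8.const_mul _).fun_add (j5.const_mul _)).fun_add (j6.const_mul _)),
      ← integral_add ((j3.const_mul _).fun_add (j4.const_mul _))
        (((i4.const_mul _).fun_add (j7.const_mul _)).fun_add
        (((j8.const_mul _).fun_add (j5.const_mul _)).fun_add (j6.const_mul _))),
      ← integral_add (j1.fun_add j2) (((j3.const_mul _).fun_add (j4.const_mul _)).fun_add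
        (((i4.const_mul _).fun_add (j7.const_mul _)).fun_add
        (((j8.const_mul _).fun_add (j5.const_mul _)).fun_add (j6.const_mul _))))]
    refine integral_nonneg fun x => ?_
    -- since `g₁ ≤ 0` the radial derivative may be replaced by the full gradient
    have h1 := mul_nonneg (neg_nonneg.2 (W.g₁_nonpos x)) (sub_nonneg.2 (euler_sq_le w x))
    have h2 : 0 ≤ gradSq w x := Finset.sum_nonneg fun j _ => mul_self_nonneg _
    have h3 := mul_nonneg (sub_nonneg.2 (W.m_le x)) h2
    have h4 := mul_nonneg (sub_nonneg.2 (W.q_le x)) (sq_nonneg (w x))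
    simp only [Pi.zero_apply, potential]
    linarith
  have iL : Integrable (fun x => W.m x / 4 * gradSq w x
      + 2 * W.θ x * W.g x * (eulerN w x * eulerN w x) + W.q x * (w x * w x)) volume := by
    refine (((j7.const_mul (1 / 4)).fun_add i2).fun_add j8).congr
      (Filter.Eventually.of_forall fun x => ?_)
    ring
  have iR : Integrable (fun x => (-lap w x + 2 * W.θ x * eulerN w x + W.potential x * w x)
      * (W.g x * eulerN w x)) volume := by
    refine ((i1.fun_neg.fun_add i2).fun_add
      (i3.fun_add (i4.const_mul (((d : ℝ) - 1) / 2)))).congr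
      (Filter.Eventually.of_forall fun x => ?_)
    simp only [eulerN_apply]
    ring
  refine ⟨iR.sub iL, ?_⟩
  have h := integral_sub iR iL
  change ∫ x, W.defect w x = _ at h
  rw [h, hL, hR, hE1]
  linarith

end CarlemanWeight

/-! ### The Carleman inequality for complex Schwartz functions -/

theorem pderiv_postcomp {d : ℕ} (L : ℂ →L[ℝ] ℝ) (w : 𝓢(Space d, ℂ)) (j : Fin d) :
    pderiv j (SchwartzMap.postcompCLM (𝕜 := ℝ) L w)
      = SchwartzMap.postcompCLM (𝕜 := ℝ) L (pderiv j w) := by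
  ext x
  rw [SchwartzMap.postcompCLM_apply, pderiv_apply, pderiv_apply]
  have h : HasFDerivAt (SchwartzMap.postcompCLM (𝕜 := ℝ) L w) (L.comp (fderiv ℝ w x)) x :=
    L.hasFDerivAt.comp x (w.hasFDerivAt x)
  rw [h.fderiv]
  simp

theorem lap_postcomp {d : ℕ} (L : ℂ →L[ℝ] ℝ) (w : 𝓢(Space d, ℂ)) (x : Space d) :
    lap (SchwartzMap.postcompCLM (𝕜 := ℝ) L w) x = L (lap w x) := by
  simp only [lap_apply, pderiv_postcomp, SchwartzMap.postcompCLM_apply, map_sum]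

namespace CarlemanWeight

variable {d : ℕ} {lam : ℝ}

/-- `exp (-φ) ∇ exp φ`, applied to a Schwartz function. -/
noncomputable def twistedGrad (W : CarlemanWeight d lam) (j : Fin d) (y : 𝓢(Space d, ℂ))
    (x : Space d) : ℂ := pderiv j y x + ((W.θ x * x j : ℝ) : ℂ) * y x

/-- `g exp (-φ) (x · ∇ + (d - 1) / 2) exp φ`, applied to a Schwartz function. -/
noncomputable def multiplier (W : CarlemanWeight d lam) (y : 𝓢(Space d, ℂ)) (x : Space d) : ℂ :=
  (∑ j, ((W.g x * x j : ℝ) : ℂ) * pderiv j y x)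
    + ((W.g x * (W.θ x * ‖x‖ ^ 2 + ((d : ℝ) - 1) / 2) : ℝ) : ℂ) * y x

/-- `exp φ y` as a Schwartz function. -/
noncomputable def conjugate (W : CarlemanWeight d lam) (y : 𝓢(Space d, ℂ)) : 𝓢(Space d, ℂ) :=
  SchwartzMap.smulLeftCLM ℂ (fun x => Real.exp (W.φ x)) y

theorem conjugate_apply (W : CarlemanWeight d lam) (y : 𝓢(Space d, ℂ)) (x : Space d) :
    W.conjugate y x = (Real.exp (W.φ x) : ℂ) * y x := by
  rw [conjugate, SchwartzMap.smulLeftCLM_apply_apply W.exp_φ, Complex.real_smul]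

theorem temperate_θ_coord (W : CarlemanWeight d lam) (j : Fin d) :
    (fun x : Space d => W.θ x * x j).HasTemperateGrowth :=
  W.radial_θ.temperate.mul (hasTemperateGrowth_coord j)

theorem pderiv_conjugate (W : CarlemanWeight d lam) (y : 𝓢(Space d, ℂ)) (j : Fin d) :
    pderiv j (W.conjugate y)
      = W.conjugate (pderiv j y + SchwartzMap.smulLeftCLM ℂ (fun x => W.θ x * x j) y) := by
  ext x
  rw [conjugate_apply, conjugate, pderiv_real_smul W.exp_φ, W.fderiv_φ, add_apply,
    SchwartzMap.smulLeftCLM_apply_apply (W.temperate_θ_coord j), Complex.real_smul]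
  push_cast
  ring

theorem pderiv_conjugate_apply (W : CarlemanWeight d lam) (y : 𝓢(Space d, ℂ)) (j : Fin d)
    (x : Space d) :
    pderiv j (W.conjugate y) x = (Real.exp (W.φ x) : ℂ) * W.twistedGrad j y x := by
  rw [pderiv_conjugate, conjugate_apply, add_apply,
    SchwartzMap.smulLeftCLM_apply_apply (W.temperate_θ_coord j), Complex.real_smul, twistedGrad]

theorem lap_conjugate (W : CarlemanWeight d lam) (y : 𝓢(Space d, ℂ)) (x : Space d) :
    lap (W.conjugate y) x = (Real.exp (W.φ x) : ℂ) * (lap y x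
      + 2 * (W.θ x : ℂ) * ∑ j, (x j : ℂ) * pderiv j y x
      + ((d * W.θ x + 2 * ‖x‖ ^ 2 * W.θ₁ x + W.θ x ^ 2 * ‖x‖ ^ 2 : ℝ) : ℂ) * y x) := by
  have h : ∀ j, pderiv j (pderiv j (W.conjugate y)) x = (Real.exp (W.φ x) : ℂ) *
      (pderiv j (pderiv j y) x + 2 * (W.θ x : ℂ) * ((x j : ℂ) * pderiv j y x)
        + ((W.θ x + 2 * (x j * x j) * W.θ₁ x + W.θ x ^ 2 * (x j * x j) : ℝ) : ℂ) * y x) := by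
    intro j
    rw [pderiv_conjugate, pderiv_conjugate_apply, twistedGrad]
    have h1 : pderiv j (pderiv j y + SchwartzMap.smulLeftCLM ℂ (fun x => W.θ x * x j) y)
        = pderiv j (pderiv j y) + pderiv j (SchwartzMap.smulLeftCLM ℂ (fun x => W.θ x * x j) y) :=
      pderiv_add _ _ _
    rw [h1, add_apply, add_apply, pderiv_real_smul (W.temperate_θ_coord j),
      SchwartzMap.smulLeftCLM_apply_apply (W.temperate_θ_coord j), Complex.real_smul,
      fderiv_mul_apply W.radial_θ.temperate (hasTemperateGrowth_coord j), fderiv_coord,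
      W.radial_θ.fderiv_eq]
    simp only [if_true]
    push_cast
    ring
  rw [lap_apply, Finset.sum_congr rfl fun j _ => h j, ← Finset.mul_sum]
  congr 1
  rw [Finset.sum_add_distrib, Finset.sum_add_distrib, ← lap_apply, ← Finset.mul_sum,
    ← Finset.sum_mul, ← Complex.ofReal_sum, Finset.sum_add_distrib, Finset.sum_add_distrib,
    ← Finset.sum_mul, ← Finset.mul_sum, ← Finset.mul_sum, ← norm_sq_eq_sum]
  simp

theorem eulerN_postcomp (W : CarlemanWeight d lam) (L : ℂ →L[ℝ] ℝ) (y : 𝓢(Space d, ℂ))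
    (x : Space d) :
    W.g x * eulerN (SchwartzMap.postcompCLM (𝕜 := ℝ) L (W.conjugate y)) x
      = Real.exp (W.φ x) * L (W.multiplier y x) := by
  have hL : ∀ (r : ℝ) (z : ℂ), L ((r : ℂ) * z) = r * L z := fun r z => by
    rw [← Complex.real_smul, map_smul, smul_eq_mul]
  rw [eulerN_apply, euler_apply]
  simp only [pderiv_postcomp, SchwartzMap.postcompCLM_apply, pderiv_conjugate_apply, hL,
    multiplier, map_add, map_sum, twistedGrad, conjugate_apply, norm_sq_eq_sum]
  simp only [mul_add, Finset.mul_sum, Finset.sum_add_distrib]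
  have h1 : ∀ k, W.g x * (x k * (Real.exp (W.φ x) * L (pderiv k y x)))
      = Real.exp (W.φ x) * (W.g x * x k * L (pderiv k y x)) := fun k => by ring
  have h2 : ∀ k, W.g x * (x k * (Real.exp (W.φ x) * (W.θ x * x k * L (y x))))
      = Real.exp (W.φ x) * (W.g x * (W.θ x * (x k * x k)) * L (y x)) := fun k => by ring
  simp only [h1, h2, add_mul, mul_add, Finset.mul_sum, Finset.sum_mul]
  ring

/-- The Carleman inequality for complex Schwartz functions: the real inequality for the real and the
imaginary part of `exp φ y`. -/
theorem carleman_schwartz (W : CarlemanWeight d lam) (y : 𝓢(Space d, ℂ)) :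
    0 ≤ ∫ x, Real.exp (W.φ x) ^ 2 * (((starRingEnd ℂ) (W.multiplier y x)
        * (-lap y x - (lam : ℂ) ^ 2 * y x)).re
      - (W.m x / 4 * (∑ j, ‖W.twistedGrad j y x‖ ^ 2)
        + 2 * (W.θ x / W.g x) * ‖W.multiplier y x‖ ^ 2 + W.q x * ‖y x‖ ^ 2)) := by
  have hr := W.integral_defect_nonneg (SchwartzMap.postcompCLM (𝕜 := ℝ) Complex.reCLM (W.conjugate y))
  have hi := W.integral_defect_nonneg (SchwartzMap.postcompCLM (𝕜 := ℝ) Complex.imCLM (W.conjugate y))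
  have h := add_nonneg hr.2 hi.2
  rw [← integral_add hr.1 hi.1] at h
  refine h.trans_eq (integral_congr_ae (Filter.Eventually.of_forall fun x => ?_))
  have hg := (W.g_pos x).ne'
  have key : ∀ L : ℂ →L[ℝ] ℝ,
      W.defect (SchwartzMap.postcompCLM (𝕜 := ℝ) L (W.conjugate y)) x
      = Real.exp (W.φ x) ^ 2 * (L (-lap y x - (lam : ℂ) ^ 2 * y x) * L (W.multiplier y x)
        - (W.m x / 4 * (∑ j, L (W.twistedGrad j y x) ^ 2)
        + 2 * (W.θ x / W.g x) * L (W.multiplier y x) ^ 2 + W.q x * L (y x) ^ 2)) := by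
    intro L
    have hL : ∀ (r : ℝ) (z : ℂ), L ((r : ℂ) * z) = r * L z := fun r z => by
      rw [← Complex.real_smul, map_smul, smul_eq_mul]
    have hN : eulerN (SchwartzMap.postcompCLM (𝕜 := ℝ) L (W.conjugate y)) x
        = Real.exp (W.φ x) * L (W.multiplier y x) / W.g x := by
      rw [← eulerN_postcomp]
      field_simp
    have hN2 : (-lap (SchwartzMap.postcompCLM (𝕜 := ℝ) L (W.conjugate y)) x
        + 2 * W.θ x * eulerN (SchwartzMap.postcompCLM (𝕜 := ℝ) L (W.conjugate y)) x
        + W.potential x * SchwartzMap.postcompCLM (𝕜 := ℝ) L (W.conjugate y) x)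
        = Real.exp (W.φ x) * L (-lap y x - (lam : ℂ) ^ 2 * y x) := by
      have e1 : L (-lap y x - (lam : ℂ) ^ 2 * y x) = -L (lap y x) - lam ^ 2 * L (y x) := by
        rw [map_sub, map_neg, ← Complex.ofReal_pow, hL]
      have e2 : 2 * (W.θ x : ℂ) * ∑ j, (x j : ℂ) * pderiv j y x
          = ((2 * W.θ x : ℝ) : ℂ) * ∑ j, (x j : ℂ) * pderiv j y x := by push_cast; ring
      rw [hN, multiplier, lap_postcomp, lap_conjugate, SchwartzMap.postcompCLM_apply,
        conjugate_apply, hL, hL, map_add, map_add, map_add, e2, hL, hL, hL, map_sum, map_sum, e1,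
        potential]
      have e3 : ∑ j, L (((W.g x * x j : ℝ) : ℂ) * pderiv j y x)
          = W.g x * ∑ j, L ((x j : ℂ) * pderiv j y x) := by
        rw [Finset.mul_sum]
        exact Finset.sum_congr rfl fun j _ => by rw [hL, hL]; ring
      rw [e3]
      field_simp
      ring
    have hG : gradSq (SchwartzMap.postcompCLM (𝕜 := ℝ) L (W.conjugate y)) x
        = Real.exp (W.φ x) ^ 2 * ∑ j, L (W.twistedGrad j y x) ^ 2 := by
      rw [gradSq, Finset.mul_sum]
      refine Finset.sum_congr rfl fun j _ => ?_
      rw [pderiv_postcomp, SchwartzMap.postcompCLM_apply, pderiv_conjugate_apply, hL]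
      ring
    rw [defect, hN2, hN, hG, SchwartzMap.postcompCLM_apply, conjugate_apply, hL]
    field_simp
  have hn : ∀ z : ℂ, ‖z‖ ^ 2 = z.re ^ 2 + z.im ^ 2 := fun z => by
    rw [← Complex.normSq_eq_norm_sq, Complex.normSq_apply]; ring
  refine (congrArg₂ (· + ·) (key Complex.reCLM) (key Complex.imCLM)).trans ?_
  simp only [hn, Finset.sum_add_distrib, Complex.reCLM_apply, Complex.imCLM_apply, Complex.mul_re,
    Complex.conj_re, Complex.conj_im]
  ring

end CarlemanWeight

/-! ### Extension of the Carleman inequality by density -/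

theorem integrable_mul_re_conj_mul {d : ℕ} {a : Space d → ℝ}
    (ha : MemLp a ⊤ (volume : Measure (Space d))) (u v : L2 d) :
    Integrable (fun x => a x * ((starRingEnd ℂ) (u x) * v x).re) volume := by
  have h := (L2.integrable_inner (𝕜 := ℂ) u (mulOp ha v)).re
  refine h.congr ?_
  filter_upwards [mulOp_coeFn ha v] with x hx
  rw [hx]
  simp [Complex.mul_re]
  ring

theorem re_inner_mulOp {d : ℕ} {a : Space d → ℝ}
    (ha : MemLp a ⊤ (volume : Measure (Space d))) (u v : L2 d) :
    (⟪u, mulOp ha v⟫_ℂ).re = ∫ x, a x * ((starRingEnd ℂ) (u x) * v x).re := by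
  rw [L2.inner_def]
  have h := integral_re (𝕜 := ℂ) (L2.integrable_inner (𝕜 := ℂ) u (mulOp ha v))
  refine h.symm.trans (integral_congr_ae ?_)
  filter_upwards [mulOp_coeFn ha v] with x hx
  rw [hx]
  simp [Complex.mul_re]
  ring

theorem conj_mul_self_re (z : ℂ) : ((starRingEnd ℂ) z * z).re = ‖z‖ ^ 2 := by
  rw [← Complex.normSq_eq_conj_mul_self, Complex.ofReal_re, Complex.normSq_eq_norm_sq]

theorem integrable_mul_norm_sq {d : ℕ} {a : Space d → ℝ}
    (ha : MemLp a ⊤ (volume : Measure (Space d))) (u : L2 d) :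
    Integrable (fun x => a x * ‖u x‖ ^ 2) volume := by
  simpa only [conj_mul_self_re] using integrable_mul_re_conj_mul ha u u

theorem re_inner_mulOp_self {d : ℕ} {a : Space d → ℝ}
    (ha : MemLp a ⊤ (volume : Measure (Space d))) (u : L2 d) :
    (⟪u, mulOp ha u⟫_ℂ).re = ∫ x, a x * ‖u x‖ ^ 2 := by
  simpa only [conj_mul_self_re] using re_inner_mulOp ha u u

theorem coeFn_sum {d : ℕ} {ι : Type*} (s : Finset ι) (u : ι → L2 d) :
    (∑ j ∈ s, u j : L2 d) =ᵐ[volume] fun x => ∑ j ∈ s, u j x := by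
  classical
  induction s using Finset.induction_on with
  | empty =>
    simp only [Finset.sum_empty]
    exact Lp.coeFn_zero ℂ 2 volume
  | insert a s ha ih =>
    rw [Finset.sum_insert ha]
    filter_upwards [Lp.coeFn_add (u a) (∑ j ∈ s, u j), ih] with x h1 h2
    rw [h1, Pi.add_apply, h2, Finset.sum_insert ha]

/-- A continuous inequality which holds for Schwartz functions holds for all functions in `H¹` with
Laplacian in `L²`. -/
theorem nonneg_of_nonneg_schwartz {d : ℕ} (F : sobolev d → L2 d → ℝ)
    (hF : Continuous fun p : sobolev d × L2 d => F p.1 p.2)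
    (hS : ∀ y : 𝓢(Space d, ℂ), 0 ≤ F (schwartzJet y) (-(lap y).toLp 2 volume))
    (U : sobolev d) (h : L2 d)
    (hU : ∀ V : sobolev d, ∑ j, ⟪grad j U, grad j V⟫_ℂ = ⟪h, val d V⟫_ℂ) : 0 ≤ F U h := by
  have hcl : IsClosed ((fun p : sobolev d × L2 d => F p.1 p.2) ⁻¹' Set.Ici 0) :=
    isClosed_Ici.preimage hF
  have h1 := mem_closure_schwartz_graph U h hU
  have h2 := closure_minimal (s := Set.range fun ψ : 𝓢(Space d, ℂ) =>
      ((schwartzJet ψ, -(lap ψ).toLp 2 volume) : sobolev d × L2 d)) ?_ hcl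
  · exact h2 h1
  · rintro _ ⟨y, rfl⟩
    exact hS y

namespace CarlemanWeight

variable {d : ℕ} {lam : ℝ}

/-- The boundedness properties of the weights which allow to extend the Carleman inequality
from Schwartz functions to functions with Laplacian in `L²`. -/
structure Bounded (W : CarlemanWeight d lam) : Prop where
  exp : MemLp (fun x => Real.exp (W.φ x) ^ 2) ⊤ (volume : Measure (Space d))
  exp_m : MemLp (fun x => Real.exp (W.φ x) ^ 2 * (W.m x / 4)) ⊤ (volume : Measure (Space d))
  exp_θ : MemLp (fun x => Real.exp (W.φ x) ^ 2 * (2 * (W.θ x / W.g x))) ⊤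
    (volume : Measure (Space d))
  exp_q : MemLp (fun x => Real.exp (W.φ x) ^ 2 * W.q x) ⊤ (volume : Measure (Space d))
  θ_coord : ∀ j, MemLp (fun x => W.θ x * x j) ⊤ (volume : Measure (Space d))
  g_coord : ∀ j, MemLp (fun x => W.g x * x j) ⊤ (volume : Measure (Space d))
  g_θ : MemLp (fun x => W.g x * (W.θ x * ‖x‖ ^ 2 + ((d : ℝ) - 1) / 2)) ⊤
    (volume : Measure (Space d))

/-- `exp (-φ) ∂_j exp φ` on `H¹`. -/
noncomputable def twistedGradOp {W : CarlemanWeight d lam} (hW : W.Bounded) (j : Fin d) :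
    sobolev d →L[ℂ] L2 d := grad j + mulOp (hW.θ_coord j) ∘L val d

/-- `g exp (-φ) (x · ∇ + (d - 1) / 2) exp φ` on `H¹`. -/
noncomputable def multiplierOp {W : CarlemanWeight d lam} (hW : W.Bounded) :
    sobolev d →L[ℂ] L2 d :=
  (∑ j, mulOp (hW.g_coord j) ∘L grad j) + mulOp hW.g_θ ∘L val d

theorem twistedGradOp_coeFn {W : CarlemanWeight d lam} (hW : W.Bounded) (j : Fin d)
    (U : sobolev d) : twistedGradOp hW j U =ᵐ[volume] fun x =>
      grad j U x + ((W.θ x * x j : ℝ) : ℂ) * val d U x := by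
  have h : twistedGradOp hW j U = grad j U + mulOp (hW.θ_coord j) (val d U) := rfl
  rw [h]
  filter_upwards [Lp.coeFn_add (grad j U) (mulOp (hW.θ_coord j) (val d U)),
    mulOp_coeFn (hW.θ_coord j) (val d U)] with x h1 h2
  rw [h1, Pi.add_apply, h2]

theorem multiplierOp_coeFn {W : CarlemanWeight d lam} (hW : W.Bounded) (U : sobolev d) :
    multiplierOp hW U =ᵐ[volume] fun x =>
      (∑ j, ((W.g x * x j : ℝ) : ℂ) * grad j U x)
        + ((W.g x * (W.θ x * ‖x‖ ^ 2 + ((d : ℝ) - 1) / 2) : ℝ) : ℂ) * val d U x := by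
  have h : multiplierOp hW U = (∑ j, mulOp (hW.g_coord j) (grad j U))
      + mulOp hW.g_θ (val d U) := by
    simp [multiplierOp, sum_apply]
  rw [h]
  have hj : ∀ᵐ x, ∀ j, mulOp (hW.g_coord j) (grad j U) x
      = ((W.g x * x j : ℝ) : ℂ) * grad j U x :=
    ae_all_iff.2 fun j => mulOp_coeFn (hW.g_coord j) (grad j U)
  filter_upwards [Lp.coeFn_add (∑ j, mulOp (hW.g_coord j) (grad j U)) (mulOp hW.g_θ (val d U)),
    mulOp_coeFn hW.g_θ (val d U), coeFn_sum Finset.univ fun j => mulOp (hW.g_coord j) (grad j U),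
    hj] with x h1 h2 h3 h4
  rw [h1, Pi.add_apply, h2, h3, Finset.sum_congr rfl fun j _ => h4 j]

/-- The integrated difference of the two sides of the Carleman inequality, for `U ∈ H¹` and
`h = -ΔU ∈ L²`, as a continuous function of `U` and `h`. -/
noncomputable def carlemanForm {W : CarlemanWeight d lam} (hW : W.Bounded) (U : sobolev d)
    (h : L2 d) : ℝ :=
  (⟪multiplierOp hW U, mulOp hW.exp (h - (lam : ℂ) ^ 2 • val d U)⟫_ℂ).re
      - ((∑ j, (⟪twistedGradOp hW j U, mulOp hW.exp_m (twistedGradOp hW j U)⟫_ℂ).re)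
        + (⟪multiplierOp hW U, mulOp hW.exp_θ (multiplierOp hW U)⟫_ℂ).re
        + (⟪val d U, mulOp hW.exp_q (val d U)⟫_ℂ).re)

theorem continuous_carlemanForm {W : CarlemanWeight d lam} (hW : W.Bounded) :
    Continuous fun p : sobolev d × L2 d => carlemanForm hW p.1 p.2 := by
  have c0 : ∀ u v : sobolev d × L2 d → L2 d, Continuous u → Continuous v →
      Continuous fun p => (⟪u p, v p⟫_ℂ).re := fun u v hu hv =>
    Complex.continuous_re.comp (hu.inner hv)
  unfold carlemanForm
  refine Continuous.sub (c0 (fun p => multiplierOp hW p.1)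
    (fun p => mulOp hW.exp (p.2 - (lam : ℂ) ^ 2 • val d p.1)) (by fun_prop) (by fun_prop)) ?_
  refine Continuous.add (Continuous.add (continuous_finsetSum _ fun j _ => ?_) ?_) ?_
  · exact c0 (fun p => twistedGradOp hW j p.1) (fun p => mulOp hW.exp_m (twistedGradOp hW j p.1))
      (by fun_prop) (by fun_prop)
  · exact c0 (fun p => multiplierOp hW p.1) (fun p => mulOp hW.exp_θ (multiplierOp hW p.1))
      (by fun_prop) (by fun_prop)
  · exact c0 (fun p => val d p.1) (fun p => mulOp hW.exp_q (val d p.1))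
      (by fun_prop) (by fun_prop)

theorem carleman_form_eq {W : CarlemanWeight d lam} (hW : W.Bounded) (U : sobolev d) (h : L2 d) :
    carlemanForm hW U h = ∫ x, Real.exp (W.φ x) ^ 2 * (((starRingEnd ℂ) (multiplierOp hW U x)
        * (h x - (lam : ℂ) ^ 2 * val d U x)).re
      - (W.m x / 4 * (∑ j, ‖twistedGradOp hW j U x‖ ^ 2)
        + 2 * (W.θ x / W.g x) * ‖multiplierOp hW U x‖ ^ 2 + W.q x * ‖val d U x‖ ^ 2)) := by
  have i1 := integrable_mul_re_conj_mul hW.exp (multiplierOp hW U) (h - (lam : ℂ) ^ 2 • val d U)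
  have i2 := fun j => integrable_mul_norm_sq hW.exp_m (twistedGradOp hW j U)
  have i3 := integrable_mul_norm_sq hW.exp_θ (multiplierOp hW U)
  have i4 := integrable_mul_norm_sq hW.exp_q (val d U)
  have i2' := integrable_finsetSum (μ := volume) Finset.univ fun j _ => i2 j
  rw [carlemanForm]
  simp only [re_inner_mulOp_self]
  rw [re_inner_mulOp, ← integral_finsetSum _ fun j _ => i2 j, ← integral_add i2' i3,
    ← integral_add (i2'.fun_add i3) i4, ← integral_sub i1 ((i2'.fun_add i3).fun_add i4)]
  refine integral_congr_ae ?_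
  filter_upwards [Lp.coeFn_sub h ((lam : ℂ) ^ 2 • val d U),
    Lp.coeFn_smul ((lam : ℂ) ^ 2) (val d U)] with x h1 h2
  rw [h1, Pi.sub_apply, h2, Pi.smul_apply, smul_eq_mul, ← Finset.mul_sum]
  ring

/-- The Carleman inequality for functions in `H¹` with Laplacian in `L²`, by density of the Schwartz
functions. -/
theorem carleman {W : CarlemanWeight d lam} (hW : W.Bounded) (U : sobolev d) (h : L2 d)
    (hU : ∀ V : sobolev d, ∑ j, ⟪grad j U, grad j V⟫_ℂ = ⟪h, val d V⟫_ℂ) :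
    0 ≤ ∫ x, Real.exp (W.φ x) ^ 2 * (((starRingEnd ℂ) (multiplierOp hW U x)
        * (h x - (lam : ℂ) ^ 2 * val d U x)).re
      - (W.m x / 4 * (∑ j, ‖twistedGradOp hW j U x‖ ^ 2)
        + 2 * (W.θ x / W.g x) * ‖multiplierOp hW U x‖ ^ 2 + W.q x * ‖val d U x‖ ^ 2)) := by
  have hy : ∀ y : 𝓢(Space d, ℂ),
      0 ≤ carlemanForm hW (schwartzJet y) (-(lap y).toLp 2 volume) := fun y => by
    rw [carleman_form_eq]
    refine (W.carleman_schwartz y).trans_eq (integral_congr_ae ?_)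
    have hj : ∀ᵐ x, ∀ j, grad j (schwartzJet y) x = pderiv j y x :=
      ae_all_iff.2 fun j => (pderiv j y).coeFn_toLp 2 volume
    have hj' : ∀ᵐ x, ∀ j, twistedGradOp hW j (schwartzJet y) x
        = grad j (schwartzJet y) x + ((W.θ x * x j : ℝ) : ℂ) * val d (schwartzJet y) x :=
      ae_all_iff.2 fun j => twistedGradOp_coeFn hW j (schwartzJet y)
    filter_upwards [multiplierOp_coeFn hW (schwartzJet y), hj, hj', y.coeFn_toLp 2 volume,
      (lap y).coeFn_toLp 2 volume, Lp.coeFn_neg ((lap y).toLp 2 volume : L2 d)] with x h1 h2 h3 h4 h5 h6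
    have h7 : val d (schwartzJet y) x = y x := h4
    simp only [h1, h3, h2, h7, h6, Pi.neg_apply, h5]
    rfl
  rw [← carleman_form_eq]
  exact nonneg_of_nonneg_schwartz (carlemanForm hW) (continuous_carlemanForm hW) hy U h hU

end CarlemanWeight

/-! ### Powers of `1 + c|x|²` and the weight inequality -/

/-- The radial function `(1 + c |x|²) ^ r`. -/
noncomputable def pw {d : ℕ} (c r : ℝ) (x : Space d) : ℝ := (1 + c * ‖x‖ ^ 2) ^ r

theorem one_le_one_add_mul_norm_sq {d : ℕ} {c : ℝ} (hc : 0 ≤ c) (x : Space d) :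
    1 ≤ 1 + c * ‖x‖ ^ 2 := le_add_of_nonneg_right (by positivity)

theorem pw_pos {d : ℕ} {c : ℝ} (hc : 0 ≤ c) (r : ℝ) (x : Space d) : 0 < pw c r x :=
  Real.rpow_pos_of_pos (by linarith [one_le_one_add_mul_norm_sq hc x]) r

theorem pw_sub_one {d : ℕ} {c : ℝ} (hc : 0 ≤ c) (r : ℝ) (x : Space d) :
    pw c (r - 1) x = pw c r x / (1 + c * ‖x‖ ^ 2) :=
  Real.rpow_sub_one (by linarith [one_le_one_add_mul_norm_sq hc x]) r

theorem pw_le_pw {d : ℕ} {c : ℝ} (hc : 0 ≤ c) {r s : ℝ} (h : r ≤ s) (x : Space d) :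
    pw c r x ≤ pw c s x :=
  Real.rpow_le_rpow_of_exponent_le (one_le_one_add_mul_norm_sq hc x) h

theorem pw_mul {d : ℕ} {c : ℝ} (hc : 0 ≤ c) (r s : ℝ) (x : Space d) :
    pw c r x * pw c s x = pw c (r + s) x :=
  (Real.rpow_add (by linarith [one_le_one_add_mul_norm_sq hc x]) r s).symm

theorem pw_zero {d : ℕ} (c : ℝ) (x : Space d) : pw c 0 x = 1 := Real.rpow_zero _

theorem pw_neg_one {d : ℕ} (c : ℝ) (x : Space d) : pw c (-1) x = (1 + c * ‖x‖ ^ 2)⁻¹ :=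
  Real.rpow_neg_one _

theorem pw_le_one {d : ℕ} {c : ℝ} (hc : 0 ≤ c) {r : ℝ} (hr : r ≤ 0) (x : Space d) :
    pw c r x ≤ 1 := by
  rw [← pw_zero c x]
  exact pw_le_pw hc hr x

theorem radialDeriv_pw {d : ℕ} {c : ℝ} (hc : 0 ≤ c) (r : ℝ) :
    RadialDeriv (pw (d := d) c r) fun x => r * c * pw c (r - 1) x where
  temperate := hasTemperateGrowth_one_add_const_mul_norm_sq_rpow d c r hc
  fderiv_eq j x := by
    have h1 : HasFDerivAt (fun x : Space d => 1 + c * ‖x‖ ^ 2) (c • (2 • innerSL ℝ x)) x :=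
      (((hasStrictFDerivAt_norm_sq x).hasFDerivAt).const_mul c).const_add 1
    have h2 : HasFDerivAt (pw (d := d) c r) _ x := h1.rpow_const (p := r)
      (Or.inl (by linarith [one_le_one_add_mul_norm_sq hc x]))
    rw [h2.fderiv]
    simp [stdVec, EuclideanSpace.inner_single_right, pw]
    ring

theorem RadialDeriv.congr {d : ℕ} {a a' b b' : Space d → ℝ} (h : RadialDeriv a a')
    (h1 : ∀ x, b x = a x) (h2 : ∀ x, b' x = a' x) : RadialDeriv b b' := by
  rw [funext h1, funext h2]
  exact h

/-- The inequality to which `weight_inequality` reduces when `g = 2S - Q` and its derivatives are replaced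
by simple bounds. There are two regimes: where `τ` is small all the weights are close to their
values for `t = 0`, elsewhere the terms with `e` are controlled by `X = lam ^ 2`. -/
theorem weight_inequality_aux {p e X τ S Q F G H k g : ℝ} (hp : 0 < p) (hp' : p ≤ 1 / 8)
    (he : 0 < e) (hk : k = p / 100) (hX : 0 ≤ X)
    (hτ : 0 ≤ τ) (hτ' : τ ≤ 1) (hS : 0 < S) (hS2 : S ^ 2 = 1 - τ) (hQS : Q ≤ S) (hSQ : S ^ 2 ≤ Q)
    (hG : 0 < G) (hG' : G ≤ 1) (hH : 0 < H) (hH' : H ≤ 1) (hF : 0 < F) (hF2 : F ^ 2 = G * H)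
    (hGF : G ≤ F) (hF' : F ≤ 1)
    (hω : e * F * τ ≤ X / 100) (hfar : 1 / 32 ≤ τ → e * H ≤ X)
    (hgS : S ≤ g) (hg2 : g ≤ 2 * S) (hg1 : g ≤ 1) :
    k ^ 2 / 10 * (Q * (X + e * H)) ≤ 1 / 2 * X * (p * Q)
      + 1 / 2 * (k ^ 2 * e * (1 - G) * H * S ^ 2) * (g * (1 - 2 * p - 4 * τ))
      - 1 / 2 * (k * e * F * S) * (g * (p ^ 2 + G + 5 * τ))
      + 1 / 4 * (1 / 2 * p * e * Q * G * (1 / 2 - 9 / 8 * τ)) := by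
  have hQ : 0 < Q := lt_of_lt_of_le (by positivity) hSQ
  have hS1 : S ≤ 1 := by nlinarith only [hS, hS2, hτ]
  have hg0 : 0 < g := by linarith
  have hk0 : 0 < k := by rw [hk]; positivity
  have hk2 : k ^ 2 ≤ p / 80000 := by
    rw [hk]; nlinarith only [hp, hp']
  have hG0 : 0 ≤ 1 - G := by linarith
  have hQ1 : Q ≤ 1 := hQS.trans hS1
  have hpp : p ^ 2 ≤ 1 / 64 := by nlinarith only [hp, hp']
  rcases le_total τ (1 / 32) with hc | hc
  · have hS3 : 31 / 32 ≤ S ^ 2 := by linarith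
    have hQ3 : 31 / 32 ≤ Q := hS3.trans hSQ
    have hg3 : 31 / 32 ≤ g := by linarith
    -- the four terms, bounded below by multiples of `p * X`, `k² e (1 - G) H` and `p e G`
    have s1 : 31 / 64 * (p * X) ≤ 1 / 2 * X * (p * Q) := by
      have := mul_le_mul_of_nonneg_left hQ3 (a := p * X) (by positivity)
      linarith
    have s2 : 1 / 4 * (k ^ 2 * e * ((1 - G) * H))
        ≤ 1 / 2 * (k ^ 2 * e * (1 - G) * H * S ^ 2) * (g * (1 - 2 * p - 4 * τ)) := by
      have h1 : 31 / 32 * (5 / 8) ≤ g * (1 - 2 * p - 4 * τ) :=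
        mul_le_mul hg3 (by linarith) (by norm_num) hg0.le
      have h2 : 31 / 32 * (31 / 32 * (5 / 8)) ≤ S ^ 2 * (g * (1 - 2 * p - 4 * τ)) :=
        mul_le_mul hS3 h1 (by norm_num) (by positivity)
      have := mul_le_mul_of_nonneg_left h2 (a := 1 / 2 * (k ^ 2 * e * ((1 - G) * H)))
        (by positivity)
      have h0 : 0 ≤ k ^ 2 * e * ((1 - G) * H) := by positivity
      linarith
    have s4 : 1 / 20 * (p * e * G) ≤ 1 / 4 * (1 / 2 * p * e * Q * G * (1 / 2 - 9 / 8 * τ)) := by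
      have h2 : 31 / 32 * (14 / 32) ≤ Q * (1 / 2 - 9 / 8 * τ) :=
        mul_le_mul hQ3 (by linarith) (by norm_num) hQ.le
      have := mul_le_mul_of_nonneg_left h2 (a := 1 / 8 * (p * e * G)) (by positivity)
      have h0 : 0 ≤ p * e * G := by positivity
      linarith
    have s3 : 1 / 2 * (k * e * F * S) * (g * (p ^ 2 + G + 5 * τ))
        ≤ 1 / 2 * k * e * (F * p ^ 2) + 1 / 2 * k * (e * G) + 1 / 40 * k * X := by
      have h1 : S * g ≤ 1 := mul_le_one₀ hS1 hg0.le hg1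
      have h2 := mul_le_mul_of_nonneg_left h1 (a := 1 / 2 * (k * e * F) * (p ^ 2 + G + 5 * τ))
        (by positivity)
      have h3 : k * e * (F * G) ≤ k * e * (1 * G) := by gcongr
      have h4 := mul_le_mul_of_nonneg_left hω hk0.le
      linarith
    -- the geometric-arithmetic mean inequality for `F² = G H`
    have s5 : 1 / 2 * (F * p ^ 2) ≤ G + 1 / 16 * p ^ 4 * H := by
      refine le_of_sq_le_sq ?_ (by positivity)
      have h1 : (1 / 2 * (F * p ^ 2)) ^ 2 = 1 / 4 * p ^ 4 * (G * H) := by rw [← hF2]; ring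
      have := sq_nonneg (G - 1 / 16 * p ^ 4 * H)
      rw [h1]
      linarith
    have s6 := mul_le_mul_of_nonneg_left s5 (a := k * e) (by positivity)
    have s7 : H ≤ (1 - G) * H + G := by
      have := mul_nonneg hG.le (sub_nonneg.2 hH')
      linarith
    have s8 : k ^ 2 / 10 * (Q * (X + e * H)) ≤ k ^ 2 / 10 * (1 * (X + e * H)) := by gcongr
    have s9 : k * p ^ 4 ≤ 1 / 5 * k ^ 2 := by
      rw [hk]
      have : p ^ 5 ≤ p ^ 2 * (1 / 512) := by
        have h0 : p ^ 3 ≤ (1 / 8) ^ 3 := by gcongr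
        have := mul_le_mul_of_nonneg_left h0 (a := p ^ 2) (by positivity)
        calc p ^ 5 = p ^ 2 * p ^ 3 := by ring
          _ ≤ _ := by linarith
      linarith [sq_nonneg p]
    have s10 := mul_le_mul_of_nonneg_right s9 (a := e * H) (by positivity)
    have s11 := mul_le_mul_of_nonneg_left s7 (a := k ^ 2 * e) (by positivity)
    have s12 := mul_le_mul_of_nonneg_right hk2 (a := e * G) (by positivity)
    have s13 := mul_le_mul_of_nonneg_right hk2 (a := X) (by positivity)
    have n1 : 0 ≤ p * e * G := by positivity
    have n2 : 0 ≤ p * X := by positivity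
    have n3 : 0 ≤ k ^ 2 * e * ((1 - G) * H) := by positivity
    have e1 : k * (e * G) = 1 / 100 * (p * e * G) := by rw [hk]; ring
    have e2 : k * X = 1 / 100 * (p * X) := by rw [hk]; ring
    linarith
  · have hH2 := hfar hc
    have hF3 : e * F ≤ 8 / 25 * X := by
      have : e * F * (1 / 32) ≤ e * F * τ := by gcongr
      linarith
    have s3 : 1 / 2 * (k * e * F * S) * (g * (p ^ 2 + G + 5 * τ)) ≤ 49 / 25 * k * X * Q := by
      have h1 : S * g ≤ 2 * Q := by nlinarith only [hg2, hSQ, hS]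
      have h2 : p ^ 2 + G + 5 * τ ≤ 49 / 8 := by linarith
      calc 1 / 2 * (k * e * F * S) * (g * (p ^ 2 + G + 5 * τ))
          = 1 / 2 * k * ((e * F) * (S * g) * (p ^ 2 + G + 5 * τ)) := by ring
        _ ≤ 1 / 2 * k * ((8 / 25 * X) * (2 * Q) * (49 / 8)) := by gcongr
        _ = _ := by ring
    have s2 : -(13 / 8 * k ^ 2 * X * Q)
        ≤ 1 / 2 * (k ^ 2 * e * (1 - G) * H * S ^ 2) * (g * (1 - 2 * p - 4 * τ)) := by
      have h1 : g * (2 * p + 4 * τ - 1) ≤ 1 * (13 / 4) := by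
        have h0 : g * (2 * p + 4 * τ - 1) ≤ g * (13 / 4) :=
          mul_le_mul_of_nonneg_left (by linarith) hg0.le
        linarith
      have h2 : (1 - G) * (e * H) * S ^ 2 ≤ 1 * X * Q := by
        gcongr
        linarith
      have h3 := mul_le_mul_of_nonneg_left h1 (a := 1 / 2 * k ^ 2 * ((1 - G) * (e * H) * S ^ 2))
        (by positivity)
      have h4 := mul_le_mul_of_nonneg_left h2 (a := 13 / 8 * k ^ 2) (by positivity)
      linarith
    have s4 : -(1 / 40 * p * X * Q) ≤ 1 / 4 * (1 / 2 * p * e * Q * G * (1 / 2 - 9 / 8 * τ)) := by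
      have h1 : e * G ≤ 8 / 25 * X := le_trans (by gcongr) hF3
      have h2 := mul_le_mul_of_nonneg_left h1 (a := 5 / 64 * p * Q) (by positivity)
      have h3 : -(5 / 8) ≤ 1 / 2 - 9 / 8 * τ := by linarith
      have h4 := mul_le_mul_of_nonneg_left h3 (a := 1 / 8 * p * e * Q * G) (by positivity)
      linarith
    have s8 : k ^ 2 / 10 * (Q * (X + e * H)) ≤ k ^ 2 / 10 * (Q * (X + X)) := by gcongr
    have s9 := mul_le_mul_of_nonneg_right hk2 (a := X * Q) (by positivity)
    have n1 : 0 ≤ p * X * Q := by positivity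
    have e1 : k * X * Q = 1 / 100 * (p * X * Q) := by rw [hk]; ring
    linarith

/-- The pointwise inequality behind the lower bound in the Carleman estimate. The variables stand
for `τ = t|x|²/T`, `S = T^(-1/2)`, `Q = T^(-(1+p)/2)`, `G = 1/E`, `H = E^(-p)`,
`F = E^(-(1+p)/2)`, where `E = 1 + e|x|²` and `T = 1 + t|x|²`. The first term on the right hand side
stems from `λ²`, the second from `θ²`, the third from `θ` and its derivatives, the
last one from the Hardy inequality. -/
theorem weight_inequality {d p e lam τ S Q F G H u k : ℝ} (hd : 3 ≤ d) (hp : 0 < p) (hp' : p ≤ 1 / 8)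
    (he : 0 < e) (hu : u = (1 + p) / 2) (hk : k = p / 100)
    (hτ : 0 ≤ τ) (hτ' : τ ≤ 1) (hS : 0 < S) (hS2 : S ^ 2 = 1 - τ) (hQS : Q ≤ S) (hSQ : S ^ 2 ≤ Q)
    (hG : 0 < G) (hG' : G ≤ 1) (hH : 0 < H) (hH' : H ≤ 1) (hF : 0 < F) (hF2 : F ^ 2 = G * H)
    (hGF : G ≤ F) (hF' : F ≤ 1)
    (hω : e * F * τ ≤ lam ^ 2 / 100) (hfar : 1 / 32 ≤ τ → e * H ≤ lam ^ 2) :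
    k ^ 2 / 10 * (Q * (lam ^ 2 + e * H)) ≤
      1 / 2 * lam ^ 2 * (2 * S - Q - 2 * τ * S + 2 * u * τ * Q)
      + 1 / 2 * (k ^ 2 * e * (1 - G) * H * S ^ 2) * ((2 * S - Q - 2 * τ * S + 2 * u * τ * Q)
          + (2 * S - Q) * (2 - 4 * u * (1 - G) - 2 * τ))
      - 1 / 2 * (k * e * F * S) * ((1 - 2 * u * (1 - G) - τ) *
            (2 * S - Q - 2 * τ * S + 2 * u * τ * Q)
          + (2 * S - Q) * (-6 * u * (1 - G) - 3 * τ + 4 * u * (u + 1) * (1 - G) ^ 2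
            + 4 * u * (1 - G) * τ + 3 * τ ^ 2))
      + 1 / 4 * (1 / 2 * p * e * Q * G * (d - 2 * u * τ - 2 * (1 - G) - 1 / 2 * (1 - G))) := by
  have hQ : 0 < Q := lt_of_lt_of_le (by positivity) hSQ
  set g := 2 * S - Q with hg
  set μ := 2 * S - Q - 2 * τ * S + 2 * u * τ * Q with hμ
  have hS1 : S ≤ 1 := by nlinarith only [hS, hS2, hτ]
  have hgS : S ≤ g := by linarith
  have hg2 : g ≤ 2 * S := by linarith
  have hup : 1 / 2 ≤ u := by linarith
  have hu1 : u ≤ 9 / 16 := by linarith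
  have hμp : p * Q ≤ μ := by
    have h1 : 0 ≤ (S - Q) * (1 - τ) := mul_nonneg (by linarith) (by linarith)
    have h2 : 0 ≤ (1 - τ) * (1 - p) * Q :=
      mul_nonneg (mul_nonneg (by linarith) (by linarith)) hQ.le
    have h3 : μ - p * Q = 2 * ((S - Q) * (1 - τ)) + (1 - τ) * (1 - p) * Q := by
      rw [hμ, hu]; ring
    linarith
  have hμg : μ = g - (2 * τ * S - 2 * u * τ * Q) := by rw [hμ, hg]; ring
  have hδ0 : 0 ≤ 2 * τ * S - 2 * u * τ * Q := by
    have : 0 ≤ τ * (S - u * Q) := mul_nonneg hτ (by nlinarith only [hu1, hup, hQ, hQS])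
    linarith
  have hδ1 : 2 * τ * S - 2 * u * τ * Q ≤ 2 * τ * g := by
    have h1 : 0 ≤ u * τ * Q := by positivity
    have h2 := mul_le_mul_of_nonneg_left hgS hτ
    linarith
  have hA : g * (1 - 2 * p - 4 * τ) ≤ μ + g * (2 - 4 * u * (1 - G) - 2 * τ) := by
    have h1 : 0 ≤ g * (4 * u * G) := by
      have : 0 ≤ g := by linarith
      positivity
    have h2 : 4 * u = 2 + 2 * p := by rw [hu]; ring
    rw [hμg]
    linear_combination hδ1 + h1 + g * h2
  have hB : (1 - 2 * u * (1 - G) - τ) * μ + g * (-6 * u * (1 - G) - 3 * τ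
      + 4 * u * (u + 1) * (1 - G) ^ 2 + 4 * u * (1 - G) * τ + 3 * τ ^ 2)
      ≤ g * (p ^ 2 + G + 5 * τ) := by
    have h0 : 0 ≤ 1 - G := by linarith
    have h1 : 1 - 8 * u * (1 - G) + 4 * u * (u + 1) * (1 - G) ^ 2 ≤ p ^ 2 + G := by
      have h2 : p ^ 2 + G - (1 - 8 * u * (1 - G) + 4 * u * (u + 1) * (1 - G) ^ 2)
          = G * (p ^ 2 * (1 + (1 - G)) + (3 + 4 * p) * (1 - G)) := by
        rw [hu]; ring
      have h3 : 0 ≤ G * (p ^ 2 * (1 + (1 - G)) + (3 + 4 * p) * (1 - G)) := by positivity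
      linarith
    have h2 : -4 * τ + 4 * u * (1 - G) * τ + 3 * τ ^ 2 ≤ 5 / 4 * τ := by
      have h3 : 0 ≤ τ * (9 / 16 - u) := mul_nonneg hτ (by linarith)
      have h4 : 0 ≤ τ * (u * G) := by positivity
      have h5 : 0 ≤ τ * (1 - τ) := mul_nonneg hτ (by linarith)
      linarith
    have h3 : -(2 * τ * S - 2 * u * τ * Q) * (1 - 2 * u * (1 - G) - τ) ≤ 9 / 4 * τ * g := by
      have h4 : -(1 - 2 * u * (1 - G) - τ) ≤ 9 / 8 := by
        have : 0 ≤ u * G := by positivity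
        linarith
      have h5 := mul_le_mul_of_nonneg_left h4 hδ0
      linarith
    have hg0 : 0 ≤ g := by linarith
    have h6 := mul_le_mul_of_nonneg_left (add_le_add h1 h2) hg0
    have h7 : 0 ≤ g * τ := mul_nonneg hg0 hτ
    clear_value g μ
    rw [hμg]
    linarith
  have hg0 : 0 < g := by linarith
  have hg1 : g ≤ 1 := by nlinarith only [hg, hSQ, sq_nonneg (S - 1)]
  have hd' : (3 : ℝ) ≤ d := by exact_mod_cast hd
  have hX : 0 ≤ lam ^ 2 := sq_nonneg lam
  have hk0 : 0 < k := by rw [hk]; positivity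
  have hG0 : 0 ≤ 1 - G := by linarith
  clear_value g μ
  have t1 : 1 / 2 * lam ^ 2 * (p * Q) ≤ 1 / 2 * lam ^ 2 * μ :=
    mul_le_mul_of_nonneg_left hμp (by positivity)
  have t2 : 1 / 2 * (k ^ 2 * e * (1 - G) * H * S ^ 2) * (g * (1 - 2 * p - 4 * τ))
      ≤ 1 / 2 * (k ^ 2 * e * (1 - G) * H * S ^ 2) * (μ + g * (2 - 4 * u * (1 - G) - 2 * τ)) :=
    mul_le_mul_of_nonneg_left hA (by positivity)
  have t3 := mul_le_mul_of_nonneg_left hB (a := 1 / 2 * (k * e * F * S)) (by positivity)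
  have t4 : 1 / 4 * (1 / 2 * p * e * Q * G * (1 / 2 - 9 / 8 * τ)) ≤
      1 / 4 * (1 / 2 * p * e * Q * G * (d - 2 * u * τ - 2 * (1 - G) - 1 / 2 * (1 - G))) := by
    have h1 : u * τ ≤ 9 / 16 * τ := mul_le_mul_of_nonneg_right hu1 hτ
    have h2 : 1 / 2 - 9 / 8 * τ ≤ d - 2 * u * τ - 2 * (1 - G) - 1 / 2 * (1 - G) := by
      linarith
    have := mul_le_mul_of_nonneg_left h2 (a := 1 / 2 * p * e * Q * G) (by positivity)
    linarith
  have := weight_inequality_aux hp hp' he hk hX hτ hτ' hS hS2 hQS hSQ hG hG' hH hH' hF hF2 hGF hF'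
    hω hfar hgS hg2 hg1
  linarith

/-! ### The phase of the Carleman weight -/

/-- Admissible parameters for the concrete Carleman weight at energy `lam ^ 2`: the weight varies at
the scales `e ^ (-1/2)` and `t ^ (-1/2)`. By the last two conditions `lam ^ 2` dominates the errors
which the phase causes at distances of order `t ^ (-1/2)` and beyond. -/
structure WeightParams (p e t lam : ℝ) : Prop where
  p_pos : 0 < p
  p_le : p ≤ 1 / 8
  one_le_e : 1 ≤ e
  t_pos : 0 < t
  t_le : t ≤ 1
  mul_le : e * t ≤ (lam ^ 2 / 100) ^ 2
  far_le : e * (32 * t / e) ^ p ≤ lam ^ 2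

/-- The derivative of twice the phase with respect to `r = |x|²`, that is `θ`. The absolute values make
it defined and integrable on the whole line. -/
noncomputable def phaseDeriv (p e t r : ℝ) : ℝ :=
  p / 100 * e * (1 + e * |r|) ^ (-((1 + p) / 2)) * (1 + t * |r|) ^ (-(1 / 2) : ℝ)

/-- The phase `φ` of the concrete weight, the radial function with `φ 0 = 0` and `∇φ = θ x`. -/
noncomputable def phase {d : ℕ} (p e t : ℝ) (x : Space d) : ℝ :=
  1 / 2 * ∫ r in (0 : ℝ)..‖x‖ ^ 2, phaseDeriv p e t r

theorem continuous_phaseDeriv {p e t : ℝ} (he : 0 ≤ e) (ht : 0 ≤ t) :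
    Continuous (phaseDeriv p e t) := by
  have h : ∀ c : ℝ, 0 ≤ c → ∀ s : ℝ, Continuous fun r : ℝ => (1 + c * |r|) ^ s := fun c hc s => by
    refine Continuous.rpow_const (by fun_prop) fun r => Or.inl ?_
    positivity
  unfold phaseDeriv
  exact ((continuous_const.mul (h e he _)).mul (h t ht _))

theorem phaseDeriv_nonneg {p e t : ℝ} (hp : 0 ≤ p) (he : 0 ≤ e) (ht : 0 ≤ t) (r : ℝ) :
    0 ≤ phaseDeriv p e t r := by
  unfold phaseDeriv
  positivity

theorem phaseDeriv_norm_sq {d : ℕ} (p e t : ℝ) (x : Space d) :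
    phaseDeriv p e t (‖x‖ ^ 2) = p / 100 * e * pw e (-((1 + p) / 2)) x * pw t (-(1 / 2)) x := by
  unfold phaseDeriv pw
  rw [abs_of_nonneg (by positivity)]

theorem phase_nonneg {d : ℕ} {p e t : ℝ} (hp : 0 ≤ p) (he : 0 ≤ e) (ht : 0 ≤ t) (x : Space d) :
    0 ≤ phase p e t x :=
  mul_nonneg (by norm_num) (intervalIntegral.integral_nonneg (by positivity)
    fun r _ => phaseDeriv_nonneg hp he ht r)

theorem integrable_phaseDeriv {p e t : ℝ} (hp : 0 < p) (he : 1 ≤ e) (ht : 0 < t) (ht' : t ≤ 1) :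
    Integrable (phaseDeriv p e t) volume := by
  have h1 : Integrable (fun r : ℝ => (1 + ‖r‖) ^ (-(1 + p / 2))) volume :=
    integrable_one_add_norm (by simp; linarith)
  refine (h1.const_mul (p / 100 * e * t ^ (-(1 / 2) : ℝ))).mono'
    (continuous_phaseDeriv (by linarith) ht.le).aestronglyMeasurable (Filter.Eventually.of_forall ?_)
  intro r
  rw [Real.norm_of_nonneg (phaseDeriv_nonneg hp.le (by linarith) ht.le r), phaseDeriv,
    Real.norm_eq_abs]
  have hr := abs_nonneg r
  have h2 : (1 + e * |r|) ^ (-((1 + p) / 2)) ≤ (1 + |r|) ^ (-((1 + p) / 2)) :=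
    Real.rpow_le_rpow_of_nonpos (by positivity) (by nlinarith) (by linarith)
  have h3 : (1 + t * |r|) ^ (-(1 / 2) : ℝ) ≤ t ^ (-(1 / 2) : ℝ) * (1 + |r|) ^ (-(1 / 2) : ℝ) := by
    rw [← Real.mul_rpow ht.le (by positivity)]
    exact Real.rpow_le_rpow_of_nonpos (by positivity) (by nlinarith) (by norm_num)
  have h4 : (1 + |r|) ^ (-(1 + p / 2)) = (1 + |r|) ^ (-((1 + p) / 2)) * (1 + |r|) ^ (-(1 / 2) : ℝ) := by
    rw [← Real.rpow_add (by positivity)]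
    congr 1
    ring
  rw [h4]
  have h5 : 0 ≤ p / 100 * e := by positivity
  calc p / 100 * e * (1 + e * |r|) ^ (-((1 + p) / 2)) * (1 + t * |r|) ^ (-(1 / 2) : ℝ)
      ≤ p / 100 * e * (1 + |r|) ^ (-((1 + p) / 2)) * (t ^ (-(1 / 2) : ℝ) * (1 + |r|) ^ (-(1 / 2) : ℝ)) := by
        gcongr
    _ = _ := by ring

theorem exists_phase_le (d : ℕ) {p e t : ℝ} (hp : 0 < p) (he : 1 ≤ e) (ht : 0 < t) (ht' : t ≤ 1) :
    ∃ M, ∀ x : Space d, phase p e t x ≤ M := by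
  refine ⟨1 / 2 * ∫ r, phaseDeriv p e t r, fun x => ?_⟩
  refine mul_le_mul_of_nonneg_left ?_ (by norm_num)
  rw [intervalIntegral.integral_of_le (by positivity)]
  exact setIntegral_le_integral (integrable_phaseDeriv hp he ht ht')
    (Filter.Eventually.of_forall (phaseDeriv_nonneg hp.le (by linarith) ht.le))

theorem hasFDerivAt_phase {d : ℕ} {p e t : ℝ} (he : 0 ≤ e) (ht : 0 ≤ t) (x : Space d) :
    HasFDerivAt (phase (d := d) p e t) (phaseDeriv p e t (‖x‖ ^ 2) • innerSL ℝ x) x := by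
  have hc := continuous_phaseDeriv (p := p) he ht
  have h1 : HasDerivAt (fun s => ∫ r in (0 : ℝ)..s, phaseDeriv p e t r)
      (phaseDeriv p e t (‖x‖ ^ 2)) (‖x‖ ^ 2) :=
    intervalIntegral.integral_hasDerivAt_right (hc.intervalIntegrable _ _)
      (hc.stronglyMeasurableAtFilter _ _) hc.continuousAt
  have h2 := (h1.comp_hasFDerivAt x (hasStrictFDerivAt_norm_sq x).hasFDerivAt).const_mul (1 / 2 : ℝ)
  have h3 : (1 / 2 : ℝ) • phaseDeriv p e t (‖x‖ ^ 2) • (2 • innerSL ℝ x)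
      = phaseDeriv p e t (‖x‖ ^ 2) • innerSL ℝ x := by
    ext y
    simp
    ring
  rw [← h3]
  exact h2

/-- The exponential of a bounded-above function of temperate growth has temperate growth. -/
theorem Function.HasTemperateGrowth.exp {d : ℕ} {f : Space d → ℝ} (hf : f.HasTemperateGrowth)
    {M : ℝ} (hM : ∀ x, f x ≤ M) : (fun x => Real.exp (f x)).HasTemperateGrowth := by
  have ht : Set.range f ⊆ Set.Iio (M + 1) := by
    rintro _ ⟨x, rfl⟩
    exact lt_of_le_of_lt (hM x) (by linarith)
  refine Function.HasTemperateGrowth.comp' (g := Real.exp) ht (isOpen_Iio.uniqueDiffOn)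
    Real.contDiff_exp.contDiffOn (fun N => ⟨0, Real.exp (M + 1), (Real.exp_pos _).le, ?_⟩) hf
  intro n _ x hx
  rw [norm_iteratedFDerivWithin_eq_norm_iteratedDerivWithin,
    iteratedDerivWithin_of_isOpen isOpen_Iio hx, iteratedDeriv_eq_iterate, Real.iter_deriv_exp,
    Real.norm_of_nonneg (Real.exp_pos x).le, pow_zero, mul_one]
  exact Real.exp_le_exp.2 (le_of_lt hx)

theorem hasTemperateGrowth_phase {d : ℕ} {p e t : ℝ} (hp : 0 < p) (he : 1 ≤ e) (ht : 0 < t)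
    (ht' : t ≤ 1) : (phase (d := d) p e t).HasTemperateGrowth := by
  have he0 : 0 ≤ e := by linarith
  obtain ⟨M, hM⟩ := exists_phase_le d hp he ht ht'
  refine .of_fderiv ?_ (fun x => (hasFDerivAt_phase he0 ht.le x).differentiableAt) (k := 0) (C := M) ?_
  · have h1 : fderiv ℝ (phase (d := d) p e t) = fun x =>
        (p / 100 * e * pw e (-((1 + p) / 2)) x * pw t (-(1 / 2)) x) • innerSL ℝ x := by
      funext x
      rw [(hasFDerivAt_phase he0 ht.le x).fderiv, phaseDeriv_norm_sq]
    rw [h1]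
    exact (((Function.HasTemperateGrowth.const (p / 100 * e)).mul
      (radialDeriv_pw he0 _).temperate).mul (radialDeriv_pw ht.le _).temperate).smul
      (innerSL ℝ).hasTemperateGrowth
  · intro x
    rw [Real.norm_of_nonneg (phase_nonneg hp.le he0 ht.le x)]
    simpa using hM x

theorem RadialDeriv.const_mul {d : ℕ} {a a' : Space d → ℝ} (ha : RadialDeriv a a') (c : ℝ) :
    RadialDeriv (fun x => c * a x) fun x => c * a' x :=
  ((CarlemanWeight.radial_const c).mul ha).congr (fun _ => rfl) fun x => by ring

namespace WeightParams

variable {p e t lam : ℝ}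

/-- The inequality `weight_inequality` for the concrete weight: the bound `q_le` of
`CarlemanWeight`, written out. -/
theorem inequality (h : WeightParams p e t lam) {d : ℕ} (hd : 3 ≤ d) (x : Space d)
    {u k : ℝ} (hu : u = (1 + p) / 2) (hk : k = p / 100) :
    k ^ 2 / 10 * (pw t (-u) x * (lam ^ 2 + e * pw e (-p) x)) ≤
      -(((d : ℝ) - 1) / 2 * (d * (t * (-pw t (-(1 / 2) - 1) x + u * pw t (-u - 1) x))
        + 2 * ‖x‖ ^ 2 * (t ^ 2 * (3 / 2 * pw t (-(1 / 2) - 1 - 1) x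
          - u * (u + 1) * pw t (-u - 1 - 1) x))))
    - 1 / 2 * ((k * e * pw e (-u) x * pw t (-(1 / 2)) x + 2 * ‖x‖ ^ 2 * (k * e *
            (-u * e * pw e (-u - 1) x * pw t (-(1 / 2)) x
              - 1 / 2 * t * pw e (-u) x * pw t (-(1 / 2) - 1) x))
          - (k * e * pw e (-u) x * pw t (-(1 / 2)) x) ^ 2 * ‖x‖ ^ 2 - lam ^ 2)
        * (2 * pw t (-(1 / 2)) x - pw t (-u) x + 2 * ‖x‖ ^ 2 * (t * (-pw t (-(1 / 2) - 1) x
            + u * pw t (-u - 1) x)))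
      + 2 * ‖x‖ ^ 2 * (3 * (k * e * (-u * e * pw e (-u - 1) x * pw t (-(1 / 2)) x
              - 1 / 2 * t * pw e (-u) x * pw t (-(1 / 2) - 1) x))
          + 2 * ‖x‖ ^ 2 * (k * e * (u * (u + 1) * e ^ 2 * pw e (-u - 1 - 1) x * pw t (-(1 / 2)) x
            + u * e * t * pw e (-u - 1) x * pw t (-(1 / 2) - 1) x
            + 3 / 4 * t ^ 2 * pw e (-u) x * pw t (-(1 / 2) - 1 - 1) x))
          - (k * e * pw e (-u) x * pw t (-(1 / 2)) x) ^ 2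
          - 2 * ‖x‖ ^ 2 * (k * e * pw e (-u) x * pw t (-(1 / 2)) x)
            * (k * e * (-u * e * pw e (-u - 1) x * pw t (-(1 / 2)) x
              - 1 / 2 * t * pw e (-u) x * pw t (-(1 / 2) - 1) x)))
        * (2 * pw t (-(1 / 2)) x - pw t (-u) x))
    + 1 / 4 * (d * (p * pw t (-u) x * (1 / 2 * e * pw e (-1) x))
      + 2 * ‖x‖ ^ 2 * (1 / 2 * p * e * (-u * t * pw t (-u - 1) x * pw e (-1) x
          - e * pw t (-u) x * pw e (-1 - 1) x))
      - p * pw t (-u) x * (1 / 2 * e * pw e (-1) x) ^ 2 * ‖x‖ ^ 2) := by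
  have he0 : 0 < e := by linarith [h.one_le_e]
  have ht0 := h.t_pos
  have hp := h.p_pos
  have hp' := h.p_le
  have hup : 1 / 2 ≤ u := by rw [hu]; linarith
  have hu1 : u ≤ 9 / 16 := by rw [hu]; linarith
  have hS := pw_pos ht0.le (-(1 / 2)) x
  have hQ := pw_pos ht0.le (-u) x
  have hF := pw_pos he0.le (-u) x
  have hG := pw_pos he0.le (-1) x
  have hH := pw_pos he0.le (-p) x
  have hQS : pw t (-u) x ≤ pw t (-(1 / 2)) x := pw_le_pw ht0.le (by linarith) x
  have hG1 : pw e (-1) x ≤ 1 := pw_le_one he0.le (by norm_num) x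
  have hH1 : pw e (-p) x ≤ 1 := pw_le_one he0.le (by linarith) x
  have hF1 : pw e (-u) x ≤ 1 := pw_le_one he0.le (by linarith) x
  have hGF : pw e (-1) x ≤ pw e (-u) x := pw_le_pw he0.le (by linarith) x
  have hF2 : pw e (-u) x ^ 2 = pw e (-1) x * pw e (-p) x := by
    rw [sq, pw_mul he0.le, pw_mul he0.le, hu]; congr 1; ring
  have hSQ : pw t (-(1 / 2)) x ^ 2 ≤ pw t (-u) x := by
    rw [sq, pw_mul ht0.le]
    exact pw_le_pw ht0.le (by linarith) x
  have hS2' : pw t (-(1 / 2)) x ^ 2 = (1 + t * ‖x‖ ^ 2)⁻¹ := by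
    rw [sq, pw_mul ht0.le, ← pw_neg_one]; norm_num
  have hG' := pw_neg_one e x
  have hfar0 : 1 / 32 * (1 + t * ‖x‖ ^ 2) ≤ t * ‖x‖ ^ 2 → e * pw e (-p) x ≤ lam ^ 2 := by
    intro h1
    refine le_trans (mul_le_mul_of_nonneg_left ?_ he0.le) h.far_le
    have h2 : (32 * t / e) ^ p = (e / (32 * t)) ^ (-p) := by
      rw [Real.rpow_neg (by positivity), ← Real.inv_rpow (by positivity), inv_div]
    rw [h2]
    refine Real.rpow_le_rpow_of_nonpos (by positivity) ?_ (by linarith)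
    rw [div_le_iff₀ (by positivity)]
    have h3 : 1 ≤ 32 * t * ‖x‖ ^ 2 := by nlinarith [mul_nonneg ht0.le (sq_nonneg ‖x‖)]
    nlinarith [mul_le_mul_of_nonneg_left h3 he0.le]
  simp only [pw_sub_one ht0.le, pw_sub_one he0.le]
  have hR : 0 ≤ ‖x‖ ^ 2 := sq_nonneg _
  generalize hRR : ‖x‖ ^ 2 = R at *
  have hT0 : 0 < 1 + t * R := by positivity
  have hE0 : 0 < 1 + e * R := by positivity
  set T := 1 + t * R with hT
  set E := 1 + e * R with hE
  generalize pw t (-(1 / 2)) x = S at *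
  generalize pw t (-u) x = Q at *
  generalize pw e (-u) x = F at *
  generalize pw e (-1) x = G at *
  generalize pw e (-p) x = H at *
  obtain ⟨τ, hτ⟩ : ∃ τ, τ = t * R / T := ⟨_, rfl⟩
  have hτT : τ * T = t * R := by rw [hτ]; field_simp
  have hGE : G * E = 1 := by rw [hG']; field_simp
  have hτ0 : 0 ≤ τ := by rw [hτ]; positivity
  have hS2 : S ^ 2 = 1 - τ := by
    rw [hS2', hτ]
    field_simp
    rw [hT]; ring
  have hτ1 : τ ≤ 1 := by nlinarith only [hS2, sq_nonneg S]
  have hω : e * F * τ ≤ lam ^ 2 / 100 := by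
    refine le_of_sq_le_sq ?_ (by positivity)
    refine le_trans ?_ h.mul_le
    have h1 : e * R * G ≤ 1 := by
      rw [hE] at hGE
      linarith
    have h2 : τ ≤ t * R := by
      rw [← hτT]
      exact le_mul_of_one_le_right hτ0 (by rw [hT]; nlinarith [mul_nonneg ht0.le hR])
    calc (e * F * τ) ^ 2 = e ^ 2 * (G * H) * (τ * τ) := by rw [← hF2]; ring
      _ ≤ e ^ 2 * (G * 1) * (t * R * 1) := by gcongr
      _ = e * t * (e * R * G) := by ring
      _ ≤ e * t * 1 := by gcongr
      _ = e * t := mul_one _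
  have hfar : 1 / 32 ≤ τ → e * H ≤ lam ^ 2 := fun h1 => hfar0 (by
    rw [← hτT]; gcongr)
  have key := weight_inequality (d := (d : ℝ)) (by exact_mod_cast hd) hp hp' he0 hu hk hτ0 hτ1 hS hS2 hQS hSQ hG hG1 hH hH1 hF hF2 hGF
    hF1 hω hfar
  have r1 : ∀ a : ℝ, R * (t * (a / T)) = τ * a := fun a => by
    rw [hτ]; field_simp
  have r2 : ∀ a : ℝ, R * (e * (a / E)) = (1 - G) * a := fun a => by
    rw [hG', hE]; field_simp; ring
  have a1 : d * (t * (-(S / T) + u * (Q / T)))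
      + 2 * R * (t ^ 2 * (3 / 2 * (S / T / T) - u * (u + 1) * (Q / T / T))) ≤ 0 := by
    have h1 : d * (t * (-(S / T) + u * (Q / T)))
      + 2 * R * (t ^ 2 * (3 / 2 * (S / T / T) - u * (u + 1) * (Q / T / T)))
      = t / T * (S * (3 * τ - d) + u * Q * (d - 2 * (u + 1) * τ)) := by
      rw [hτ]; field_simp; ring
    rw [h1]
    refine mul_nonpos_of_nonneg_of_nonpos (by positivity) ?_
    have hd' : (3 : ℝ) ≤ d := by exact_mod_cast hd
    have h2 : 0 ≤ (S - Q) * (d - 3 * τ) := mul_nonneg (by linarith) (by linarith)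
    have h3 : 0 ≤ Q * ((1 - u) * (d - 3 * τ)) := by
      have : 0 ≤ d - 3 * τ := by linarith
      have : 0 ≤ 1 - u := by linarith
      positivity
    have h4 : 0 ≤ Q * (u * τ * (2 * u - 1)) := by
      have : 0 ≤ 2 * u - 1 := by linarith
      have : 0 ≤ u := by linarith
      positivity
    linarith
  have a1' := mul_nonneg (show 0 ≤ ((d : ℝ) - 1) / 2 by
    have hd' : (3 : ℝ) ≤ d := by exact_mod_cast hd
    linarith) (neg_nonneg.2 a1)
  have a2 : R * (t * (-(S / T) + u * (Q / T))) = -τ * S + u * τ * Q := by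
    linear_combination -r1 S + u * r1 Q
  have a3 : R * (k * e * (-u * e * (F / E) * S - 1 / 2 * t * F * (S / T)))
      = k * e * F * S * (-u * (1 - G) - 1 / 2 * τ) := by
    linear_combination (-u * k * e * S) * r2 F - 1 / 2 * k * e * F * r1 S
  have a4 : R ^ 2 * (k * e * (u * (u + 1) * e ^ 2 * (F / E / E) * S
      + u * e * t * (F / E) * (S / T) + 3 / 4 * t ^ 2 * F * (S / T / T)))
      = k * e * F * S * (u * (u + 1) * (1 - G) ^ 2 + u * (1 - G) * τ + 3 / 4 * τ ^ 2) := by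
    have r3 : R ^ 2 * (e ^ 2 * (F / E / E)) = (1 - G) ^ 2 * F := by
      linear_combination (R * e) * r2 (F / E) + (1 - G) * r2 F
    have r4 : R ^ 2 * (t ^ 2 * (S / T / T)) = τ ^ 2 * S := by
      linear_combination (R * t) * r1 (S / T) + τ * r1 S
    have r5 : R * (e * (F / E)) * (R * (t * (S / T))) = (1 - G) * F * (τ * S) := by
      rw [r2, r1]
    linear_combination (k * e * u * (u + 1) * S) * r3 + (k * e * u) * r5 + (3 / 4 * k * e * F) * r4
  have hGE' : e * R * G = 1 - G := by
    rw [hE] at hGE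
    linarith
  have a5 : (k * e * F * S) ^ 2 * R = k ^ 2 * e * (1 - G) * H * S ^ 2 := by
    linear_combination (k ^ 2 * e ^ 2 * S ^ 2 * R) * hF2 + (k ^ 2 * e * H * S ^ 2) * hGE'
  have a6 : R * (1 / 2 * p * e * (-u * t * (Q / T) * G - e * Q * (G / E)))
      = 1 / 2 * p * e * Q * G * (-u * τ - (1 - G)) := by
    linear_combination (-1 / 2 * p * e * u * G) * r1 Q - 1 / 2 * p * e * Q * r2 G
  have a7 : p * Q * (1 / 2 * e * G) ^ 2 * R = 1 / 4 * p * e * Q * G * (1 - G) := by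
    linear_combination (1 / 4 * p * e * Q * G) * hGE'
  clear_value T E
  clear hfar0 hS2' hG' r1 r2
  set g₁ := t * (-(S / T) + u * (Q / T))
  set θ₁ := k * e * (-u * e * (F / E) * S - 1 / 2 * t * F * (S / T))
  set θ₂ := k * e * (u * (u + 1) * e ^ 2 * (F / E / E) * S
      + u * e * t * (F / E) * (S / T) + 3 / 4 * t ^ 2 * F * (S / T / T))
  set θ := k * e * F * S
  clear_value g₁ θ₁ θ₂ θ
  linear_combination key + a1'
    + (1 / 2 * (2 * (2 * S - Q + 2 * R * g₁) + 6 * (2 * S - Q) - 4 * R * θ * (2 * S - Q))) * a3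
    + (1 / 2 * (-(2 * S - Q + 2 * R * g₁)
        + (-2 - 4 * (-u * (1 - G) - 1 / 2 * τ)) * (2 * S - Q))) * a5
    + (θ + 2 * θ * (-u * (1 - G) - 1 / 2 * τ) - k ^ 2 * e * (1 - G) * H * S ^ 2 - lam ^ 2) * a2
    + 2 * (2 * S - Q) * a4 - 1 / 2 * a6 + 1 / 4 * a7

end WeightParams

/-! ### The Carleman weight -/

theorem memLp_top_of_continuous {d : ℕ} {a : Space d → ℝ} (ha : Continuous a) (C : ℝ)
    (h : ∀ x, |a x| ≤ C) : MemLp a ⊤ (volume : Measure (Space d)) :=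
  memLp_top_of_bound ha.aestronglyMeasurable C (Filter.Eventually.of_forall h)

theorem continuous_pw {d : ℕ} {c : ℝ} (hc : 0 ≤ c) (r : ℝ) : Continuous (pw (d := d) c r) :=
  (radialDeriv_pw hc r).temperate.1.continuous

theorem pw_mul_norm_sq_le {d : ℕ} {c : ℝ} (hc : 0 ≤ c) (r : ℝ) (x : Space d) :
    pw c r x * (c * ‖x‖ ^ 2) ≤ pw c (r + 1) x := by
  rw [← pw_mul hc]
  refine mul_le_mul_of_nonneg_left ?_ (pw_pos hc r x).le
  rw [pw, Real.rpow_one]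
  linarith

theorem abs_coord_le {d : ℕ} (x : Space d) (j : Fin d) : |x j| ≤ ‖x‖ := PiLp.norm_apply_le x j

namespace WeightParams

variable {p e t lam : ℝ}

theorem e_pos (h : WeightParams p e t lam) : 0 < e := by linarith [h.one_le_e]

/-- The concrete Carleman weight with parameters `p`, `e`, `t`. With `E = 1 + e|x|²`, `T = 1 + t|x|²`
the multiplier is `g = 2 T^(-1/2) - T^(-(1+p)/2)`, so that `g + 2|x|² g₁ ≥ p T^(-(1+p)/2) = m`, and
`γ = e / (2E)` is adapted to the Hardy inequality at the scale `e ^ (-1/2)`. -/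
noncomputable def weight (h : WeightParams p e t lam) {d : ℕ} (hd : 3 ≤ d) :
    CarlemanWeight d lam where
  φ := phase p e t
  g x := 2 * pw t (-(1 / 2)) x - pw t (-((1 + p) / 2)) x
  g₁ x := t * (-pw t (-(1 / 2) - 1) x + (1 + p) / 2 * pw t (-((1 + p) / 2) - 1) x)
  g₂ x := t ^ 2 * (3 / 2 * pw t (-(1 / 2) - 1 - 1) x
    - (1 + p) / 2 * ((1 + p) / 2 + 1) * pw t (-((1 + p) / 2) - 1 - 1) x)
  θ x := p / 100 * e * pw e (-((1 + p) / 2)) x * pw t (-(1 / 2)) x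
  θ₁ x := p / 100 * e * (-((1 + p) / 2) * e * pw e (-((1 + p) / 2) - 1) x * pw t (-(1 / 2)) x
    - 1 / 2 * t * pw e (-((1 + p) / 2)) x * pw t (-(1 / 2) - 1) x)
  θ₂ x := p / 100 * e * ((1 + p) / 2 * ((1 + p) / 2 + 1) * e ^ 2
      * pw e (-((1 + p) / 2) - 1 - 1) x * pw t (-(1 / 2)) x
    + (1 + p) / 2 * e * t * pw e (-((1 + p) / 2) - 1) x * pw t (-(1 / 2) - 1) x
    + 3 / 4 * t ^ 2 * pw e (-((1 + p) / 2)) x * pw t (-(1 / 2) - 1 - 1) x)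
  m x := p * pw t (-((1 + p) / 2)) x
  q x := (p / 100) ^ 2 / 10 * (pw t (-((1 + p) / 2)) x * (lam ^ 2 + e * pw e (-p) x))
  γ x := 1 / 2 * e * pw e (-1) x
  β₁ x := 1 / 2 * p * e * (-((1 + p) / 2) * t * pw t (-((1 + p) / 2) - 1) x * pw e (-1) x
    - e * pw t (-((1 + p) / 2)) x * pw e (-1 - 1) x)
  exp_φ := (hasTemperateGrowth_phase h.p_pos h.one_le_e h.t_pos h.t_le).exp
    (exists_phase_le d h.p_pos h.one_le_e h.t_pos h.t_le).choose_spec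
  fderiv_φ j x := by
    have h1 := (hasFDerivAt_phase (p := p) h.e_pos.le h.t_pos.le x).exp
    rw [h1.fderiv, phaseDeriv_norm_sq]
    simp [stdVec, EuclideanSpace.inner_single_right]
  radial_g := (((radialDeriv_pw h.t_pos.le (-(1 / 2))).const_mul 2).add
      ((radialDeriv_pw h.t_pos.le (-((1 + p) / 2))).const_mul (-1))).congr
    (fun x => by ring) (fun x => by ring)
  radial_g₁ := (((radialDeriv_pw h.t_pos.le (-(1 / 2) - 1)).const_mul (-t)).add
      ((radialDeriv_pw h.t_pos.le (-((1 + p) / 2) - 1)).const_mul (t * ((1 + p) / 2)))).congr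
    (fun x => by ring) (fun x => by ring)
  temperate_g₂ := ((((radialDeriv_pw h.t_pos.le (-(1 / 2) - 1 - 1)).const_mul (t ^ 2 * (3 / 2))).add
      ((radialDeriv_pw h.t_pos.le (-((1 + p) / 2) - 1 - 1)).const_mul
        (-t ^ 2 * ((1 + p) / 2 * ((1 + p) / 2 + 1))))).congr
    (fun x => by ring) (fun _ => rfl)).temperate
  radial_θ := (((radialDeriv_pw h.e_pos.le (-((1 + p) / 2))).mul
      (radialDeriv_pw h.t_pos.le (-(1 / 2)))).const_mul (p / 100 * e)).congr
    (fun x => by ring) (fun x => by ring)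
  radial_θ₁ := ((((radialDeriv_pw h.e_pos.le (-((1 + p) / 2) - 1)).mul
      (radialDeriv_pw h.t_pos.le (-(1 / 2)))).const_mul (p / 100 * e * (-((1 + p) / 2) * e))).add
      (((radialDeriv_pw h.e_pos.le (-((1 + p) / 2))).mul
      (radialDeriv_pw h.t_pos.le (-(1 / 2) - 1))).const_mul (-(p / 100 * e * (1 / 2 * t))))).congr
    (fun x => by ring) (fun x => by ring)
  temperate_θ₂ := ((((((radialDeriv_pw h.e_pos.le (-((1 + p) / 2) - 1 - 1)).mul
      (radialDeriv_pw h.t_pos.le (-(1 / 2)))).const_mul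
        (p / 100 * e * ((1 + p) / 2 * ((1 + p) / 2 + 1) * e ^ 2))).add
      (((radialDeriv_pw h.e_pos.le (-((1 + p) / 2) - 1)).mul
      (radialDeriv_pw h.t_pos.le (-(1 / 2) - 1))).const_mul
        (p / 100 * e * ((1 + p) / 2 * e * t)))).add
      (((radialDeriv_pw h.e_pos.le (-((1 + p) / 2))).mul
      (radialDeriv_pw h.t_pos.le (-(1 / 2) - 1 - 1))).const_mul
        (p / 100 * e * (3 / 4 * t ^ 2)))).congr
    (fun x => by ring) (fun _ => rfl)).temperate
  temperate_m := ((radialDeriv_pw h.t_pos.le (-((1 + p) / 2))).const_mul p).temperate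
  temperate_q := ((((radialDeriv_pw h.t_pos.le (-((1 + p) / 2))).const_mul
      ((p / 100) ^ 2 / 10 * lam ^ 2)).add
      (((radialDeriv_pw h.t_pos.le (-((1 + p) / 2))).mul
      (radialDeriv_pw h.e_pos.le (-p))).const_mul ((p / 100) ^ 2 / 10 * e))).congr
    (fun x => by ring) (fun _ => rfl)).temperate
  temperate_γ := ((radialDeriv_pw h.e_pos.le (-1)).const_mul (1 / 2 * e)).temperate
  radial_mγ := (((radialDeriv_pw h.t_pos.le (-((1 + p) / 2))).mul
      (radialDeriv_pw h.e_pos.le (-1))).const_mul (1 / 2 * p * e)).congr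
    (fun x => by ring) (fun x => by ring)
  temperate_β₁ := (((((radialDeriv_pw h.t_pos.le (-((1 + p) / 2) - 1)).mul
      (radialDeriv_pw h.e_pos.le (-1))).const_mul (1 / 2 * p * e * (-((1 + p) / 2) * t))).add
      (((radialDeriv_pw h.t_pos.le (-((1 + p) / 2))).mul
      (radialDeriv_pw h.e_pos.le (-1 - 1))).const_mul (-(1 / 2 * p * e * e)))).congr
    (fun x => by ring) (fun _ => rfl)).temperate
  g_pos x := by
    have h1 : pw t (-((1 + p) / 2)) x ≤ pw t (-(1 / 2)) x :=
      pw_le_pw h.t_pos.le (by linarith [h.p_pos]) x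
    have h2 := pw_pos h.t_pos.le (-(1 / 2)) x
    linarith
  g₁_nonpos x := by
    have h1 : pw t (-((1 + p) / 2) - 1) x ≤ pw t (-(1 / 2) - 1) x :=
      pw_le_pw h.t_pos.le (by linarith [h.p_pos]) x
    have h2 := pw_pos h.t_pos.le (-(1 / 2) - 1) x
    have h3 := mul_le_mul_of_nonneg_left h1 (show 0 ≤ (1 + p) / 2 by linarith [h.p_pos])
    refine mul_nonpos_of_nonneg_of_nonpos h.t_pos.le ?_
    nlinarith [h.p_le]
  m_nonneg x := mul_nonneg h.p_pos.le (pw_pos h.t_pos.le _ x).le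
  m_le x := by
    have hT := one_le_one_add_mul_norm_sq h.t_pos.le x
    have hS := pw_pos h.t_pos.le (-(1 / 2)) x
    have hQS : pw t (-((1 + p) / 2)) x ≤ pw t (-(1 / 2)) x :=
      pw_le_pw h.t_pos.le (by linarith [h.p_pos]) x
    have hQ := pw_pos h.t_pos.le (-((1 + p) / 2)) x
    simp only [pw_sub_one h.t_pos.le]
    generalize pw t (-(1 / 2)) x = S at *
    generalize pw t (-((1 + p) / 2)) x = Q at *
    have hT0 : 1 + t * ‖x‖ ^ 2 ≠ 0 := by linarith
    generalize ‖x‖ ^ 2 = R at *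
    have h3 : 2 * S - Q + 2 * R *
        (t * (-(S / (1 + t * R)) + (1 + p) / 2
          * (Q / (1 + t * R)))) - p * Q
        = (2 * (S - Q)
          + (1 - p) * Q) / (1 + t * R) := by
      have ha := div_mul_cancel₀ S hT0
      have hb := div_mul_cancel₀ Q hT0
      rw [eq_div_iff hT0]
      linear_combination (-2 * R * t) * ha + (R * t * (1 + p)) * hb
    have h4 : 0 ≤ (2 * (S - Q)
          + (1 - p) * Q) / (1 + t * R) := by
      have : 0 ≤ 1 - p := by linarith [h.p_le]
      have : 0 ≤ S - Q := by linarith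
      positivity
    linarith
  q_le x := h.inequality hd x rfl rfl

section
variable (h : WeightParams p e t lam) {d : ℕ} (hd : 3 ≤ d) (x : Space d)

theorem g_le : (h.weight hd).g x ≤ 2 * pw t (-(1 / 2)) x := by
  have := pw_pos h.t_pos.le (-((1 + p) / 2)) x
  show 2 * pw t (-(1 / 2)) x - pw t (-((1 + p) / 2)) x ≤ _
  linarith

theorem le_g : pw t (-(1 / 2)) x ≤ (h.weight hd).g x := by
  have h1 : pw t (-((1 + p) / 2)) x ≤ pw t (-(1 / 2)) x :=
    pw_le_pw h.t_pos.le (by linarith [h.p_pos]) x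
  show _ ≤ 2 * pw t (-(1 / 2)) x - pw t (-((1 + p) / 2)) x
  linarith

theorem θ_pos : 0 < (h.weight hd).θ x := by
  have h1 := pw_pos h.e_pos.le (-((1 + p) / 2)) x
  have h2 := pw_pos h.t_pos.le (-(1 / 2)) x
  have h3 := h.p_pos
  have h4 := h.e_pos
  show 0 < p / 100 * e * pw e (-((1 + p) / 2)) x * pw t (-(1 / 2)) x
  positivity

theorem θ_sq_mul_norm_sq_le :
    (h.weight hd).θ x ^ 2 * ‖x‖ ^ 2 ≤ (p / 100) ^ 2 * e * pw e (-p) x := by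
  have h1 := pw_pos h.t_pos.le (-(1 / 2)) x
  have h2 : pw t (-(1 / 2)) x ≤ 1 := pw_le_one h.t_pos.le (by norm_num) x
  have h3 := pw_mul_norm_sq_le h.e_pos.le (-((1 + p) / 2) + -((1 + p) / 2)) x
  have h4 := h.e_pos
  rw [← pw_mul h.e_pos.le, show -((1 + p) / 2) + -((1 + p) / 2) + 1 = -p by ring] at h3
  show (p / 100 * e * pw e (-((1 + p) / 2)) x * pw t (-(1 / 2)) x) ^ 2 * ‖x‖ ^ 2 ≤ _
  have h5 : pw t (-(1 / 2)) x ^ 2 ≤ 1 := by nlinarith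
  calc (p / 100 * e * pw e (-((1 + p) / 2)) x * pw t (-(1 / 2)) x) ^ 2 * ‖x‖ ^ 2
      = (p / 100) ^ 2 * e * (pw e (-((1 + p) / 2)) x * pw e (-((1 + p) / 2)) x * (e * ‖x‖ ^ 2))
        * pw t (-(1 / 2)) x ^ 2 := by ring
    _ ≤ (p / 100) ^ 2 * e * pw e (-p) x * 1 := by
        have := pw_pos h.e_pos.le (-((1 + p) / 2)) x
        have := pw_pos h.e_pos.le (-p) x
        gcongr
    _ = _ := mul_one _

theorem θ_mul_norm_le : (h.weight hd).θ x * ‖x‖ ≤ e := by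
  have h0 := h.e_pos
  have h1 := h.θ_sq_mul_norm_sq_le hd x
  have h2 : pw e (-p) x ≤ 1 := pw_le_one h.e_pos.le (by linarith [h.p_pos]) x
  refine le_of_sq_le_sq ?_ h0.le
  have h3 : (p / 100) ^ 2 ≤ 1 := by nlinarith [h.p_pos, h.p_le]
  calc ((h.weight hd).θ x * ‖x‖) ^ 2 ≤ (p / 100) ^ 2 * e * pw e (-p) x := by rw [mul_pow]; exact h1
    _ ≤ 1 * e * 1 := by
      have := pw_pos h.e_pos.le (-p) x
      gcongr
    _ ≤ e ^ 2 := by nlinarith [h.one_le_e]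

theorem g_mul_norm_le : (h.weight hd).g x * ‖x‖ ≤ 2 / t := by
  have h0 := h.t_pos
  have h1 : pw t (-(1 / 2)) x * ‖x‖ ≤ 1 / t := by
    refine le_of_sq_le_sq ?_ (by positivity)
    have h3 := pw_mul_norm_sq_le h.t_pos.le (-(1 / 2) + -(1 / 2)) x
    rw [← pw_mul h.t_pos.le, show (-(1 / 2) + -(1 / 2) + 1 : ℝ) = 0 by ring, pw_zero] at h3
    have h4 : (1 : ℝ) ≤ 1 / t := by rw [le_div_iff₀ h0]; linarith [h.t_le]
    calc (pw t (-(1 / 2)) x * ‖x‖) ^ 2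
        = 1 / t * (pw t (-(1 / 2)) x * pw t (-(1 / 2)) x * (t * ‖x‖ ^ 2)) := by field_simp
      _ ≤ 1 / t * 1 := by gcongr
      _ ≤ 1 / t * (1 / t) := by gcongr
      _ = _ := (sq _).symm
  calc (h.weight hd).g x * ‖x‖ ≤ 2 * pw t (-(1 / 2)) x * ‖x‖ := by gcongr; exact h.g_le hd x
    _ = 2 * (pw t (-(1 / 2)) x * ‖x‖) := by ring
    _ ≤ 2 * (1 / t) := by gcongr
    _ = _ := by ring

theorem g_le_two : (h.weight hd).g x ≤ 2 := by
  have h2 : pw t (-(1 / 2)) x ≤ 1 := pw_le_one h.t_pos.le (by norm_num) x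
  linarith [h.g_le hd x]

theorem θ_div_g_le : (h.weight hd).θ x / (h.weight hd).g x ≤ e := by
  rw [div_le_iff₀ ((h.weight hd).g_pos x)]
  have h1 := h.le_g hd x
  have h2 : pw e (-((1 + p) / 2)) x ≤ 1 := pw_le_one h.e_pos.le (by linarith [h.p_pos]) x
  have h3 := pw_pos h.t_pos.le (-(1 / 2)) x
  have h4 := pw_pos h.e_pos.le (-((1 + p) / 2)) x
  have h5 := h.e_pos
  have h6 := h.p_pos
  show p / 100 * e * pw e (-((1 + p) / 2)) x * pw t (-(1 / 2)) x ≤ _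
  calc p / 100 * e * pw e (-((1 + p) / 2)) x * pw t (-(1 / 2)) x
      ≤ 1 * e * 1 * pw t (-(1 / 2)) x := by gcongr; linarith [h.p_le]
    _ = e * pw t (-(1 / 2)) x := by ring
    _ ≤ e * (h.weight hd).g x := by gcongr

theorem g_div_θ_le : (h.weight hd).g x / (h.weight hd).θ x
    ≤ 200 / (p * e) * pw e ((1 + p) / 2) x := by
  rw [div_le_iff₀ (h.θ_pos hd x)]
  have h1 : pw e ((1 + p) / 2) x * pw e (-((1 + p) / 2)) x = 1 := by
    rw [pw_mul h.e_pos.le, add_neg_cancel, pw_zero]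
  have h5 := h.e_pos
  have h6 := h.p_pos
  refine (h.g_le hd x).trans_eq ?_
  show _ = 200 / (p * e) * pw e ((1 + p) / 2) x *
    (p / 100 * e * pw e (-((1 + p) / 2)) x * pw t (-(1 / 2)) x)
  calc 2 * pw t (-(1 / 2)) x = 2 * (pw e ((1 + p) / 2) x * pw e (-((1 + p) / 2)) x)
        * pw t (-(1 / 2)) x := by rw [h1]; ring
    _ = _ := by
      generalize pw e ((1 + p) / 2) x = A
      generalize pw e (-((1 + p) / 2)) x = B
      generalize pw t (-(1 / 2)) x = D
      field_simp
      ring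

theorem abs_g_mul_le : |(h.weight hd).g x * ((h.weight hd).θ x * ‖x‖ ^ 2 + ((d : ℝ) - 1) / 2)|
    ≤ 2 / t * e + d := by
  have h0 := (h.weight hd).g_pos x
  have h1 := h.θ_pos hd x
  have h2 : (3 : ℝ) ≤ d := by exact_mod_cast hd
  have h3 := h.g_mul_norm_le hd x
  have h4 := h.θ_mul_norm_le hd x
  have h5 : 0 ≤ ((d : ℝ) - 1) / 2 := by linarith
  have ht := h.t_pos
  rw [abs_of_nonneg (by positivity)]
  calc (h.weight hd).g x * ((h.weight hd).θ x * ‖x‖ ^ 2 + ((d : ℝ) - 1) / 2)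
      = ((h.weight hd).g x * ‖x‖) * ((h.weight hd).θ x * ‖x‖)
        + (h.weight hd).g x * (((d : ℝ) - 1) / 2) := by ring
    _ ≤ 2 / t * e + 2 * (((d : ℝ) - 1) / 2) := by gcongr; exact h.g_le_two hd x
    _ ≤ _ := by linarith

end

theorem bounded (h : WeightParams p e t lam) {d : ℕ} (hd : 3 ≤ d) : (h.weight hd).Bounded := by
  obtain ⟨M, hM⟩ := exists_phase_le d h.p_pos h.one_le_e h.t_pos h.t_le
  have hexp : ∀ x, Real.exp ((h.weight hd).φ x) ^ 2 ≤ Real.exp M ^ 2 := fun x => by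
    gcongr
    exact hM x
  have cexp : Continuous fun x => Real.exp ((h.weight hd).φ x) ^ 2 :=
    ((h.weight hd).exp_φ.1.continuous).pow 2
  have cθ : Continuous (h.weight hd).θ := (h.weight hd).radial_θ.temperate.1.continuous
  have cg : Continuous (h.weight hd).g := (h.weight hd).radial_g.temperate.1.continuous
  have hQ : ∀ x : Space d, pw t (-((1 + p) / 2)) x ≤ 1 := pw_le_one h.t_pos.le (by linarith [h.p_pos])
  have hH : ∀ x : Space d, pw e (-p) x ≤ 1 := pw_le_one h.e_pos.le (by linarith [h.p_pos])
  have key : ∀ {a : Space d → ℝ} {C : ℝ}, Continuous a → (∀ x, 0 ≤ a x) → (∀ x, a x ≤ C) →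
      MemLp (fun x => Real.exp ((h.weight hd).φ x) ^ 2 * a x) ⊤ (volume : Measure (Space d)) := by
    intro a C ha ha0 haC
    refine memLp_top_of_continuous (cexp.mul ha) (Real.exp M ^ 2 * C) fun x => ?_
    rw [abs_of_nonneg (mul_nonneg (by positivity) (ha0 x))]
    exact mul_le_mul (hexp x) (haC x) (ha0 x) (by positivity)
  constructor
  · simpa using key (a := fun _ => 1) (C := 1) continuous_const (fun _ => zero_le_one) fun _ => le_rfl
  · refine key (C := p / 4) ((h.weight hd).temperate_m.1.continuous.div_const 4)
      (fun x => div_nonneg ((h.weight hd).m_nonneg x) (by norm_num)) fun x => ?_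
    have : (h.weight hd).m x ≤ p := mul_le_of_le_one_right h.p_pos.le (hQ x)
    linarith
  · refine key (C := 2 * e) (continuous_const.mul (cθ.div cg fun x => ((h.weight hd).g_pos x).ne'))
      (fun x => mul_nonneg (by norm_num) (div_nonneg (h.θ_pos hd x).le ((h.weight hd).g_pos x).le))
      fun x => ?_
    have := h.θ_div_g_le hd x
    linarith
  · refine key (C := (p / 100) ^ 2 / 10 * (1 * (lam ^ 2 + e * 1)))
      (h.weight hd).temperate_q.1.continuous (fun x => ?_) fun x => ?_
    all_goals
      have h1 := pw_pos h.t_pos.le (-((1 + p) / 2)) x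
      have h2 := pw_pos h.e_pos.le (-p) x
      have h3 := h.e_pos
      have h4 := hQ x
      have h5 := hH x
    · show 0 ≤ (p / 100) ^ 2 / 10 * (pw t (-((1 + p) / 2)) x * (lam ^ 2 + e * pw e (-p) x))
      positivity
    · show (p / 100) ^ 2 / 10 * (pw t (-((1 + p) / 2)) x * (lam ^ 2 + e * pw e (-p) x)) ≤ _
      gcongr
  · intro j
    refine memLp_top_of_continuous (by fun_prop) e fun x => ?_
    rw [abs_mul, abs_of_pos (h.θ_pos hd x)]
    exact (mul_le_mul_of_nonneg_left (abs_coord_le x j) (h.θ_pos hd x).le).trans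
      (h.θ_mul_norm_le hd x)
  · intro j
    refine memLp_top_of_continuous (by fun_prop) (2 / t) fun x => ?_
    rw [abs_mul, abs_of_pos ((h.weight hd).g_pos x)]
    exact (mul_le_mul_of_nonneg_left (abs_coord_le x j) ((h.weight hd).g_pos x).le).trans
      (h.g_mul_norm_le hd x)
  · exact memLp_top_of_continuous (by fun_prop) _ fun x => h.abs_g_mul_le hd x

end WeightParams

/-! ### The form operator -/

section FormOperator

variable {d : ℕ} {b : Space d → Space d} {V : Space d → ℝ}

/-- The magnetic derivative `i ∂_j + b_j : H¹ → L²`. -/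
noncomputable def magGrad (hb : ∀ j, MemLp (fun x => b x j) ⊤ (volume : Measure (Space d)))
    (j : Fin d) : sobolev d →L[ℂ] L2 d :=
  Complex.I • grad j + mulOp (hb j) ∘L val d

theorem magGrad_apply (hb : ∀ j, MemLp (fun x => b x j) ⊤ (volume : Measure (Space d)))
    (j : Fin d) (U : sobolev d) :
    magGrad hb j U = Complex.I • grad j U + mulOp (hb j) (val d U) := rfl

/-- The operator on `H¹` which represents the form `q(U, W) - ⟨z U, W⟩`. -/
noncomputable def formOp (hb : ∀ j, MemLp (fun x => b x j) ⊤ (volume : Measure (Space d)))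
    (hV : MemLp V ⊤ (volume : Measure (Space d))) (z : ℂ) : sobolev d →L[ℂ] sobolev d :=
  ∑ j, (magGrad hb j).adjoint ∘L magGrad hb j
    + (val d).adjoint ∘L (mulOp hV ∘L val d - z • val d)

theorem inner_formOp (hb : ∀ j, MemLp (fun x => b x j) ⊤ (volume : Measure (Space d)))
    (hV : MemLp V ⊤ (volume : Measure (Space d))) (z : ℂ) (U W : sobolev d) :
    ⟪formOp hb hV z U, W⟫_ℂ = ∑ j, ⟪magGrad hb j U, magGrad hb j W⟫_ℂ
      + ⟪mulOp hV (val d U), val d W⟫_ℂ - ⟪z • val d U, val d W⟫_ℂ := by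
  simp only [formOp, add_apply, sum_apply, ContinuousLinearMap.comp_apply, sub_apply, smul_apply,
    inner_add_left, sum_inner, ContinuousLinearMap.adjoint_inner_left, inner_sub_left]
  ring

theorem form_eq_inner (hb : ∀ j, MemLp (fun x => b x j) ⊤ (volume : Measure (Space d)))
    (hV : MemLp V ⊤ (volume : Measure (Space d))) (U W : sobolev d) :
    form b V (val d U) (fun j => grad j U) (val d W) (fun j => grad j W)
      = ∑ j, ⟪magGrad hb j U, magGrad hb j W⟫_ℂ + ⟪mulOp hV (val d U), val d W⟫_ℂ := by
  have h : ∀ (j : Fin d) (U : sobolev d), magGrad hb j U =ᵐ[volume] fun x =>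
      Complex.I * grad j U x + (b x j : ℂ) * val d U x := fun j U => by
    rw [magGrad_apply]
    filter_upwards [Lp.coeFn_add (Complex.I • grad j U) (mulOp (hb j) (val d U)),
      Lp.coeFn_smul Complex.I (grad j U), mulOp_coeFn (hb j) (val d U)] with x h1 h2 h3
    rw [h1, Pi.add_apply, h2, h3, Pi.smul_apply, smul_eq_mul]
  unfold form
  congr 1
  · refine Finset.sum_congr rfl fun j _ => ?_
    rw [L2.inner_def]
    refine integral_congr_ae ?_
    filter_upwards [h j U, h j W] with x h1 h2
    rw [h1, h2, RCLike.inner_apply, mul_comm]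
  · rw [L2.inner_def]
    refine integral_congr_ae ?_
    filter_upwards [mulOp_coeFn hV (val d U)] with x h1
    rw [h1, RCLike.inner_apply]
    simp
    ring

theorem sum_norm_grad_sq_le (hb : ∀ j, MemLp (fun x => b x j) ⊤ (volume : Measure (Space d)))
    (U : sobolev d) : ∑ j, ‖grad j U‖ ^ 2
      ≤ 2 * ∑ j, ‖magGrad hb j U‖ ^ 2 + 2 * (∑ j, ‖mulOp (hb j)‖ ^ 2) * ‖val d U‖ ^ 2 := by
  rw [mul_assoc, Finset.sum_mul, Finset.mul_sum, Finset.mul_sum, ← Finset.sum_add_distrib]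
  refine Finset.sum_le_sum fun j _ => ?_
  have h1 : Complex.I • grad j U = magGrad hb j U - mulOp (hb j) (val d U) := by
    rw [magGrad_apply]; abel
  have h2 : ‖grad j U‖ = ‖Complex.I • grad j U‖ := by rw [norm_smul, Complex.norm_I, one_mul]
  have h3 : ‖grad j U‖ ≤ ‖magGrad hb j U‖ + ‖mulOp (hb j)‖ * ‖val d U‖ := by
    rw [h2, h1]
    exact (norm_sub_le _ _).trans (add_le_add le_rfl ((mulOp (hb j)).le_opNorm _))
  calc ‖grad j U‖ ^ 2 ≤ (‖magGrad hb j U‖ + ‖mulOp (hb j)‖ * ‖val d U‖) ^ 2 := by gcongr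
    _ ≤ 2 * ‖magGrad hb j U‖ ^ 2 + 2 * (‖mulOp (hb j)‖ ^ 2 * ‖val d U‖ ^ 2) := by
      nlinarith [sq_nonneg (‖magGrad hb j U‖ - ‖mulOp (hb j)‖ * ‖val d U‖)]

theorem inner_self_re_im {E : Type*} [NormedAddCommGroup E] [InnerProductSpace ℂ E] (u : E) :
    ⟪u, u⟫_ℂ = ((‖u‖ ^ 2 : ℝ) : ℂ) := by
  rw [inner_self_eq_norm_sq_to_K]
  push_cast
  rfl

theorem inner_mulOp_self_im {a : Space d → ℝ} (ha : MemLp a ⊤ (volume : Measure (Space d)))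
    (u : L2 d) : (⟪mulOp ha u, u⟫_ℂ).im = 0 := by
  rw [← Complex.conj_eq_iff_im, inner_conj_symm, inner_mulOp_left]

theorem re_inner_formOp_self (hb : ∀ j, MemLp (fun x => b x j) ⊤ (volume : Measure (Space d)))
    (hV : MemLp V ⊤ (volume : Measure (Space d))) (z : ℂ) (U : sobolev d) :
    (⟪formOp hb hV z U, U⟫_ℂ).re = ∑ j, ‖magGrad hb j U‖ ^ 2
      + (⟪mulOp hV (val d U), val d U⟫_ℂ).re - z.re * ‖val d U‖ ^ 2 := by
  rw [inner_formOp, inner_smul_left]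
  simp only [inner_self_re_im, Complex.sub_re, Complex.add_re, Complex.re_sum, Complex.ofReal_re,
    Complex.mul_re, Complex.ofReal_im, Complex.conj_re]
  ring

theorem im_inner_formOp_self (hb : ∀ j, MemLp (fun x => b x j) ⊤ (volume : Measure (Space d)))
    (hV : MemLp V ⊤ (volume : Measure (Space d))) (z : ℂ) (U : sobolev d) :
    (⟪formOp hb hV z U, U⟫_ℂ).im = z.im * ‖val d U‖ ^ 2 := by
  rw [inner_formOp, inner_smul_left]
  simp only [inner_self_re_im, Complex.sub_im, Complex.add_im, Complex.im_sum, Complex.ofReal_im,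
    Complex.mul_im, Complex.ofReal_re, Complex.conj_im, inner_mulOp_self_im]
  simp

/-- Away from the real axis the form is coercive on `H¹`: its imaginary part controls `u`, and then its
real part controls `∇u`. -/
theorem formOp_coercive (hb : ∀ j, MemLp (fun x => b x j) ⊤ (volume : Measure (Space d)))
    (hV : MemLp V ⊤ (volume : Measure (Space d))) {z : ℂ} (hz : z.im ≠ 0) :
    ∃ c : ℝ, 0 < c ∧ ∀ U, c * ‖U‖ ^ 2 ≤ ‖⟪formOp hb hV z U, U⟫_ℂ‖ := by
  have hε : 0 < |z.im| := abs_pos.2 hz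
  set K := 2 * (∑ j, ‖mulOp (hb j)‖ ^ 2) + 1 with hK
  have hK0 : 0 ≤ K := by positivity
  set D := 2 + (2 * (‖mulOp hV‖ + |z.re|) + K) / |z.im| with hD
  have hD0 : 0 < D := by positivity
  refine ⟨D⁻¹, inv_pos.2 hD0, fun U => ?_⟩
  rw [inv_mul_le_iff₀ hD0]
  have h1 := re_inner_formOp_self hb hV z U
  have h2 := im_inner_formOp_self hb hV z U
  set w := ⟪formOp hb hV z U, U⟫_ℂ
  have h3 := Complex.abs_re_le_norm w
  have h4 := Complex.abs_im_le_norm w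
  have h5 := sum_norm_grad_sq_le hb U
  have h6 := sobolev_norm_sq U
  have h7 : ‖val d U‖ ^ 2 ≤ ‖w‖ / |z.im| := by
    rw [le_div_iff₀ hε]
    rw [h2, abs_mul, abs_of_nonneg (sq_nonneg ‖val d U‖)] at h4
    linarith
  have h8 : |(⟪mulOp hV (val d U), val d U⟫_ℂ).re| ≤ ‖mulOp hV‖ * ‖val d U‖ ^ 2 := by
    refine (Complex.abs_re_le_norm _).trans ((norm_inner_le_norm _ _).trans ?_)
    have := (mulOp hV).le_opNorm (val d U)
    calc _ ≤ ‖mulOp hV‖ * ‖val d U‖ * ‖val d U‖ := by gcongr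
      _ = _ := by ring
  have h9 : ∑ j, ‖magGrad hb j U‖ ^ 2 ≤ ‖w‖ + (‖mulOp hV‖ + |z.re|) * ‖val d U‖ ^ 2 := by
    have a1 := le_abs_self w.re
    have a2 := neg_le_of_abs_le h8
    have a3 := mul_le_mul_of_nonneg_right (le_abs_self z.re) (sq_nonneg ‖val d U‖)
    linarith
  calc ‖U‖ ^ 2 ≤ 2 * ‖w‖ + (2 * (‖mulOp hV‖ + |z.re|) + K) * ‖val d U‖ ^ 2 := by
        rw [hK]; linarith
    _ ≤ 2 * ‖w‖ + (2 * (‖mulOp hV‖ + |z.re|) + K) * (‖w‖ / |z.im|) := by gcongr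
    _ = D * ‖w‖ := by rw [hD]; field_simp

/-- The solution of the screened equation `-Δv + κ² v = -div F`. -/
theorem exists_screened {κ : ℝ} (hκ : 1 ≤ κ) (F : Fin d → L2 d) : ∃ Y : sobolev d,
    ∀ W : sobolev d, ∑ j, ⟪grad j Y, grad j W⟫_ℂ + (κ : ℂ) ^ 2 * ⟪val d Y, val d W⟫_ℂ
      = ∑ j, ⟪F j, grad j W⟫_ℂ := by
  let A : sobolev d →L[ℂ] sobolev d := ∑ j, (grad j).adjoint ∘L grad j
    + (val d).adjoint ∘L ((κ : ℂ) ^ 2 • val d)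
  have hA : ∀ U W, ⟪A U, W⟫_ℂ = ∑ j, ⟪grad j U, grad j W⟫_ℂ
      + (κ : ℂ) ^ 2 * ⟪val d U, val d W⟫_ℂ := fun U W => by
    simp only [A, add_apply, sum_apply, ContinuousLinearMap.comp_apply, smul_apply,
      inner_add_left, sum_inner, ContinuousLinearMap.adjoint_inner_left, inner_smul_left, map_pow,
      Complex.conj_ofReal]
  obtain ⟨B, hB, -⟩ := A.exists_inverse_of_coercive one_pos fun U => by
    rw [hA]
    have h1 : ∑ j, ⟪grad j U, grad j U⟫_ℂ + (κ : ℂ) ^ 2 * ⟪val d U, val d U⟫_ℂ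
        = ((∑ j, ‖grad j U‖ ^ 2 + κ ^ 2 * ‖val d U‖ ^ 2 : ℝ) : ℂ) := by
      simp only [inner_self_re_im]
      push_cast
      rfl
    rw [h1, Complex.norm_real, Real.norm_of_nonneg (by positivity), sobolev_norm_sq]
    have : ‖val d U‖ ^ 2 ≤ κ ^ 2 * ‖val d U‖ ^ 2 :=
      le_mul_of_one_le_left (sq_nonneg _) (one_le_pow₀ hκ)
    linarith
  refine ⟨B (∑ j, (grad j).adjoint (F j)), fun W => ?_⟩
  rw [← hA, hB, sum_inner]
  simp only [ContinuousLinearMap.adjoint_inner_left]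

/-- The equation `(P - z) u = f₀ - div f` for `u ∈ H¹`, solved for `-Δu`: the term
with `div (b u)` stays in divergence form since `b` need not be differentiable. -/
theorem sum_inner_grad_eq (hb : ∀ j, MemLp (fun x => b x j) ⊤ (volume : Measure (Space d)))
    (hV : MemLp V ⊤ (volume : Measure (Space d))) {z : ℂ} {U : sobolev d} {f₀ : L2 d}
    {f : Fin d → L2 d}
    (hU : ∀ W, ⟪formOp hb hV z U, W⟫_ℂ = ⟪f₀, val d W⟫_ℂ + ∑ j, ⟪f j, grad j W⟫_ℂ)
    (W : sobolev d) :
    ∑ j, ⟪grad j U, grad j W⟫_ℂ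
      = ⟪f₀ - ∑ j, mulOp (hb j) (magGrad hb j U) - mulOp hV (val d U) + z • val d U, val d W⟫_ℂ
        + ∑ j, ⟪f j + Complex.I • mulOp (hb j) (val d U), grad j W⟫_ℂ := by
  have h := hU W
  rw [inner_formOp] at h
  have h1 : ∀ j, ⟪magGrad hb j U, magGrad hb j W⟫_ℂ = ⟪grad j U, grad j W⟫_ℂ
      - ⟪Complex.I • mulOp (hb j) (val d U), grad j W⟫_ℂ
      + ⟪mulOp (hb j) (magGrad hb j U), val d W⟫_ℂ := fun j => by
    rw [magGrad_apply hb j W, inner_add_right, inner_smul_right, inner_mulOp_left, magGrad_apply,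
      inner_add_left, inner_smul_left, inner_smul_left]
    simp only [Complex.conj_I]
    linear_combination -(⟪grad j U, grad j W⟫_ℂ) * Complex.I_sq
  rw [Finset.sum_congr rfl fun j _ => h1 j, Finset.sum_add_distrib, Finset.sum_sub_distrib] at h
  simp only [inner_add_left, inner_sub_left, sum_inner, Finset.sum_add_distrib]
  linear_combination h

end FormOperator

/-! ### Weighted energy estimates for the screened equation -/

theorem abs_re_conj_mul_le (z w : ℂ) : |((starRingEnd ℂ) z * w).re| ≤ ‖z‖ * ‖w‖ := by
  refine (Complex.abs_re_le_norm _).trans ?_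
  rw [norm_mul, RCLike.norm_conj]

/-- The terms other than the energy in the equation tested with `a Y`, at a point with `A = a x` and
`A' = ∇a x`, are bounded by half of the energy and the data. -/
theorem screened_pointwise {d : ℕ} {κ A : ℝ} {A' : Fin d → ℝ} (hA : 0 < A)
    (hA' : ∑ j, A' j ^ 2 ≤ (κ / 2 * A) ^ 2) (G F : Fin d → ℂ) (v : ℂ) :
    ∑ j, (A * ((starRingEnd ℂ) (F j) * G j).re + A' j * ((starRingEnd ℂ) (F j) * v).re
      - A' j * ((starRingEnd ℂ) (G j) * v).re)
    ≤ 1 / 2 * (A * ∑ j, ‖G j‖ ^ 2 + κ ^ 2 * A * ‖v‖ ^ 2) + 2 * (A * ∑ j, ‖F j‖ ^ 2) := by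
  have h1 : ∀ j, A * ((starRingEnd ℂ) (F j) * G j).re + A' j * ((starRingEnd ℂ) (F j) * v).re
      - A' j * ((starRingEnd ℂ) (G j) * v).re
      ≤ 1 / 2 * A * ‖G j‖ ^ 2 + 2 * A * ‖F j‖ ^ 2 + 5 / 4 * A' j ^ 2 / A * ‖v‖ ^ 2 := fun j => by
    have a1 : A * ((starRingEnd ℂ) (F j) * G j).re ≤ A * (‖F j‖ * ‖G j‖) :=
      mul_le_mul_of_nonneg_left ((le_abs_self _).trans (abs_re_conj_mul_le _ _)) hA.le
    have a2 : A' j * ((starRingEnd ℂ) (F j) * v).re ≤ |A' j| * (‖F j‖ * ‖v‖) :=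
      (le_abs_self _).trans (by
        rw [abs_mul]
        exact mul_le_mul_of_nonneg_left (abs_re_conj_mul_le _ _) (abs_nonneg _))
    have a3 : -(A' j * ((starRingEnd ℂ) (G j) * v).re) ≤ |A' j| * (‖G j‖ * ‖v‖) :=
      (neg_le_abs _).trans (by
        rw [abs_mul]
        exact mul_le_mul_of_nonneg_left (abs_re_conj_mul_le _ _) (abs_nonneg _))
    have e1 : 5 / 4 * A' j ^ 2 / A * ‖v‖ ^ 2 = 5 / 4 * A * (|A' j| / A * ‖v‖) ^ 2 := by
      rw [mul_pow, div_pow, sq_abs]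
      field_simp
    have e2 : ∀ r : ℝ, |A' j| * (r * ‖v‖) = A * (r * (|A' j| / A * ‖v‖)) := fun r => by
      field_simp
    rw [e1]
    rw [e2] at a2 a3
    generalize |A' j| / A * ‖v‖ = w at *
    have b1 := mul_nonneg hA.le (sq_nonneg (2 * ‖F j‖ - ‖G j‖))
    have b2 := mul_nonneg hA.le (sq_nonneg (2 * ‖F j‖ - w))
    have b3 := mul_nonneg hA.le (sq_nonneg (2 * w - ‖G j‖))
    linarith
  refine (Finset.sum_le_sum fun j _ => h1 j).trans ?_
  rw [Finset.sum_add_distrib, Finset.sum_add_distrib, ← Finset.mul_sum, ← Finset.mul_sum,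
    ← Finset.sum_mul, ← Finset.sum_div, ← Finset.mul_sum]
  have h2 : 5 / 4 * (∑ j, A' j ^ 2) / A ≤ 1 / 2 * (κ ^ 2 * A) := by
    rw [div_le_iff₀ hA]
    nlinarith [sq_nonneg (κ * A)]
  have h3 := mul_le_mul_of_nonneg_right h2 (sq_nonneg ‖v‖)
  linarith

/-- The weighted energy estimate for the screened equation: test with `a Y`, where the logarithmic
derivative of `a` is at most `κ / 2`. -/
theorem screened_energy {d : ℕ} {a : Space d → ℝ} {a' : Fin d → Space d → ℝ}
    (hag : a.HasTemperateGrowth) (hderiv : ∀ j x, fderiv ℝ a x (stdVec j) = a' j x)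
    (ha : MemLp a ⊤ (volume : Measure (Space d)))
    (ha' : ∀ j, MemLp (a' j) ⊤ (volume : Measure (Space d))) (ha0 : ∀ x, 0 < a x) {κ : ℝ}
    (haκ : ∀ x, ∑ j, a' j x ^ 2 ≤ (κ / 2 * a x) ^ 2) {F : Fin d → L2 d} {Y : sobolev d}
    (hY : ∀ W : sobolev d, ∑ j, ⟪grad j Y, grad j W⟫_ℂ + (κ : ℂ) ^ 2 * ⟪val d Y, val d W⟫_ℂ
      = ∑ j, ⟪F j, grad j W⟫_ℂ) :
    ∫ x, a x * (∑ j, ‖grad j Y x‖ ^ 2 + κ ^ 2 * ‖val d Y x‖ ^ 2)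
      ≤ 4 * ∫ x, a x * ∑ j, ‖F j x‖ ^ 2 := by
  obtain ⟨W, hW0, hW⟩ := exists_sobolev_mul hag hderiv ha ha' Y
  have h1 := congrArg Complex.re (hY W)
  have hκ : ∀ z : ℂ, ((κ : ℂ) ^ 2 * z).re = κ ^ 2 * z.re := fun z => by
    rw [← Complex.ofReal_pow, Complex.re_ofReal_mul]
  simp only [hW0, hW, inner_add_right, Complex.add_re, Complex.re_sum, hκ, re_inner_mulOp,
    conj_mul_self_re] at h1
  have i1 := fun j => integrable_mul_norm_sq ha (grad j Y)
  have i2 := fun j => integrable_mul_re_conj_mul (ha' j) (grad j Y) (val d Y)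
  have i3 := integrable_mul_norm_sq ha (val d Y)
  have i4 := fun j => integrable_mul_re_conj_mul ha (F j) (grad j Y)
  have i5 := fun j => integrable_mul_re_conj_mul (ha' j) (F j) (val d Y)
  have i6 := fun j => integrable_mul_norm_sq ha (F j)
  have iP : Integrable (fun x => a x * (∑ j, ‖grad j Y x‖ ^ 2 + κ ^ 2 * ‖val d Y x‖ ^ 2)) volume := by
    refine ((integrable_finsetSum Finset.univ fun j _ => i1 j).fun_add (i3.const_mul (κ ^ 2))).congr
      (Filter.Eventually.of_forall fun x => ?_)
    simp only [← Finset.mul_sum]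
    ring
  have iF : Integrable (fun x => a x * ∑ j, ‖F j x‖ ^ 2) volume := by
    refine (integrable_finsetSum Finset.univ fun j _ => i6 j).congr
      (Filter.Eventually.of_forall fun x => ?_)
    simp only [← Finset.mul_sum]
  have eP : ∫ x, a x * (∑ j, ‖grad j Y x‖ ^ 2 + κ ^ 2 * ‖val d Y x‖ ^ 2)
      = (∑ j, ∫ x, a x * ‖grad j Y x‖ ^ 2) + κ ^ 2 * ∫ x, a x * ‖val d Y x‖ ^ 2 := by
    rw [← integral_const_mul, ← integral_finsetSum _ fun j _ => i1 j,
      ← integral_add (integrable_finsetSum Finset.univ fun j _ => i1 j) (i3.const_mul _)]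
    refine integral_congr_ae (Filter.Eventually.of_forall fun x => ?_)
    simp only [← Finset.mul_sum]
    ring
  have i7 : ∀ j, Integrable (fun x => a x * ((starRingEnd ℂ) (F j x) * grad j Y x).re
      + a' j x * ((starRingEnd ℂ) (F j x) * val d Y x).re
      - a' j x * ((starRingEnd ℂ) (grad j Y x) * val d Y x).re) volume :=
    fun j => ((i4 j).fun_add (i5 j)).sub (i2 j)
  have iR := integrable_finsetSum Finset.univ fun j _ => i7 j
  have eR : ∫ x, ∑ j, (a x * ((starRingEnd ℂ) (F j x) * grad j Y x).re
        + a' j x * ((starRingEnd ℂ) (F j x) * val d Y x).re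
        - a' j x * ((starRingEnd ℂ) (grad j Y x) * val d Y x).re)
      = ∑ j, ((∫ x, a x * ((starRingEnd ℂ) (F j x) * grad j Y x).re)
        + ∫ x, a' j x * ((starRingEnd ℂ) (F j x) * val d Y x).re)
        - ∑ j, ∫ x, a' j x * ((starRingEnd ℂ) (grad j Y x) * val d Y x).re := by
    rw [integral_finsetSum _ fun j _ => i7 j,
      ← Finset.sum_sub_distrib]
    refine Finset.sum_congr rfl fun j _ => ?_
    rw [integral_sub ((i4 j).fun_add (i5 j)) (i2 j), integral_add (i4 j) (i5 j)]
  have h2 := integral_mono iR ((iP.const_mul (1 / 2)).fun_add (iF.const_mul 2)) fun x => by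
    have := screened_pointwise (ha0 x) (haκ x) (fun j => grad j Y x) (fun j => F j x) (val d Y x)
    simp only
    linarith
  rw [integral_add (iP.const_mul (1 / 2)) (iF.const_mul 2), integral_const_mul, integral_const_mul,
    eR] at h2
  rw [Finset.sum_add_distrib] at h1
  linarith

/-- Removal of a cutoff at infinity from a weighted integral, by Fatou's lemma. -/
theorem integral_le_of_regularized {d : ℕ} {f : Space d → ℝ} (hf : ∀ x, 0 ≤ f x)
    (hfm : AEStronglyMeasurable f volume) {B : ℝ}
    (hint : ∀ n : ℕ, Integrable (fun x => pw (1 / ((n : ℝ) + 1)) (-1) x * f x) volume)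
    (hB : ∀ n : ℕ, ∫ x, pw (1 / ((n : ℝ) + 1)) (-1) x * f x ≤ B) :
    Integrable f volume ∧ ∫ x, f x ≤ B := by
  have hc : ∀ n : ℕ, (0 : ℝ) ≤ 1 / ((n : ℝ) + 1) := fun n => by positivity
  have hlim : ∀ x, Filter.Tendsto (fun n : ℕ => pw (1 / ((n : ℝ) + 1)) (-1) x * f x) Filter.atTop
      (nhds (f x)) := fun x => by
    have h1 : Filter.Tendsto (fun n : ℕ => (1 + 1 / ((n : ℝ) + 1) * ‖x‖ ^ 2)⁻¹ * f x) Filter.atTop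
        (nhds ((1 + 0 * ‖x‖ ^ 2)⁻¹ * f x)) :=
      (((tendsto_one_div_add_atTop_nhds_zero_nat.mul_const _).const_add 1).inv₀
        (by simp)).mul_const _
    simpa [pw_neg_one] using h1
  have hI : Integrable f volume := by
    refine ⟨hfm, ?_⟩
    have h1 : ∫⁻ x, ‖f x‖ₑ ≤ Filter.liminf (fun n : ℕ =>
        ∫⁻ x, ‖pw (1 / ((n : ℝ) + 1)) (-1) x * f x‖ₑ) Filter.atTop := by
      refine le_trans (le_of_eq (lintegral_congr fun x => ?_))
        (lintegral_liminf_le' fun n => (hint n).1.enorm)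
      exact ((hlim x).enorm.liminf_eq).symm
    refine lt_of_le_of_lt h1 (lt_of_le_of_lt (b := ENNReal.ofReal B) ?_ ENNReal.ofReal_lt_top)
    refine Filter.liminf_le_of_le (by isBoundedDefault) fun c hc' => ?_
    obtain ⟨n, hn⟩ := hc'.exists
    refine hn.trans ?_
    have h0 : ∀ x, 0 ≤ pw (1 / ((n : ℝ) + 1)) (-1) x * f x := fun x =>
      mul_nonneg (pw_pos (hc n) _ x).le (hf x)
    rw [← ofReal_integral_norm_eq_lintegral_enorm (hint n)]
    refine ENNReal.ofReal_le_ofReal (le_trans (le_of_eq ?_) (hB n))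
    exact integral_congr_ae (Filter.Eventually.of_forall fun x => Real.norm_of_nonneg (h0 x))
  refine ⟨hI, le_of_tendsto (tendsto_integral_of_dominated_convergence f (fun n => (hint n).1) hI
    (fun n => Filter.Eventually.of_forall fun x => ?_)
    (Filter.Eventually.of_forall hlim)) (Filter.Eventually.of_forall hB)⟩
  rw [Real.norm_of_nonneg (mul_nonneg (pw_pos (hc n) _ x).le (hf x))]
  exact mul_le_of_le_one_left (hf x) (pw_le_one (hc n) (by norm_num) x)

/-! ### The screened equation in the Carleman weight -/

theorem mul_pw_neg_one_sq_le {d : ℕ} {c : ℝ} (hc : 0 ≤ c) (x : Space d) :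
    ‖x‖ ^ 2 * (c * pw c (-1) x) ^ 2 ≤ c := by
  have h1 := pw_mul_norm_sq_le hc (-1) x
  rw [neg_add_cancel, pw_zero] at h1
  have h2 : pw c (-1) x ≤ 1 := pw_le_one hc (by norm_num) x
  have h3 := pw_pos hc (-1) x
  calc ‖x‖ ^ 2 * (c * pw c (-1) x) ^ 2
      = c * (pw c (-1) x * (c * ‖x‖ ^ 2)) * pw c (-1) x := by ring
    _ ≤ c * 1 * 1 := by gcongr
    _ = c := by ring

theorem pw_one_mul_pw_neg_one_le {d : ℕ} {c ν : ℝ} (hν : 0 < ν) (h : ν ≤ c) (x : Space d) :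
    pw c 1 x * pw ν (-1) x ≤ c / ν := by
  have h1 := one_le_one_add_mul_norm_sq hν.le x
  rw [pw_neg_one, pw, Real.rpow_one, ← div_eq_mul_inv, div_le_div_iff₀ (by linarith) hν]
  nlinarith

namespace WeightParams

variable {p e t lam : ℝ}

/-- The weight `exp (2φ) E^((1 + p) / 2)` of the screened equation, with a cutoff `(1 + ν|x|²)⁻¹`. -/
noncomputable def cutoffWeight (p e t ν : ℝ) {d : ℕ} (x : Space d) : ℝ :=
  Real.exp (phase p e t x) * Real.exp (phase p e t x) * (pw e ((1 + p) / 2) x * pw ν (-1) x)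

/-- The logarithmic derivative of `cutoffWeight` with respect to `|x|²`. -/
noncomputable def cutoffLogDeriv (p e t ν : ℝ) {d : ℕ} (x : Space d) : ℝ :=
  p / 100 * e * pw e (-((1 + p) / 2)) x * pw t (-(1 / 2)) x
    + ((1 + p) / 2 * (e * pw e (-1) x) - ν * pw ν (-1) x)

theorem radialDeriv_cutoffWeight (h : WeightParams p e t lam) {d : ℕ} (hd : 3 ≤ d) {ν : ℝ}
    (hν : 0 ≤ ν) : RadialDeriv (cutoffWeight p e t ν (d := d))
      fun x => cutoffWeight p e t ν x * cutoffLogDeriv p e t ν x := by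
  have h1 : RadialDeriv (fun x : Space d => Real.exp (phase p e t x))
      fun x => 1 / 2 * Real.exp (phase p e t x) * (h.weight hd).θ x :=
    ⟨(h.weight hd).exp_φ, fun j x => ((h.weight hd).fderiv_φ j x).trans (by
      show Real.exp (phase p e t x) * _ = _
      ring)⟩
  refine ((h1.mul h1).mul ((radialDeriv_pw h.e_pos.le ((1 + p) / 2)).mul
    (radialDeriv_pw hν (-1)))).congr (fun x => rfl) fun x => ?_
  have e1 : pw e ((1 + p) / 2 - 1) x = pw e ((1 + p) / 2) x * pw e (-1) x := by
    rw [pw_mul h.e_pos.le]; congr 1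
  have e2 : pw ν (-1 - 1) x = pw ν (-1) x * pw ν (-1) x := by
    rw [pw_mul hν]; congr 1
  rw [e1, e2]
  have e3 : (h.weight hd).θ x = p / 100 * e * pw e (-((1 + p) / 2)) x * pw t (-(1 / 2)) x := rfl
  rw [e3]
  unfold cutoffWeight cutoffLogDeriv
  ring

theorem norm_sq_mul_cutoffLogDeriv_sq_le (h : WeightParams p e t lam) {d : ℕ} (hd : 3 ≤ d) {ν κ : ℝ}
    (hν : 0 ≤ ν) (hν' : ν ≤ 1) (hκ : 256 * e ≤ κ ^ 2) (x : Space d) :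
    4 * (‖x‖ ^ 2 * cutoffLogDeriv p e t ν x ^ 2) ≤ (κ / 2) ^ 2 := by
  have he := h.one_le_e
  have h1 : ‖x‖ ^ 2 * (h.weight hd).θ x ^ 2 ≤ e := by
    rw [mul_comm]
    refine (h.θ_sq_mul_norm_sq_le hd x).trans ?_
    have h2 : pw e (-p) x ≤ 1 := pw_le_one h.e_pos.le (by linarith [h.p_pos]) x
    have h3 : (p / 100) ^ 2 ≤ 1 := by nlinarith [h.p_pos, h.p_le]
    have h4 := pw_pos h.e_pos.le (-p) x
    have h5 := h.e_pos
    calc (p / 100) ^ 2 * e * pw e (-p) x ≤ 1 * e * 1 := by gcongr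
      _ = e := by ring
  have h2 := mul_pw_neg_one_sq_le h.e_pos.le x
  have h3 := mul_pw_neg_one_sq_le hν x
  have e3 : (h.weight hd).θ x = p / 100 * e * pw e (-((1 + p) / 2)) x * pw t (-(1 / 2)) x := rfl
  rw [e3] at h1
  have hu : ((1 + p) / 2) ^ 2 ≤ 1 := by nlinarith [h.p_pos, h.p_le]
  unfold cutoffLogDeriv
  generalize p / 100 * e * pw e (-((1 + p) / 2)) x * pw t (-(1 / 2)) x = A at *
  generalize e * pw e (-1) x = B at *
  generalize ν * pw ν (-1) x = D at *
  generalize (1 + p) / 2 = u at *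
  have h4 : (A + (u * B - D)) ^ 2 ≤ 3 * (A ^ 2 + u ^ 2 * B ^ 2 + D ^ 2) := by
    nlinarith [sq_nonneg (A - u * B), sq_nonneg (A + D), sq_nonneg (u * B + D)]
  have h5 := mul_le_mul_of_nonneg_left h4 (sq_nonneg ‖x‖)
  have h6 : u ^ 2 * (‖x‖ ^ 2 * B ^ 2) ≤ 1 * e := mul_le_mul hu h2 (by positivity) (by norm_num)
  linarith

theorem cutoffWeight_pos (h : WeightParams p e t lam) {d : ℕ} {ν : ℝ} (hν : 0 ≤ ν) (x : Space d) :
    0 < cutoffWeight p e t ν x := by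
  have h1 := pw_pos h.e_pos.le ((1 + p) / 2) x
  have h2 := pw_pos hν (-1) x
  unfold cutoffWeight
  positivity

/-- The energy estimate for the screened equation, in the weight which occurs on the right hand side
of the Carleman estimate. The weight is unbounded and is approximated by `cutoffWeight`. -/
theorem screened (h : WeightParams p e t lam) {d : ℕ} (hd : 3 ≤ d) {κ : ℝ}
    (hκ : 256 * e ≤ κ ^ 2) (hκ0 : 0 ≤ κ) {F : Fin d → L2 d} {Y : sobolev d}
    (hY : ∀ W : sobolev d, ∑ j, ⟪grad j Y, grad j W⟫_ℂ + (κ : ℂ) ^ 2 * ⟪val d Y, val d W⟫_ℂ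
      = ∑ j, ⟪F j, grad j W⟫_ℂ)
    (hF : Integrable (fun x => Real.exp (phase p e t x) ^ 2 * pw e ((1 + p) / 2) x
      * ∑ j, ‖F j x‖ ^ 2) volume) :
    Integrable (fun x => Real.exp (phase p e t x) ^ 2 * pw e ((1 + p) / 2) x
        * (∑ j, ‖grad j Y x‖ ^ 2 + κ ^ 2 * ‖val d Y x‖ ^ 2)) volume ∧
      ∫ x, Real.exp (phase p e t x) ^ 2 * pw e ((1 + p) / 2) x
        * (∑ j, ‖grad j Y x‖ ^ 2 + κ ^ 2 * ‖val d Y x‖ ^ 2)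
      ≤ 4 * ∫ x, Real.exp (phase p e t x) ^ 2 * pw e ((1 + p) / 2) x * ∑ j, ‖F j x‖ ^ 2 := by
  obtain ⟨M, hM⟩ := exists_phase_le d h.p_pos h.one_le_e h.t_pos h.t_le
  have hν : ∀ n : ℕ, 0 < 1 / ((n : ℝ) + 1) := fun n => by positivity
  have hν1 : ∀ n : ℕ, 1 / ((n : ℝ) + 1) ≤ 1 := fun n => by
    rw [div_le_one (by positivity)]
    linarith [Nat.cast_nonneg (α := ℝ) n]
  have hR := fun n => h.radialDeriv_cutoffWeight hd (hν n).le
  have hpos := fun n x => h.cutoffWeight_pos (d := d) (hν n).le x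
  have hbd : ∀ n : ℕ, ∃ C, ∀ x : Space d, cutoffWeight p e t (1 / ((n : ℝ) + 1)) x ≤ C := fun n => by
    refine ⟨Real.exp M * Real.exp M * (e / (1 / ((n : ℝ) + 1))), fun x => ?_⟩
    have h1 : pw e ((1 + p) / 2) x ≤ pw e 1 x := pw_le_pw h.e_pos.le (by linarith [h.p_le]) x
    have h2 := pw_one_mul_pw_neg_one_le (hν n) ((hν1 n).trans h.one_le_e) x
    have h3 := pw_pos (hν n).le (-1) x
    have h4 := pw_pos h.e_pos.le ((1 + p) / 2) x
    have h5 := hM x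
    unfold cutoffWeight
    gcongr
    exact (mul_le_mul_of_nonneg_right h1 h3.le).trans h2
  choose C hC using hbd
  have hL : ∀ (n : ℕ) (x : Space d),
      4 * (‖x‖ ^ 2 * cutoffLogDeriv p e t (1 / ((n : ℝ) + 1)) x ^ 2) ≤ (κ / 2) ^ 2 := fun n x =>
    h.norm_sq_mul_cutoffLogDeriv_sq_le hd (hν n).le (hν1 n) hκ x
  have ha : ∀ n : ℕ, MemLp (cutoffWeight p e t (1 / ((n : ℝ) + 1))) ⊤
      (volume : Measure (Space d)) := fun n =>
    memLp_top_of_continuous (hR n).temperate.1.continuous (C n) fun x => by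
      rw [abs_of_pos (hpos n x)]; exact hC n x
  have hac : ∀ n : ℕ, Continuous (cutoffLogDeriv p e t (1 / ((n : ℝ) + 1)) (d := d)) := fun n => by
    unfold cutoffLogDeriv
    have := continuous_pw (d := d) h.e_pos.le (-((1 + p) / 2))
    have := continuous_pw (d := d) h.e_pos.le (-1)
    have := continuous_pw (d := d) h.t_pos.le (-(1 / 2))
    have := continuous_pw (d := d) (hν n).le (-1)
    fun_prop
  have ha' : ∀ (n : ℕ) (j : Fin d), MemLp (fun x : Space d => 2 * x j
      * (cutoffWeight p e t (1 / ((n : ℝ) + 1)) x * cutoffLogDeriv p e t (1 / ((n : ℝ) + 1)) x)) ⊤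
      (volume : Measure (Space d)) := fun n j => by
    have hc1 := (hR n).temperate.1.continuous
    have hc2 := hac n
    refine memLp_top_of_continuous (by fun_prop) (C n * (κ / 2)) fun x => ?_
    have h1 : |2 * x j * cutoffLogDeriv p e t (1 / ((n : ℝ) + 1)) x| ≤ κ / 2 := by
      refine abs_le_of_sq_le_sq ?_ (by positivity)
      refine le_trans ?_ (hL n x)
      have h2 : x j ^ 2 ≤ ‖x‖ ^ 2 := by
        rw [← sq_abs]
        gcongr
        exact abs_coord_le x j
      have h3 := mul_le_mul_of_nonneg_right h2 (sq_nonneg (cutoffLogDeriv p e t (1 / ((n : ℝ) + 1)) x))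
      linarith
    calc |2 * x j * (cutoffWeight p e t (1 / ((n : ℝ) + 1)) x
          * cutoffLogDeriv p e t (1 / ((n : ℝ) + 1)) x)|
        = cutoffWeight p e t (1 / ((n : ℝ) + 1)) x
          * |2 * x j * cutoffLogDeriv p e t (1 / ((n : ℝ) + 1)) x| := by
          rw [← abs_of_pos (hpos n x), ← abs_mul, abs_of_pos (hpos n x)]
          congr 1
          ring
      _ ≤ C n * (κ / 2) := by
          exact mul_le_mul (hC n x) h1 (abs_nonneg _) ((hpos n x).le.trans (hC n x))
  have hE := fun n => screened_energy (hR n).temperate (hR n).fderiv_eq (ha n) (ha' n) (hpos n)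
    (κ := κ) (fun x => by
      have h1 : ∑ j, (2 * x j * (cutoffWeight p e t (1 / ((n : ℝ) + 1)) x
            * cutoffLogDeriv p e t (1 / ((n : ℝ) + 1)) x)) ^ 2
          = cutoffWeight p e t (1 / ((n : ℝ) + 1)) x ^ 2
            * (4 * (‖x‖ ^ 2 * cutoffLogDeriv p e t (1 / ((n : ℝ) + 1)) x ^ 2)) := by
        rw [norm_sq_eq_sum, Finset.sum_mul, Finset.mul_sum, Finset.mul_sum]
        exact Finset.sum_congr rfl fun j _ => by ring
      rw [h1, mul_comm (κ / 2), mul_pow]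
      exact mul_le_mul_of_nonneg_left (hL n x) (sq_nonneg _)) hY
  have hsplit : ∀ (n : ℕ) (x : Space d) (r : ℝ), cutoffWeight p e t (1 / ((n : ℝ) + 1)) x * r
      = pw (1 / ((n : ℝ) + 1)) (-1) x
        * (Real.exp (phase p e t x) ^ 2 * pw e ((1 + p) / 2) x * r) := fun n x r => by
    unfold cutoffWeight
    ring
  have hpe : ∀ x : Space d, 0 < Real.exp (phase p e t x) ^ 2 * pw e ((1 + p) / 2) x := fun x =>
    mul_pos (by positivity) (pw_pos h.e_pos.le _ x)
  have hcont : Continuous fun x : Space d => Real.exp (phase p e t x) ^ 2 * pw e ((1 + p) / 2) x :=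
    ((h.weight hd).exp_φ.1.continuous.pow 2).mul (continuous_pw h.e_pos.le _)
  have hiG : Integrable (fun x => ∑ j, ‖grad j Y x‖ ^ 2 + κ ^ 2 * ‖val d Y x‖ ^ 2) volume := by
    have h1 : ∀ w : L2 d, Integrable (fun x => ‖w x‖ ^ 2) volume := fun w =>
      (Lp.memLp w).integrable_norm_pow (by norm_num)
    exact (integrable_finsetSum Finset.univ fun j _ => h1 (grad j Y)).fun_add
      ((h1 (val d Y)).const_mul _)
  refine integral_le_of_regularized (fun x => ?_) ?_ (fun n => ?_) fun n => ?_
  · exact mul_nonneg (hpe x).le (by positivity)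
  · exact hcont.aestronglyMeasurable.mul hiG.1
  · simp only [← hsplit]
    refine (hiG.bdd_mul (c := C n) (hR n).temperate.1.continuous.aestronglyMeasurable
      (Filter.Eventually.of_forall fun x => ?_))
    rw [Real.norm_of_nonneg (hpos n x).le]
    exact hC n x
  · simp only [← hsplit]
    refine (hE n).trans (mul_le_mul_of_nonneg_left ?_ (by norm_num))
    refine integral_mono_of_nonneg (Filter.Eventually.of_forall fun x => ?_) hF
      (Filter.Eventually.of_forall fun x => ?_)
    · exact mul_nonneg (hpos n x).le (by positivity)
    · dsimp only
      rw [hsplit]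
      exact mul_le_of_le_one_left (mul_nonneg (hpe x).le (by positivity))
        (pw_le_one (hν n).le (by norm_num) x)

end WeightParams

/-! ### The Carleman estimate on `H¹` -/

theorem integrable_norm_sq {d : ℕ} (w : L2 d) : Integrable (fun x => ‖w x‖ ^ 2) volume :=
  (Lp.memLp w).integrable_norm_pow (by norm_num)

theorem integral_norm_sq {d : ℕ} (w : L2 d) : ∫ x, ‖w x‖ ^ 2 = ‖w‖ ^ 2 := by
  have h := congrArg Complex.re (inner_self_re_im w)
  rw [Complex.ofReal_re] at h
  rw [← h, L2.inner_def]
  refine (integral_congr_ae (Filter.Eventually.of_forall fun x => ?_)).trans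
    (integral_re (𝕜 := ℂ) (L2.integrable_inner (𝕜 := ℂ) w w))
  simp only [inner_self_re_im]
  rfl

/-- The squared norm of the gradient. -/
noncomputable def gradNormSq {d : ℕ} (U : sobolev d) (x : Space d) : ℝ := ∑ j, ‖grad j U x‖ ^ 2

theorem gradNormSq_nonneg {d : ℕ} (U : sobolev d) (x : Space d) : 0 ≤ gradNormSq U x :=
  Finset.sum_nonneg fun _ _ => sq_nonneg _

theorem integrable_gradNormSq {d : ℕ} (U : sobolev d) : Integrable (gradNormSq U) volume :=
  integrable_finsetSum Finset.univ fun j _ => integrable_norm_sq (grad j U)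

theorem integral_gradNormSq {d : ℕ} (U : sobolev d) :
    ∫ x, gradNormSq U x = ∑ j, ‖grad j U‖ ^ 2 := by
  unfold gradNormSq
  rw [integral_finsetSum _ fun j _ => integrable_norm_sq (grad j U)]
  exact Finset.sum_congr rfl fun j _ => integral_norm_sq _

theorem integral_gradNormSq_add {d : ℕ} (U : sobolev d) :
    ∫ x, (gradNormSq U x + ‖val d U x‖ ^ 2) = ‖U‖ ^ 2 := by
  rw [integral_add (integrable_gradNormSq U) (integrable_norm_sq _), integral_gradNormSq,
    integral_norm_sq, sobolev_norm_sq, add_comm]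

theorem half_norm_sq_sub_le (z w : ℂ) : 1 / 2 * ‖z‖ ^ 2 - ‖w‖ ^ 2 ≤ ‖z + w‖ ^ 2 := by
  have h : ‖z‖ ≤ ‖z + w‖ + ‖w‖ := by
    calc ‖z‖ = ‖(z + w) - w‖ := by rw [add_sub_cancel_right]
      _ ≤ _ := norm_sub_le _ _
  nlinarith [sq_nonneg (‖z + w‖ - ‖w‖), norm_nonneg z, norm_nonneg (z + w), norm_nonneg w]

/-- The integrand of the Carleman inequality is integrable. -/
theorem CarlemanWeight.integrable_carleman {d : ℕ} {lam : ℝ} {W : CarlemanWeight d lam}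
    (hW : W.Bounded) (U : sobolev d) (h : L2 d) :
    Integrable (fun x => Real.exp (W.φ x) ^ 2 * (((starRingEnd ℂ) (multiplierOp hW U x)
        * (h x - (lam : ℂ) ^ 2 * val d U x)).re
      - (W.m x / 4 * (∑ j, ‖twistedGradOp hW j U x‖ ^ 2)
        + 2 * (W.θ x / W.g x) * ‖multiplierOp hW U x‖ ^ 2 + W.q x * ‖val d U x‖ ^ 2))) volume := by
  have i1 := integrable_mul_re_conj_mul hW.exp (multiplierOp hW U) (h - (lam : ℂ) ^ 2 • val d U)
  have i2 := integrable_finsetSum (μ := volume) Finset.univ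
    fun j _ => integrable_mul_norm_sq hW.exp_m (twistedGradOp hW j U)
  have i3 := integrable_mul_norm_sq hW.exp_θ (multiplierOp hW U)
  have i4 := integrable_mul_norm_sq hW.exp_q (val d U)
  refine (i1.sub ((i2.add i3).add i4)).congr ?_
  filter_upwards [Lp.coeFn_sub h ((lam : ℂ) ^ 2 • val d U),
    Lp.coeFn_smul ((lam : ℂ) ^ 2) (val d U)] with x h1 h2
  simp only [Pi.sub_apply, Pi.add_apply]
  rw [h1, Pi.sub_apply, h2, Pi.smul_apply, smul_eq_mul, ← Finset.mul_sum]
  ring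

namespace WeightParams

variable {p e t lam : ℝ}

/-- The quadratic form in the Carleman inequality controls the energy. The gradient of `exp φ y` differs
from `exp φ ∇y` by `θ x exp φ y`, and `θ² |x|²` is dominated by the zeroth order term. -/
theorem lower_bound (h : WeightParams p e t lam) {d : ℕ} (hd : 3 ≤ d) (U : sobolev d) :
    ∀ᵐ x, (p / 100) ^ 2 / 15 * (pw t (-((1 + p) / 2)) x * (gradNormSq U x
        + (lam ^ 2 + e * pw e (-p) x) * ‖val d U x‖ ^ 2))
      ≤ (h.weight hd).m x / 4 * (∑ j, ‖CarlemanWeight.twistedGradOp (h.bounded hd) j U x‖ ^ 2)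
        + (h.weight hd).q x * ‖val d U x‖ ^ 2 := by
  have h1 : ∀ᵐ x, ∀ j, CarlemanWeight.twistedGradOp (h.bounded hd) j U x
      = grad j U x + (((h.weight hd).θ x * x j : ℝ) : ℂ) * val d U x :=
    ae_all_iff.2 fun j => CarlemanWeight.twistedGradOp_coeFn (h.bounded hd) j U
  filter_upwards [h1] with x hx
  have hp := h.p_pos
  have hp' := h.p_le
  have he := h.e_pos
  have hQ := pw_pos h.t_pos.le (-((1 + p) / 2)) x
  have hH := pw_pos h.e_pos.le (-p) x
  have h2 : 1 / 2 * gradNormSq U x - (h.weight hd).θ x ^ 2 * ‖x‖ ^ 2 * ‖val d U x‖ ^ 2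
      ≤ ∑ j, ‖CarlemanWeight.twistedGradOp (h.bounded hd) j U x‖ ^ 2 := by
    rw [norm_sq_eq_sum x, gradNormSq, Finset.mul_sum, Finset.mul_sum, Finset.sum_mul,
      ← Finset.sum_sub_distrib]
    refine Finset.sum_le_sum fun j _ => ?_
    rw [hx j]
    refine le_trans (le_of_eq ?_) (half_norm_sq_sub_le _ _)
    rw [norm_mul, Complex.norm_real, mul_pow, Real.norm_eq_abs, sq_abs]
    ring
  have h3 := h.θ_sq_mul_norm_sq_le hd x
  have hm : (h.weight hd).m x = p * pw t (-((1 + p) / 2)) x := rfl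
  have hq : (h.weight hd).q x = (p / 100) ^ 2 / 10
    * (pw t (-((1 + p) / 2)) x * (lam ^ 2 + e * pw e (-p) x)) := rfl
  rw [hm, hq]
  have hn := sq_nonneg ‖val d U x‖
  have hg := gradNormSq_nonneg U x
  generalize pw t (-((1 + p) / 2)) x = Q at *
  generalize pw e (-p) x = H at *
  generalize ‖val d U x‖ ^ 2 = n at *
  generalize gradNormSq U x = D at *
  have h4 := mul_le_mul_of_nonneg_left h2 (show 0 ≤ p * Q / 4 by positivity)
  have h5 := mul_le_mul_of_nonneg_left h3 (show 0 ≤ p * Q / 4 * n by positivity)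
  have h6 : 0 ≤ (1 / 8 - p) * ((p / 100) ^ 2 * Q * (e * H) * n) :=
    mul_nonneg (by linarith) (by positivity)
  have h7 : 0 ≤ (p / 100) ^ 2 * Q * (e * H) * n := by positivity
  have h8 : 0 ≤ (p / 100) ^ 2 * Q * lam ^ 2 * n := by positivity
  have h9 : (p / 100) ^ 2 / 15 * (Q * D) ≤ p / 8 * (Q * D) :=
    mul_le_mul_of_nonneg_right (by nlinarith) (by positivity)
  linarith

theorem norm_multiplierOp_sq_le (h : WeightParams p e t lam) {d : ℕ} (hd : 3 ≤ d) (U : sobolev d) :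
    ∀ᵐ x, ‖CarlemanWeight.multiplierOp (h.bounded hd) U x‖ ^ 2
      ≤ (2 * d * (2 / t) ^ 2 + 2 * (2 / t * e + d) ^ 2) * (gradNormSq U x + ‖val d U x‖ ^ 2) := by
  filter_upwards [CarlemanWeight.multiplierOp_coeFn (h.bounded hd) U] with x hx
  rw [hx]
  have ht := h.t_pos
  have he := h.e_pos
  set a := ∑ j, (((h.weight hd).g x * x j : ℝ) : ℂ) * grad j U x
  set c := (h.weight hd).g x * ((h.weight hd).θ x * ‖x‖ ^ 2 + ((d : ℝ) - 1) / 2)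
  have h1 : ‖a‖ ^ 2 ≤ d * (2 / t) ^ 2 * gradNormSq U x := by
    have h2 : ‖a‖ ≤ ∑ j, 2 / t * ‖grad j U x‖ := by
      refine (norm_sum_le _ _).trans (Finset.sum_le_sum fun j _ => ?_)
      rw [norm_mul, Complex.norm_real, Real.norm_eq_abs, abs_mul,
        abs_of_pos ((h.weight hd).g_pos x)]
      refine mul_le_mul_of_nonneg_right ?_ (norm_nonneg _)
      exact (mul_le_mul_of_nonneg_left (abs_coord_le x j) ((h.weight hd).g_pos x).le).trans
        (h.g_mul_norm_le hd x)
    calc ‖a‖ ^ 2 ≤ (∑ j, 2 / t * ‖grad j U x‖) ^ 2 := by gcongr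
      _ = (2 / t) ^ 2 * (∑ j, ‖grad j U x‖) ^ 2 := by rw [← Finset.mul_sum, mul_pow]
      _ ≤ (2 / t) ^ 2 * (d * ∑ j, ‖grad j U x‖ ^ 2) := by
        gcongr
        have := sq_sum_le_card_mul_sum_sq (s := Finset.univ) (f := fun j => ‖grad j U x‖)
        simpa using this
      _ = _ := by rw [gradNormSq]; ring
  have h2 : ‖((c : ℝ) : ℂ) * val d U x‖ ^ 2 ≤ (2 / t * e + d) ^ 2 * ‖val d U x‖ ^ 2 := by
    rw [norm_mul, mul_pow, Complex.norm_real, Real.norm_eq_abs]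
    gcongr
    exact h.abs_g_mul_le hd x
  have h3 : ‖a + (c : ℂ) * val d U x‖ ^ 2 ≤ 2 * ‖a‖ ^ 2 + 2 * ‖(c : ℂ) * val d U x‖ ^ 2 := by
    have := norm_add_le a ((c : ℂ) * val d U x)
    calc _ ≤ (‖a‖ + ‖(c : ℂ) * val d U x‖) ^ 2 := by gcongr
      _ ≤ _ := by nlinarith [sq_nonneg (‖a‖ - ‖(c : ℂ) * val d U x‖)]
  have h4 : 0 ≤ 2 * d * (2 / t) ^ 2 * ‖val d U x‖ ^ 2 := by positivity
  have h5 : 0 ≤ 2 * (2 / t * e + d) ^ 2 * gradNormSq U x :=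
    mul_nonneg (by positivity) (gradNormSq_nonneg U x)
  linarith

/-- The Carleman estimate for `-Δy - z y = f`, with `z` close to `lam ^ 2`. -/
theorem carleman_estimate (h : WeightParams p e t lam) {d : ℕ} (hd : 3 ≤ d) (hlam : 0 < lam) {M : ℝ}
    (hM : ∀ x : Space d, phase p e t x ≤ M) {z : ℂ} {ε : ℝ} (hε : 0 ≤ ε)
    (hz : ‖z - (lam : ℂ) ^ 2‖ ≤ ε) (Y : sobolev d) (f : L2 d)
    (hY : ∀ W : sobolev d, ∑ j, ⟪grad j Y, grad j W⟫_ℂ = ⟪z • val d Y + f, val d W⟫_ℂ)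
    (hf : Integrable (fun x => Real.exp (phase p e t x) ^ 2 * pw e ((1 + p) / 2) x * ‖f x‖ ^ 2)
      volume) :
    (p / 100) ^ 2 / 15 * ∫ x, Real.exp (phase p e t x) ^ 2 * (pw t (-((1 + p) / 2)) x
        * (gradNormSq Y x + (lam ^ 2 + e * pw e (-p) x) * ‖val d Y x‖ ^ 2))
      ≤ Real.exp M ^ 2 * (2 * d * (2 / t) ^ 2 + 2 * (2 / t * e + d) ^ 2 + 1)
          * ε * (‖Y‖ ^ 2 / lam + lam * ‖val d Y‖ ^ 2)
        + 50 / (p * e) * ∫ x, Real.exp (phase p e t x) ^ 2 * pw e ((1 + p) / 2) x * ‖f x‖ ^ 2 := by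
  have hp := h.p_pos
  have he := h.e_pos
  have ht := h.t_pos
  set K := 2 * d * (2 / t) ^ 2 + 2 * (2 / t * e + d) ^ 2 with hK
  have hK0 : 0 ≤ K := by positivity
  have h1 := CarlemanWeight.carleman (h.bounded hd) Y _ hY
  have hφ : (h.weight hd).φ = phase p e t := rfl
  rw [hφ] at h1
  have iN := integrable_norm_sq (val d Y)
  have iG := integrable_gradNormSq Y
  have hcont : Continuous fun x : Space d => Real.exp (phase p e t x) ^ 2 :=
    (h.weight hd).exp_φ.1.continuous.pow 2
  have cT := continuous_pw (d := d) h.t_pos.le (-((1 + p) / 2))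
  have cE := continuous_pw (d := d) h.e_pos.le (-p)
  have hQ1 : ∀ x : Space d, pw t (-((1 + p) / 2)) x ≤ 1 := pw_le_one ht.le (by linarith)
  have hH1 : ∀ x : Space d, pw e (-p) x ≤ 1 := pw_le_one he.le (by linarith)
  have hb : ∀ x : Space d, Real.exp (phase p e t x) ^ 2 ≤ Real.exp M ^ 2 := fun x => by
    gcongr
    exact hM x
  have i1 : Integrable (fun x => Real.exp (phase p e t x) ^ 2 * (pw t (-((1 + p) / 2)) x
        * (gradNormSq Y x + (lam ^ 2 + e * pw e (-p) x) * ‖val d Y x‖ ^ 2))) volume := by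
    refine Integrable.mono' ((iG.add (iN.const_mul (lam ^ 2 + e))).const_mul (Real.exp M ^ 2)) ?_
      (Filter.Eventually.of_forall fun x => ?_)
    · exact hcont.aestronglyMeasurable.mul (cT.aestronglyMeasurable.mul (iG.1.add
        ((by fun_prop : Continuous fun x : Space d =>
          lam ^ 2 + e * pw e (-p) x).aestronglyMeasurable.mul iN.1)))
    · have a1 := gradNormSq_nonneg Y x
      have a2 := pw_pos ht.le (-((1 + p) / 2)) x
      have a3 := pw_pos he.le (-p) x
      rw [Real.norm_of_nonneg (by positivity)]
      have a4 := hQ1 x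
      have a5 := hH1 x
      calc _ ≤ Real.exp M ^ 2 * (1 * (gradNormSq Y x + (lam ^ 2 + e * 1) * ‖val d Y x‖ ^ 2)) := by
            gcongr
            exact hM x
        _ = _ := by simp only [Pi.add_apply]; ring
  have i2 : Integrable (fun x => Real.exp M ^ 2 * ((K + 1) * ε
      * ((gradNormSq Y x + ‖val d Y x‖ ^ 2) / lam + lam * ‖val d Y x‖ ^ 2))) volume :=
    ((((iG.fun_add iN).div_const lam).fun_add (iN.const_mul lam)).const_mul _).const_mul _
  have i3 := hf.const_mul (50 / (p * e))
  have key : ∀ᵐ x, Real.exp (phase p e t x) ^ 2 * (((starRingEnd ℂ)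
        (CarlemanWeight.multiplierOp (h.bounded hd) Y x) * ((z • val d Y + f : L2 d) x
          - (lam : ℂ) ^ 2 * val d Y x)).re
      - ((h.weight hd).m x / 4 * (∑ j, ‖CarlemanWeight.twistedGradOp (h.bounded hd) j Y x‖ ^ 2)
        + 2 * ((h.weight hd).θ x / (h.weight hd).g x) * ‖CarlemanWeight.multiplierOp (h.bounded hd) Y x‖ ^ 2
        + (h.weight hd).q x * ‖val d Y x‖ ^ 2))
      ≤ Real.exp M ^ 2 * ((K + 1) * ε
          * ((gradNormSq Y x + ‖val d Y x‖ ^ 2) / lam + lam * ‖val d Y x‖ ^ 2))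
        + 50 / (p * e) * (Real.exp (phase p e t x) ^ 2 * pw e ((1 + p) / 2) x * ‖f x‖ ^ 2)
        - (p / 100) ^ 2 / 15 * (Real.exp (phase p e t x) ^ 2 * (pw t (-((1 + p) / 2)) x
          * (gradNormSq Y x + (lam ^ 2 + e * pw e (-p) x) * ‖val d Y x‖ ^ 2))) := by
    filter_upwards [h.lower_bound hd Y, h.norm_multiplierOp_sq_le hd Y,
      Lp.coeFn_add (z • val d Y) f, Lp.coeFn_smul z (val d Y)] with x x1 x2 x3 x4
    rw [x3, Pi.add_apply, x4, Pi.smul_apply, smul_eq_mul]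
    have b0 : z * val d Y x + f x - (lam : ℂ) ^ 2 * val d Y x
        = (z - (lam : ℂ) ^ 2) * val d Y x + f x := by ring
    rw [b0]
    set N := CarlemanWeight.multiplierOp (h.bounded hd) Y x
    set y := val d Y x
    have hr := div_pos (h.θ_pos hd x) ((h.weight hd).g_pos x)
    have hr' := h.g_div_θ_le hd x
    have hrr : (h.weight hd).θ x / (h.weight hd).g x * ((h.weight hd).g x / (h.weight hd).θ x) = 1 := by
      have := (h.θ_pos hd x).ne'
      have := ((h.weight hd).g_pos x).ne'
      field_simp
    set r := (h.weight hd).θ x / (h.weight hd).g x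
    set r' := (h.weight hd).g x / (h.weight hd).θ x
    have b1 : ((starRingEnd ℂ) N * ((z - (lam : ℂ) ^ 2) * y + f x)).re
        ≤ ε * (‖N‖ ^ 2 / lam + lam * ‖y‖ ^ 2) + r * ‖N‖ ^ 2
          + 50 / (p * e) * pw e ((1 + p) / 2) x * ‖f x‖ ^ 2 := by
      have c1 := (le_abs_self _).trans (abs_re_conj_mul_le N ((z - (lam : ℂ) ^ 2) * y + f x))
      have c2 : ‖(z - (lam : ℂ) ^ 2) * y + f x‖ ≤ ε * ‖y‖ + ‖f x‖ := by
        refine (norm_add_le _ _).trans ?_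
        rw [norm_mul]
        gcongr
      have c3 := mul_le_mul_of_nonneg_left c2 (norm_nonneg N)
      have c4 : ‖N‖ * ‖y‖ ≤ ‖N‖ ^ 2 / lam + lam * ‖y‖ ^ 2 := by
        have : ‖N‖ ^ 2 / lam + lam * ‖y‖ ^ 2 - ‖N‖ * ‖y‖
          = lam * ((‖N‖ / lam - 1 / 2 * ‖y‖) ^ 2 + 3 / 4 * ‖y‖ ^ 2) := by field_simp; ring
        have : 0 ≤ lam * ((‖N‖ / lam - 1 / 2 * ‖y‖) ^ 2 + 3 / 4 * ‖y‖ ^ 2) := by positivity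
        linarith
      -- half of the term `2 (θ / g) |N|²` of the Carleman inequality is used for the right hand side
      have c5 : ‖N‖ * ‖f x‖ ≤ r * ‖N‖ ^ 2 + r' / 4 * ‖f x‖ ^ 2 := by
        have e1 : r * (‖N‖ - r' / 2 * ‖f x‖) ^ 2
            = r * ‖N‖ ^ 2 - ‖N‖ * ‖f x‖ + r' / 4 * ‖f x‖ ^ 2 := by
          linear_combination (-‖N‖ * ‖f x‖ + r' / 4 * ‖f x‖ ^ 2) * hrr
        have e2 : 0 ≤ r * (‖N‖ - r' / 2 * ‖f x‖) ^ 2 := by positivity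
        linarith
      have c6 := mul_le_mul_of_nonneg_left c4 hε
      have c7 := mul_le_mul_of_nonneg_right hr' (show 0 ≤ ‖f x‖ ^ 2 / 4 by positivity)
      have c8 : 200 / (p * e) = 4 * (50 / (p * e)) := by ring
      rw [c8] at c7
      linarith
    have b2 : ε * (‖N‖ ^ 2 / lam + lam * ‖y‖ ^ 2) ≤ (K + 1) * ε
        * ((gradNormSq Y x + ‖y‖ ^ 2) / lam + lam * ‖y‖ ^ 2) := by
      have c1 : ‖N‖ ^ 2 / lam ≤ K * (gradNormSq Y x + ‖y‖ ^ 2) / lam := by gcongr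
      have c2 := gradNormSq_nonneg Y x
      have c3 : 0 ≤ (gradNormSq Y x + ‖y‖ ^ 2) / lam := by positivity
      have c4 : 0 ≤ K * (lam * ‖y‖ ^ 2) := by positivity
      have c5 : ‖N‖ ^ 2 / lam + lam * ‖y‖ ^ 2
          ≤ (K + 1) * ((gradNormSq Y x + ‖y‖ ^ 2) / lam + lam * ‖y‖ ^ 2) := by
        rw [mul_div_assoc] at c1
        linarith
      have := mul_le_mul_of_nonneg_left c5 hε
      linarith
    have b3 : 0 ≤ r * ‖N‖ ^ 2 := by positivity
    have b4 : 0 ≤ (K + 1) * ε * ((gradNormSq Y x + ‖y‖ ^ 2) / lam + lam * ‖y‖ ^ 2) := by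
      have := gradNormSq_nonneg Y x
      positivity
    have b5 := mul_le_mul_of_nonneg_right (hb x) b4
    have b6 := mul_le_mul_of_nonneg_left (show
      ((starRingEnd ℂ) N * ((z - (lam : ℂ) ^ 2) * y + f x)).re
      - ((h.weight hd).m x / 4 * (∑ j, ‖CarlemanWeight.twistedGradOp (h.bounded hd) j Y x‖ ^ 2)
        + 2 * r * ‖N‖ ^ 2 + (h.weight hd).q x * ‖y‖ ^ 2)
      ≤ (K + 1) * ε * ((gradNormSq Y x + ‖y‖ ^ 2) / lam + lam * ‖y‖ ^ 2)
        + 50 / (p * e) * pw e ((1 + p) / 2) x * ‖f x‖ ^ 2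
        - (p / 100) ^ 2 / 15 * (pw t (-((1 + p) / 2)) x
          * (gradNormSq Y x + (lam ^ 2 + e * pw e (-p) x) * ‖y‖ ^ 2)) by linarith)
      (sq_nonneg (Real.exp (phase p e t x)))
    linarith
  have h2 : 0 ≤ ∫ x, (Real.exp M ^ 2 * ((K + 1) * ε
          * ((gradNormSq Y x + ‖val d Y x‖ ^ 2) / lam + lam * ‖val d Y x‖ ^ 2))
        + 50 / (p * e) * (Real.exp (phase p e t x) ^ 2 * pw e ((1 + p) / 2) x * ‖f x‖ ^ 2)
        - (p / 100) ^ 2 / 15 * (Real.exp (phase p e t x) ^ 2 * (pw t (-((1 + p) / 2)) x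
          * (gradNormSq Y x + (lam ^ 2 + e * pw e (-p) x) * ‖val d Y x‖ ^ 2)))) := by
    exact h1.trans (integral_mono_ae (CarlemanWeight.integrable_carleman (h.bounded hd) Y _)
      ((i2.fun_add i3).sub (i1.const_mul _)) key)
  have h3 := integral_sub (i2.fun_add i3) (i1.const_mul ((p / 100) ^ 2 / 15))
  have h4 := integral_add i2 i3
  have h5 : ∫ x, Real.exp M ^ 2 * ((K + 1) * ε
      * ((gradNormSq Y x + ‖val d Y x‖ ^ 2) / lam + lam * ‖val d Y x‖ ^ 2))
      = Real.exp M ^ 2 * (K + 1) * ε * (‖Y‖ ^ 2 / lam + lam * ‖val d Y‖ ^ 2) := by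
    rw [integral_const_mul, integral_const_mul, integral_add ((iG.fun_add iN).div_const lam)
      (iN.const_mul lam), integral_div, integral_const_mul, integral_gradNormSq_add,
      integral_norm_sq]
    ring
  rw [h3, h4, h5, integral_const_mul, integral_const_mul] at h2
  linarith

end WeightParams

/-! ### The first order perturbation as a source -/

section Perturbation

variable {d : ℕ} {b : Space d → Space d} {V : Space d → ℝ}

/-- The right hand side of the equation `-Δu - z u = F₀ - div F` for a solution of
`(P - z) u = f₀ - div f`: the term without derivative. -/
noncomputable def sourceTerm (hb : ∀ j, MemLp (fun x => b x j) ⊤ (volume : Measure (Space d)))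
    (hV : MemLp V ⊤ (volume : Measure (Space d))) (U : sobolev d) (f₀ : L2 d) : L2 d :=
  f₀ - ∑ j, mulOp (hb j) (magGrad hb j U) - mulOp hV (val d U)

/-- The right hand side of the equation `-Δu - z u = F₀ - div F` for a solution of
`(P - z) u = f₀ - div f`: the components of the divergence term. -/
noncomputable def sourceFlux (hb : ∀ j, MemLp (fun x => b x j) ⊤ (volume : Measure (Space d)))
    (U : sobolev d) (f : Fin d → L2 d) (j : Fin d) : L2 d :=
  f j + Complex.I • mulOp (hb j) (val d U)

theorem norm_sourceTerm_sq_le (hb : ∀ j, MemLp (fun x => b x j) ⊤ (volume : Measure (Space d)))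
    (hV : MemLp V ⊤ (volume : Measure (Space d))) (U : sobolev d) (f₀ : L2 d) {C₀ : ℝ}
    {w : Space d → ℝ} (hw : ∀ x, w x ≤ C₀) (hdecay : ∀ᵐ x, |V x| + ‖b x‖ ≤ w x) :
    ∀ᵐ x, ‖sourceTerm hb hV U f₀ x‖ ^ 2
      ≤ 3 * ‖f₀ x‖ ^ 2 + 3 * w x ^ 2 * (gradNormSq U x + (C₀ + 1) ^ 2 * ‖val d U x‖ ^ 2) := by
  have h1 : ∀ᵐ x, ∀ j, mulOp (hb j) (magGrad hb j U) x = (b x j : ℂ) * magGrad hb j U x :=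
    ae_all_iff.2 fun j => mulOp_coeFn (hb j) _
  have h2 : ∀ᵐ x, ∀ j, magGrad hb j U x = Complex.I * grad j U x + (b x j : ℂ) * val d U x := by
    refine ae_all_iff.2 fun j => ?_
    rw [magGrad_apply]
    filter_upwards [Lp.coeFn_add (Complex.I • grad j U) (mulOp (hb j) (val d U)),
      Lp.coeFn_smul Complex.I (grad j U), mulOp_coeFn (hb j) (val d U)] with x h1 h2 h3
    rw [h1, Pi.add_apply, h2, h3, Pi.smul_apply, smul_eq_mul]
  filter_upwards [h1, h2, hdecay, mulOp_coeFn hV (val d U),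
    Lp.coeFn_sub (f₀ - ∑ j, mulOp (hb j) (magGrad hb j U)) (mulOp hV (val d U)),
    Lp.coeFn_sub f₀ (∑ j, mulOp (hb j) (magGrad hb j U)),
    coeFn_sum Finset.univ fun j => mulOp (hb j) (magGrad hb j U)] with x x1 x2 x3 x4 x5 x6 x7
  rw [sourceTerm, x5, Pi.sub_apply, x6, Pi.sub_apply, x7, x4, Finset.sum_congr rfl fun j _ => x1 j,
    Finset.sum_congr rfl fun j _ => by rw [x2 j]]
  set u := val d U x
  have a1 : ‖∑ j, (b x j : ℂ) * (Complex.I * grad j U x + (b x j : ℂ) * u)‖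
      ≤ ∑ j, |b x j| * ‖grad j U x‖ + ‖b x‖ ^ 2 * ‖u‖ := by
    rw [norm_sq_eq_sum (b x), Finset.sum_mul, ← Finset.sum_add_distrib]
    refine (norm_sum_le _ _).trans (Finset.sum_le_sum fun j _ => ?_)
    rw [norm_mul, Complex.norm_real, Real.norm_eq_abs, ← abs_mul_abs_self (b x j), mul_assoc,
      ← mul_add]
    refine mul_le_mul_of_nonneg_left ((norm_add_le _ _).trans (le_of_eq ?_)) (abs_nonneg _)
    rw [norm_mul, norm_mul, Complex.norm_I, one_mul, Complex.norm_real, Real.norm_eq_abs]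
  have a2 : (∑ j, |b x j| * ‖grad j U x‖) ^ 2 ≤ ‖b x‖ ^ 2 * gradNormSq U x := by
    have := Finset.sum_mul_sq_le_sq_mul_sq Finset.univ (fun j => |b x j|) fun j => ‖grad j U x‖
    rw [norm_sq_eq_sum (b x), gradNormSq]
    simpa only [sq_abs, sq (b x _)] using this
  have hb0 : ‖b x‖ ≤ w x := by linarith [abs_nonneg (V x)]
  have hw0 : 0 ≤ w x := (norm_nonneg _).trans hb0
  have a3 : ‖b x‖ ^ 2 + |V x| ≤ (C₀ + 1) * w x := by
    have e1 : ‖b x‖ * ‖b x‖ ≤ C₀ * w x :=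
      mul_le_mul (hb0.trans (hw x)) hb0 (norm_nonneg _) (hw0.trans (hw x))
    linarith [norm_nonneg (b x)]
  set A := ∑ j, |b x j| * ‖grad j U x‖
  have a4 : ‖f₀ x - ∑ j, (b x j : ℂ) * (Complex.I * grad j U x + (b x j : ℂ) * u) - (V x : ℂ) * u‖
      ≤ ‖f₀ x‖ + A + (C₀ + 1) * w x * ‖u‖ := by
    have e1 := norm_sub_le (f₀ x - ∑ j, (b x j : ℂ) * (Complex.I * grad j U x + (b x j : ℂ) * u))
      ((V x : ℂ) * u)
    have e2 := norm_sub_le (f₀ x) (∑ j, (b x j : ℂ) * (Complex.I * grad j U x + (b x j : ℂ) * u))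
    rw [norm_mul, Complex.norm_real, Real.norm_eq_abs] at e1
    have e3 := mul_le_mul_of_nonneg_right a3 (norm_nonneg u)
    linarith
  have hA : 0 ≤ A := Finset.sum_nonneg fun j _ => by positivity
  have hC : 0 ≤ C₀ := hw0.trans (hw x)
  have a5 : A ^ 2 ≤ w x ^ 2 * gradNormSq U x := a2.trans (by
    have := gradNormSq_nonneg U x
    gcongr)
  calc _ ≤ (‖f₀ x‖ + A + (C₀ + 1) * w x * ‖u‖) ^ 2 := by gcongr
    _ ≤ 3 * ‖f₀ x‖ ^ 2 + 3 * A ^ 2 + 3 * ((C₀ + 1) * w x * ‖u‖) ^ 2 := by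
      nlinarith [sq_nonneg (‖f₀ x‖ - A), sq_nonneg (‖f₀ x‖ - (C₀ + 1) * w x * ‖u‖),
        sq_nonneg (A - (C₀ + 1) * w x * ‖u‖)]
    _ ≤ _ := by linarith

theorem sum_norm_sourceFlux_sq_le
    (hb : ∀ j, MemLp (fun x => b x j) ⊤ (volume : Measure (Space d))) (U : sobolev d)
    (f : Fin d → L2 d) {w : Space d → ℝ} (hdecay : ∀ᵐ x, |V x| + ‖b x‖ ≤ w x) :
    ∀ᵐ x, ∑ j, ‖sourceFlux hb U f j x‖ ^ 2
      ≤ 2 * ∑ j, ‖f j x‖ ^ 2 + 2 * w x ^ 2 * ‖val d U x‖ ^ 2 := by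
  have h1 : ∀ᵐ x, ∀ j, sourceFlux hb U f j x
      = f j x + Complex.I * ((b x j : ℂ) * val d U x) := by
    refine ae_all_iff.2 fun j => ?_
    filter_upwards [Lp.coeFn_add (f j) (Complex.I • mulOp (hb j) (val d U)),
      Lp.coeFn_smul Complex.I (mulOp (hb j) (val d U)), mulOp_coeFn (hb j) (val d U)]
      with x h1 h2 h3
    rw [sourceFlux, h1, Pi.add_apply, h2, Pi.smul_apply, h3, smul_eq_mul]
  filter_upwards [h1, hdecay] with x x1 x2
  have hb0 : ‖b x‖ ≤ w x := by linarith [abs_nonneg (V x)]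
  have a1 : ‖b x‖ ^ 2 * ‖val d U x‖ ^ 2 ≤ w x ^ 2 * ‖val d U x‖ ^ 2 := by gcongr
  have a2 : ∑ j, ‖sourceFlux hb U f j x‖ ^ 2
      ≤ ∑ j, (2 * ‖f j x‖ ^ 2 + 2 * (b x j * b x j * ‖val d U x‖ ^ 2)) := by
    refine Finset.sum_le_sum fun j _ => ?_
    rw [x1 j]
    have e1 := norm_add_le (f j x) (Complex.I * ((b x j : ℂ) * val d U x))
    rw [norm_mul, Complex.norm_I, one_mul, norm_mul, Complex.norm_real, Real.norm_eq_abs] at e1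
    calc _ ≤ (‖f j x‖ + |b x j| * ‖val d U x‖) ^ 2 := by gcongr
      _ ≤ 2 * ‖f j x‖ ^ 2 + 2 * (|b x j| * |b x j| * ‖val d U x‖ ^ 2) := by
        nlinarith [sq_nonneg (‖f j x‖ - |b x j| * ‖val d U x‖)]
      _ = _ := by rw [abs_mul_abs_self]
  rw [Finset.sum_add_distrib, ← Finset.mul_sum, ← Finset.mul_sum, ← Finset.sum_mul,
    ← norm_sq_eq_sum] at a2
  linarith

end Perturbation

theorem pw_le_rpow_mul_pw {d : ℕ} {e r : ℝ} (he : 1 ≤ e) (hr : 0 ≤ r) (x : Space d) :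
    pw e r x ≤ e ^ r * pw 1 r x := by
  unfold pw
  rw [← Real.mul_rpow (by linarith) (by positivity)]
  refine Real.rpow_le_rpow (by positivity) ?_ hr
  nlinarith [sq_nonneg ‖x‖]

theorem rpow_mul_pw_le_pw {d : ℕ} {e r : ℝ} (he : 1 ≤ e) (hr : r ≤ 0) (x : Space d) :
    e ^ r * pw 1 r x ≤ pw e r x := by
  unfold pw
  rw [← Real.mul_rpow (by linarith) (by positivity)]
  refine Real.rpow_le_rpow_of_nonpos (by positivity) ?_ hr
  nlinarith [sq_nonneg ‖x‖]

namespace WeightParams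

variable {p e t lam : ℝ}

theorem pw_one_le_Q (h : WeightParams p e t lam) {d : ℕ} (x : Space d) :
    pw 1 (-((1 + p) / 2)) x ≤ pw t (-((1 + p) / 2)) x := by
  unfold pw
  refine Real.rpow_le_rpow_of_nonpos (by have := h.t_pos; positivity) ?_ (by linarith [h.p_pos])
  nlinarith [sq_nonneg ‖x‖, h.t_le]

/-- The weighted square of the coefficients of the perturbation gains the factor `e ^ (-5/16)` compared
to the coefficient of `|∇u|²`, up to a factor `e` which the coefficient `100 / (p e)` of the source
term compensates. -/
theorem perturbation_le (h : WeightParams p e t lam) {d : ℕ} (x : Space d) :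
    pw e ((1 + p) / 2) x * pw 1 (-(1 + 3 * p)) x
      ≤ e * (e ^ (-(5 / 16) : ℝ) * pw t (-((1 + p) / 2)) x) := by
  have hp := h.p_pos
  have he := h.one_le_e
  have he0 := h.e_pos
  calc pw e ((1 + p) / 2) x * pw 1 (-(1 + 3 * p)) x
      ≤ e ^ ((1 + p) / 2) * pw 1 ((1 + p) / 2) x * pw 1 (-(1 + 3 * p)) x :=
        mul_le_mul_of_nonneg_right (pw_le_rpow_mul_pw he (by linarith) x) (pw_pos zero_le_one _ x).le
    _ = e ^ ((1 + p) / 2) * pw 1 ((1 + p) / 2 + -(1 + 3 * p)) x := by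
        rw [mul_assoc, pw_mul zero_le_one]
    _ ≤ e ^ (1 + -(5 / 16) : ℝ) * pw 1 (-((1 + p) / 2)) x := by
        refine mul_le_mul (Real.rpow_le_rpow_of_exponent_le he (by linarith [h.p_le]))
          (pw_le_pw zero_le_one (by linarith) x) (pw_pos zero_le_one _ x).le (by positivity)
    _ ≤ e ^ (1 + -(5 / 16) : ℝ) * pw t (-((1 + p) / 2)) x :=
        mul_le_mul_of_nonneg_left (h.pw_one_le_Q x) (by positivity)
    _ = _ := by rw [Real.rpow_add he0, Real.rpow_one, mul_assoc]

/-- The same gain compared to the coefficient `e E^(-p)` of `|u|²`. -/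
theorem perturbation_le' (h : WeightParams p e t lam) {d : ℕ} (x : Space d) :
    pw e ((1 + p) / 2) x * pw 1 (-(1 + 3 * p)) x
      ≤ e ^ (-(5 / 16) : ℝ) * pw t (-((1 + p) / 2)) x * (e * pw e (-p) x) := by
  have hp := h.p_pos
  have he := h.one_le_e
  have he0 := h.e_pos
  calc pw e ((1 + p) / 2) x * pw 1 (-(1 + 3 * p)) x
      ≤ e ^ ((1 + p) / 2) * pw 1 ((1 + p) / 2) x * pw 1 (-(1 + 3 * p)) x :=
        mul_le_mul_of_nonneg_right (pw_le_rpow_mul_pw he (by linarith) x) (pw_pos zero_le_one _ x).le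
    _ = e ^ ((1 + p) / 2) * pw 1 ((1 + p) / 2 + -(1 + 3 * p)) x := by
        rw [mul_assoc, pw_mul zero_le_one]
    _ ≤ e ^ (-(5 / 16) + (1 + -p) : ℝ) * pw 1 (-((1 + p) / 2) + -p) x := by
        refine mul_le_mul (Real.rpow_le_rpow_of_exponent_le he (by linarith [h.p_le]))
          (pw_le_pw zero_le_one (by linarith) x) (pw_pos zero_le_one _ x).le (by positivity)
    _ = e ^ (-(5 / 16) : ℝ) * pw 1 (-((1 + p) / 2)) x * (e * (e ^ (-p) * pw 1 (-p) x)) := by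
        rw [Real.rpow_add he0, Real.rpow_add he0, Real.rpow_one, ← pw_mul zero_le_one]
        ring
    _ ≤ e ^ (-(5 / 16) : ℝ) * pw t (-((1 + p) / 2)) x * (e * pw e (-p) x) := by
        have a1 := h.pw_one_le_Q x
        have a2 := rpow_mul_pw_le_pw he (show -p ≤ 0 by linarith) x
        have a3 := pw_pos h.t_pos.le (-((1 + p) / 2)) x
        have a4 := pw_pos zero_le_one (-p) x
        gcongr

end WeightParams

/-! ### The Carleman estimate with divergence terms -/

theorem norm_sq_le_two_mul_add {E : Type*} [NormedAddCommGroup E] (z w : E) :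
    ‖z‖ ^ 2 ≤ 2 * ‖z - w‖ ^ 2 + 2 * ‖w‖ ^ 2 := by
  have h : ‖z‖ ≤ ‖z - w‖ + ‖w‖ := by
    calc ‖z‖ = ‖(z - w) + w‖ := by rw [sub_add_cancel]
      _ ≤ _ := norm_add_le _ _
  nlinarith [sq_nonneg (‖z - w‖ - ‖w‖), norm_nonneg z]

/-- The unweighted energy estimate for the screened equation. -/
theorem screened_norm_le {d : ℕ} {κ : ℝ} {F : Fin d → L2 d} {Y : sobolev d}
    (hY : ∀ W : sobolev d, ∑ j, ⟪grad j Y, grad j W⟫_ℂ + (κ : ℂ) ^ 2 * ⟪val d Y, val d W⟫_ℂ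
      = ∑ j, ⟪F j, grad j W⟫_ℂ) :
    ∑ j, ‖grad j Y‖ ^ 2 + κ ^ 2 * ‖val d Y‖ ^ 2 ≤ 4 * ∑ j, ‖F j‖ ^ 2 := by
  have h := screened_energy (a := fun _ => 1) (a' := fun _ _ => 0) (.const 1) (by simp)
    (memLp_top_of_continuous continuous_const 1 (by simp))
    (fun _ => memLp_top_of_continuous continuous_const 0 (by simp)) (fun _ => one_pos) (κ := κ)
    (by intro x; simp; positivity) hY
  simp only [one_mul] at h
  have e1 := integral_gradNormSq Y
  have i1 := integrable_gradNormSq Y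
  unfold gradNormSq at e1 i1
  rw [integral_add i1 ((integrable_norm_sq (val d Y)).const_mul _), e1, integral_const_mul,
    integral_norm_sq, integral_finsetSum _ fun j _ => integrable_norm_sq (F j)] at h
  simpa only [integral_norm_sq] using h

namespace WeightParams

variable {p e t lam : ℝ}

/-- The energy of `U` in the norm which the Carleman estimate controls. -/
noncomputable def energyDensity (p e t lam : ℝ) {d : ℕ} (U : sobolev d) (x : Space d) : ℝ :=
  Real.exp (phase p e t x) ^ 2 * (pw t (-((1 + p) / 2)) x
        * (gradNormSq U x + (lam ^ 2 + e * pw e (-p) x) * ‖val d U x‖ ^ 2))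

theorem energyDensity_nonneg (h : WeightParams p e t lam) {d : ℕ} (U : sobolev d) (x : Space d) :
    0 ≤ energyDensity p e t lam U x := by
  have a1 := gradNormSq_nonneg U x
  have a2 := pw_pos h.t_pos.le (-((1 + p) / 2)) x
  have a3 := pw_pos h.e_pos.le (-p) x
  have a4 := h.e_pos
  unfold energyDensity
  positivity

theorem integrable_energyDensity (h : WeightParams p e t lam) {d : ℕ} (hd : 3 ≤ d)
    (U : sobolev d) : Integrable (energyDensity p e t lam U) volume := by
  have hp := h.p_pos
  have he := h.e_pos
  have ht := h.t_pos
  obtain ⟨M, hM⟩ := exists_phase_le d h.p_pos h.one_le_e h.t_pos h.t_le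
  have iN := integrable_norm_sq (val d U)
  have iG := integrable_gradNormSq U
  have hcont : Continuous fun x : Space d => Real.exp (phase p e t x) ^ 2 :=
    (h.weight hd).exp_φ.1.continuous.pow 2
  have cT := continuous_pw (d := d) h.t_pos.le (-((1 + p) / 2))
  have cE := continuous_pw (d := d) h.e_pos.le (-p)
  refine Integrable.mono' ((iG.add (iN.const_mul (lam ^ 2 + e))).const_mul (Real.exp M ^ 2)) ?_
    (Filter.Eventually.of_forall fun x => ?_)
  · exact hcont.aestronglyMeasurable.mul (cT.aestronglyMeasurable.mul (iG.1.add
      ((by fun_prop : Continuous fun x : Space d =>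
        lam ^ 2 + e * pw e (-p) x).aestronglyMeasurable.mul iN.1)))
  · have a1 := gradNormSq_nonneg U x
    have a2 := pw_pos ht.le (-((1 + p) / 2)) x
    have a3 := pw_pos he.le (-p) x
    rw [Real.norm_of_nonneg (h.energyDensity_nonneg U x), energyDensity]
    have a4 : pw t (-((1 + p) / 2)) x ≤ 1 := pw_le_one ht.le (by linarith) x
    have a5 : pw e (-p) x ≤ 1 := pw_le_one he.le (by linarith) x
    calc _ ≤ Real.exp M ^ 2 * (1 * (gradNormSq U x + (lam ^ 2 + e * 1) * ‖val d U x‖ ^ 2)) := by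
          gcongr
          exact hM x
      _ = _ := by simp only [Pi.add_apply]; ring

theorem energyDensity_le (h : WeightParams p e t lam) {d : ℕ} {κ : ℝ}
    (hκ : lam ^ 2 + e ≤ κ ^ 2) (U Y : sobolev d) :
    ∀ᵐ x, energyDensity p e t lam U x ≤ 2 * energyDensity p e t lam (U - Y) x
      + 2 * (Real.exp (phase p e t x) ^ 2 * pw e ((1 + p) / 2) x
        * (∑ j, ‖grad j Y x‖ ^ 2 + κ ^ 2 * ‖val d Y x‖ ^ 2)) := by
  have h1 : ∀ᵐ x, ∀ j, grad j (U - Y) x = grad j U x - grad j Y x := ae_all_iff.2 fun j => by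
    rw [map_sub]; exact Lp.coeFn_sub _ _
  have h2 : ∀ᵐ x, val d (U - Y) x = val d U x - val d Y x := by
    rw [map_sub]; exact Lp.coeFn_sub _ _
  filter_upwards [h1, h2] with x x1 x2
  have a2 := pw_pos h.t_pos.le (-((1 + p) / 2)) x
  have a3 := pw_pos h.e_pos.le (-p) x
  have a4 : pw t (-((1 + p) / 2)) x ≤ pw e ((1 + p) / 2) x := by
    have b1 : pw t (-((1 + p) / 2)) x ≤ 1 := pw_le_one h.t_pos.le (by linarith [h.p_pos]) x
    have b2 : pw e 0 x ≤ pw e ((1 + p) / 2) x := pw_le_pw h.e_pos.le (by linarith [h.p_pos]) x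
    rw [pw_zero] at b2
    exact b1.trans b2
  have a5 : pw e (-p) x ≤ 1 := pw_le_one h.e_pos.le (by linarith [h.p_pos]) x
  have a6 := h.e_pos
  have a7 : lam ^ 2 + e * pw e (-p) x ≤ κ ^ 2 := by nlinarith
  have hD : gradNormSq U x ≤ 2 * gradNormSq (U - Y) x + 2 * gradNormSq Y x := by
    unfold gradNormSq
    rw [Finset.mul_sum, Finset.mul_sum, ← Finset.sum_add_distrib]
    refine Finset.sum_le_sum fun j _ => ?_
    rw [x1 j]
    exact norm_sq_le_two_mul_add _ _
  have hn : ‖val d U x‖ ^ 2 ≤ 2 * ‖val d (U - Y) x‖ ^ 2 + 2 * ‖val d Y x‖ ^ 2 := by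
    rw [x2]
    exact norm_sq_le_two_mul_add _ _
  have hY : 0 ≤ gradNormSq Y x := gradNormSq_nonneg Y x
  have a8 := pw_pos h.e_pos.le ((1 + p) / 2) x
  change _ ≤ _ + 2 * (_ * (gradNormSq Y x + _))
  unfold energyDensity
  have b1 : pw t (-((1 + p) / 2)) x * (gradNormSq Y x + (lam ^ 2 + e * pw e (-p) x)
      * ‖val d Y x‖ ^ 2) ≤ pw e ((1 + p) / 2) x * (gradNormSq Y x + κ ^ 2 * ‖val d Y x‖ ^ 2) := by
    gcongr
  have b2 := mul_le_mul_of_nonneg_left b1 (sq_nonneg (Real.exp (phase p e t x)))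
  have b3 : 0 ≤ lam ^ 2 + e * pw e (-p) x := by positivity
  have b4 := mul_le_mul_of_nonneg_left hn b3
  have b5 := mul_le_mul_of_nonneg_left (add_le_add hD b4)
    (show 0 ≤ Real.exp (phase p e t x) ^ 2 * pw t (-((1 + p) / 2)) x by positivity)
  linarith

/-- The Carleman estimate for `-Δu - z u = F₀ - div F`, with `z` close to `lam ^ 2`. The divergence
term is removed by means of the screened equation. -/
theorem carleman_estimate_div (h : WeightParams p e t lam) {d : ℕ} (hd : 3 ≤ d) (hlam : 0 < lam)
    {M : ℝ} (hM : ∀ x : Space d, phase p e t x ≤ M) {z : ℂ} {ε : ℝ} (hε : 0 ≤ ε) (hε1 : ε ≤ 1)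
    (hz : ‖z - (lam : ℂ) ^ 2‖ ≤ ε) (U : sobolev d) (F₀ : L2 d) (F : Fin d → L2 d)
    (hU : ∀ W : sobolev d, ∑ j, ⟪grad j U, grad j W⟫_ℂ
      = ⟪F₀ + z • val d U, val d W⟫_ℂ + ∑ j, ⟪F j, grad j W⟫_ℂ)
    (hF₀ : Integrable (fun x => Real.exp (phase p e t x) ^ 2 * pw e ((1 + p) / 2) x * ‖F₀ x‖ ^ 2)
      volume)
    (hF : Integrable (fun x => Real.exp (phase p e t x) ^ 2 * pw e ((1 + p) / 2) x
      * ∑ j, ‖F j x‖ ^ 2) volume) :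
    (p / 100) ^ 2 / 30 * ∫ x, energyDensity p e t lam U x
      ≤ Real.exp M ^ 2 * (2 * d * (2 / t) ^ 2 + 2 * (2 / t * e + d) ^ 2 + 1)
          * ε * (2 * (‖U‖ ^ 2 / lam + lam * ‖val d U‖ ^ 2) + 16 * (∑ j, ‖F j‖ ^ 2) / lam)
        + 100 / (p * e) * (∫ x, Real.exp (phase p e t x) ^ 2 * pw e ((1 + p) / 2) x * ‖F₀ x‖ ^ 2)
        + (819200 / p * (lam ^ 2 / e + 1) + 4 * ((p / 100) ^ 2 / 15))
          * ∫ x, Real.exp (phase p e t x) ^ 2 * pw e ((1 + p) / 2) x * ∑ j, ‖F j x‖ ^ 2 := by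
  have hp := h.p_pos
  have he := h.e_pos
  have he1 := h.one_le_e
  have ht := h.t_pos
  -- large enough to dominate the logarithmic derivatives of the weights, and not larger, because the
  -- remaining equation has the source term `(κ² + z) v`
  obtain ⟨κ, hκ0, hκ⟩ : ∃ κ : ℝ, 0 ≤ κ ∧ κ ^ 2 = 512 * (lam ^ 2 + e) :=
    ⟨√(512 * (lam ^ 2 + e)), Real.sqrt_nonneg _, Real.sq_sqrt (by positivity)⟩
  have hX : 0 < lam ^ 2 := by positivity
  have hκ1 : 1 ≤ κ := by nlinarith
  obtain ⟨S, hS⟩ := exists_screened hκ1 F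
  obtain ⟨hS1, hS2⟩ := h.screened hd (by rw [hκ]; linarith) hκ0 hS hF
  have hS3 := screened_norm_le hS
  have hzn : ‖(κ : ℂ) ^ 2 + z‖ ≤ 2 * κ ^ 2 := by
    have e1 : (κ : ℂ) ^ 2 + z = ((κ ^ 2 + lam ^ 2 : ℝ) : ℂ) + (z - (lam : ℂ) ^ 2) := by
      push_cast; ring
    rw [e1]
    refine (norm_add_le _ _).trans ?_
    rw [Complex.norm_real, Real.norm_of_nonneg (by positivity)]
    linarith
  set f : L2 d := F₀ + ((κ : ℂ) ^ 2 + z) • val d S with hfdef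
  have hY : ∀ W : sobolev d, ∑ j, ⟪grad j (U - S), grad j W⟫_ℂ
      = ⟪z • val d (U - S) + f, val d W⟫_ℂ := fun W => by
    have e1 := hU W
    have e2 := hS W
    simp only [hfdef, map_sub, inner_sub_left, Finset.sum_sub_distrib, inner_add_left,
      inner_smul_left, smul_sub] at e1 ⊢
    simp only [map_add, map_pow, Complex.conj_ofReal]
    linear_combination e1 - e2
  have hw : ∀ x : Space d, 0 < Real.exp (phase p e t x) ^ 2 * pw e ((1 + p) / 2) x := fun x =>
    mul_pos (by positivity) (pw_pos he.le _ x)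
  have hfx : ∀ᵐ x, Real.exp (phase p e t x) ^ 2 * pw e ((1 + p) / 2) x * ‖f x‖ ^ 2
      ≤ 2 * (Real.exp (phase p e t x) ^ 2 * pw e ((1 + p) / 2) x * ‖F₀ x‖ ^ 2)
        + 8 * κ ^ 2 * (Real.exp (phase p e t x) ^ 2 * pw e ((1 + p) / 2) x
        * (∑ j, ‖grad j S x‖ ^ 2 + κ ^ 2 * ‖val d S x‖ ^ 2)) := by
    filter_upwards [Lp.coeFn_add F₀ (((κ : ℂ) ^ 2 + z) • val d S),
      Lp.coeFn_smul ((κ : ℂ) ^ 2 + z) (val d S)] with x x1 x2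
    have b1 : ‖f x‖ ≤ ‖F₀ x‖ + 2 * κ ^ 2 * ‖val d S x‖ := by
      rw [hfdef, x1, Pi.add_apply, x2, Pi.smul_apply, smul_eq_mul]
      refine (norm_add_le _ _).trans ?_
      rw [norm_mul]
      gcongr
    have b2 : ‖f x‖ ^ 2 ≤ 2 * ‖F₀ x‖ ^ 2 + 8 * κ ^ 2 * (κ ^ 2 * ‖val d S x‖ ^ 2) := by
      calc ‖f x‖ ^ 2 ≤ (‖F₀ x‖ + 2 * κ ^ 2 * ‖val d S x‖) ^ 2 := by gcongr
        _ ≤ _ := by nlinarith [sq_nonneg (‖F₀ x‖ - 2 * κ ^ 2 * ‖val d S x‖)]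
    have b3 : 0 ≤ 8 * κ ^ 2 * ∑ j, ‖grad j S x‖ ^ 2 := by positivity
    have b4 := mul_le_mul_of_nonneg_left (show ‖f x‖ ^ 2 ≤ 2 * ‖F₀ x‖ ^ 2 + 8 * κ ^ 2
      * (∑ j, ‖grad j S x‖ ^ 2 + κ ^ 2 * ‖val d S x‖ ^ 2) by linarith) (hw x).le
    linarith
  have hcont : Continuous fun x : Space d => Real.exp (phase p e t x) ^ 2 * pw e ((1 + p) / 2) x :=
    ((h.weight hd).exp_φ.1.continuous.pow 2).mul (continuous_pw h.e_pos.le _)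
  have hif : Integrable (fun x => Real.exp (phase p e t x) ^ 2 * pw e ((1 + p) / 2) x
      * ‖f x‖ ^ 2) volume := by
    refine Integrable.mono' ((hF₀.const_mul 2).fun_add (hS1.const_mul (8 * κ ^ 2)))
      (hcont.aestronglyMeasurable.mul (integrable_norm_sq f).1) ?_
    filter_upwards [hfx] with x hx
    rw [Real.norm_of_nonneg (mul_nonneg (hw x).le (sq_nonneg _))]
    exact hx
  have key := h.carleman_estimate hd hlam hM hε hz (U - S) f hY hif
  have k1 := integral_mono_ae hif ((hF₀.const_mul 2).fun_add (hS1.const_mul (8 * κ ^ 2))) hfx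
  rw [integral_add (hF₀.const_mul 2) (hS1.const_mul (8 * κ ^ 2)), integral_const_mul,
    integral_const_mul] at k1
  have k2 := integral_mono_ae (h.integrable_energyDensity hd U)
    (((h.integrable_energyDensity hd (U - S)).const_mul 2).fun_add (hS1.const_mul 2))
    (h.energyDensity_le (by rw [hκ]; linarith) U S)
  rw [integral_add ((h.integrable_energyDensity hd (U - S)).const_mul 2) (hS1.const_mul 2),
    integral_const_mul, integral_const_mul] at k2
  have k3 : ‖U - S‖ ^ 2 / lam + lam * ‖val d (U - S)‖ ^ 2
      ≤ 2 * (‖U‖ ^ 2 / lam + lam * ‖val d U‖ ^ 2) + 16 * (∑ j, ‖F j‖ ^ 2) / lam := by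
    have n0 : ∀ {E : Type} [NormedAddCommGroup E] (a b : E),
        ‖a - b‖ ^ 2 ≤ 2 * ‖a‖ ^ 2 + 2 * ‖b‖ ^ 2 := fun a b => by
      have := norm_sub_le a b
      nlinarith [sq_nonneg (‖a‖ - ‖b‖), norm_nonneg (a - b)]
    have n1 := n0 U S
    have n2 := n0 (val d U) (val d S)
    rw [← map_sub] at n2
    have n3 : ‖S‖ ^ 2 ≤ 4 * ∑ j, ‖F j‖ ^ 2 := by
      rw [sobolev_norm_sq]
      have : ‖val d S‖ ^ 2 ≤ κ ^ 2 * ‖val d S‖ ^ 2 :=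
        le_mul_of_one_le_left (sq_nonneg _) (one_le_pow₀ hκ1)
      linarith
    have n4 : lam ^ 2 * ‖val d S‖ ^ 2 ≤ 4 * ∑ j, ‖F j‖ ^ 2 := by
      have n5 : lam ^ 2 * ‖val d S‖ ^ 2 ≤ κ ^ 2 * ‖val d S‖ ^ 2 :=
        mul_le_mul_of_nonneg_right (by rw [hκ]; linarith) (sq_nonneg _)
      have n6 : 0 ≤ ∑ j, ‖grad j S‖ ^ 2 := by positivity
      linarith
    have n7 : lam * ‖val d S‖ ^ 2 ≤ 4 * (∑ j, ‖F j‖ ^ 2) / lam := by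
      rw [le_div_iff₀ hlam]
      linarith
    have n8 : ‖U - S‖ ^ 2 / lam ≤ (2 * ‖U‖ ^ 2 + 2 * (4 * ∑ j, ‖F j‖ ^ 2)) / lam := by
      gcongr
      linarith
    have n9 := mul_le_mul_of_nonneg_left n2 hlam.le
    have n10 : (2 * ‖U‖ ^ 2 + 2 * (4 * ∑ j, ‖F j‖ ^ 2)) / lam
        = 2 * (‖U‖ ^ 2 / lam) + 2 * (4 * (∑ j, ‖F j‖ ^ 2) / lam) := by ring
    have n11 : 16 * (∑ j, ‖F j‖ ^ 2) / lam = 4 * (4 * (∑ j, ‖F j‖ ^ 2) / lam) := by ring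
    rw [n11]
    linarith
  have k4 := mul_le_mul_of_nonneg_left k3 (show 0 ≤ Real.exp M ^ 2 *
    (2 * d * (2 / t) ^ 2 + 2 * (2 / t * e + d) ^ 2 + 1) * ε by positivity)
  have k5 := mul_le_mul_of_nonneg_left k1 (show 0 ≤ 50 / (p * e) by positivity)
  have k6 : 0 ≤ ((p / 100) ^ 2 / 15 + 50 / (p * e) * (8 * κ ^ 2)) := by positivity
  have k7 := mul_le_mul_of_nonneg_left hS2 k6
  have k8 := mul_le_mul_of_nonneg_left k2 (show 0 ≤ (p / 100) ^ 2 / 30 by positivity)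
  have k9 : (819200 / p * (lam ^ 2 / e + 1) + 4 * ((p / 100) ^ 2 / 15))
      = ((p / 100) ^ 2 / 15 + 50 / (p * e) * (8 * κ ^ 2)) * 4 := by
    rw [hκ]
    field_simp
    ring
  have k10 : 100 / (p * e) = 2 * (50 / (p * e)) := by ring
  rw [k9, k10]
  change (p / 100) ^ 2 / 15 * ∫ x, energyDensity p e t lam (U - S) x ≤ _ at key
  linarith

end WeightParams

/-! ### The Carleman estimate for the magnetic operator -/

/-- The coefficients of the perturbation terms are small compared to those of the energy. -/
theorem perturbation_coeff_le {p e C₀ X Aw η Q H D n α β : ℝ} (hp : 0 < p) (hp' : p ≤ 1 / 8) (he1 : 1 ≤ e)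
    (hX : 0 ≤ X) (hα : α = 100 / (p * e))
    (hβ : β = 819200 / p * (X / e + 1) + 4 * ((p / 100) ^ 2 / 15))
    (hAw : 0 ≤ Aw) (hη : 0 < η) (hQ : 0 < Q) (hH : 0 < H) (hD : 0 ≤ D) (hn : 0 ≤ n)
    (a1 : Aw ≤ e * (η * Q)) (a2 : Aw ≤ η * Q * (e * H)) :
    α * (3 * C₀ ^ 2 * (Aw * D + (C₀ + 1) ^ 2 * (Aw * n))) + β * (2 * C₀ ^ 2 * (Aw * n))
      ≤ C₀ ^ 2 * ((300 * ((C₀ + 1) ^ 2 + 1) + 1638400) / p + 8) * η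
          * (Q * (D + (X + e * H) * n)) := by
  have he : 0 < e := by linarith
  have hα0 : 0 ≤ α := by rw [hα]; positivity
  have b1 : α * Aw ≤ 100 / p * (η * Q) := by
    have := mul_le_mul_of_nonneg_left a1 hα0
    refine this.trans (le_of_eq ?_)
    rw [hα]; field_simp
  have hα1 : α ≤ 100 / p := by
    rw [hα]
    gcongr
    exact le_mul_of_one_le_right hp.le he1
  have b2 : α * Aw ≤ 100 / p * (η * Q * (e * H)) :=
    mul_le_mul hα1 a2 hAw (by positivity)
  have b3 : β * Aw ≤ 819200 / p * (X * (η * Q) + η * Q * (e * H)) + 4 * (η * Q * (e * H)) := by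
    have c1 : X / e * Aw ≤ X * (η * Q) := by
      have := mul_le_mul_of_nonneg_left a1 (show 0 ≤ X / e by positivity)
      refine this.trans (le_of_eq ?_)
      field_simp
    have c2 := mul_le_mul_of_nonneg_left (add_le_add c1 a2) (show 0 ≤ 819200 / p by positivity)
    have c3 : 4 * ((p / 100) ^ 2 / 15) ≤ 4 := by nlinarith only [hp, hp']
    have c4 := mul_le_mul c3 a2 hAw (by norm_num)
    rw [hβ]
    linarith
  have c1 := mul_le_mul_of_nonneg_right b1 (show 0 ≤ 3 * C₀ ^ 2 * D by positivity)
  have c2 := mul_le_mul_of_nonneg_right b2 (show 0 ≤ 3 * C₀ ^ 2 * (C₀ + 1) ^ 2 * n by positivity)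
  have c3 := mul_le_mul_of_nonneg_right b3 (show 0 ≤ 2 * C₀ ^ 2 * n by positivity)
  have r1 : 0 ≤ C₀ ^ 2 * η * Q * D * ((300 * (C₀ + 1) ^ 2 + 1638400) / p + 8) := by positivity
  have r2 : 0 ≤ C₀ ^ 2 * η * Q * (e * H) * n * (300 / p) := by positivity
  have r3 : 0 ≤ C₀ ^ 2 * η * Q * X * n * (300 * ((C₀ + 1) ^ 2 + 1) / p + 8) := by positivity
  have e1 : C₀ ^ 2 * ((300 * ((C₀ + 1) ^ 2 + 1) + 1638400) / p + 8) * η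
      * (Q * (D + (X + e * H) * n))
      = 100 / p * (η * Q) * (3 * C₀ ^ 2 * D)
        + 100 / p * (η * Q * (e * H)) * (3 * C₀ ^ 2 * (C₀ + 1) ^ 2 * n)
        + (819200 / p * (X * (η * Q) + η * Q * (e * H)) + 4 * (η * Q * (e * H)))
          * (2 * C₀ ^ 2 * n)
        + C₀ ^ 2 * η * Q * D * ((300 * (C₀ + 1) ^ 2 + 1638400) / p + 8)
        + C₀ ^ 2 * η * Q * (e * H) * n * (300 / p)
        + C₀ ^ 2 * η * Q * X * n * (300 * ((C₀ + 1) ^ 2 + 1) / p + 8) := by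
    field_simp
    ring
  rw [e1]
  linarith

namespace WeightParams

variable {p e t lam : ℝ} {d : ℕ} {b : Space d → Space d} {V : Space d → ℝ}

/-- The Carleman estimate for `(P - z) u = f₀ - div f`: for large `e` the contributions of `b` and `V`
are absorbed. -/
theorem carleman_estimate_magnetic (h : WeightParams p e t lam) (hd : 3 ≤ d) (hlam : 0 < lam)
    {M : ℝ} (hM : ∀ x : Space d, phase p e t x ≤ M) {C₀ : ℝ} (hC₀ : 0 ≤ C₀)
    (hb : ∀ j, MemLp (fun x => b x j) ⊤ (volume : Measure (Space d)))
    (hV : MemLp V ⊤ (volume : Measure (Space d)))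
    (hdecay : ∀ᵐ x, |V x| + ‖b x‖ ≤ C₀ * pw 1 (-((1 + 3 * p) / 2)) x)
    (hlarge : C₀ ^ 2 * ((300 * ((C₀ + 1) ^ 2 + 1) + 1638400) / p + 8) * e ^ (-(5 / 16) : ℝ)
      ≤ (p / 100) ^ 2 / 60)
    {z : ℂ} {ε : ℝ} (hε : 0 ≤ ε) (hε1 : ε ≤ 1) (hz : ‖z - (lam : ℂ) ^ 2‖ ≤ ε)
    (U : sobolev d) (f₀ : L2 d) (f : Fin d → L2 d)
    (hU : ∀ W, ⟪formOp hb hV z U, W⟫_ℂ = ⟪f₀, val d W⟫_ℂ + ∑ j, ⟪f j, grad j W⟫_ℂ)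
    (hf₀ : Integrable (fun x => Real.exp (phase p e t x) ^ 2 * pw e ((1 + p) / 2) x * ‖f₀ x‖ ^ 2)
      volume)
    (hf : Integrable (fun x => Real.exp (phase p e t x) ^ 2 * pw e ((1 + p) / 2) x
      * ∑ j, ‖f j x‖ ^ 2) volume) :
    (p / 100) ^ 2 / 60 * ∫ x, energyDensity p e t lam U x
      ≤ Real.exp M ^ 2 * (2 * d * (2 / t) ^ 2 + 2 * (2 / t * e + d) ^ 2 + 1)
          * ε * (2 * (‖U‖ ^ 2 / lam + lam * ‖val d U‖ ^ 2)
            + 16 * (∑ j, ‖sourceFlux hb U f j‖ ^ 2) / lam)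
        + 100 / (p * e) * (3 * ∫ x, Real.exp (phase p e t x) ^ 2 * pw e ((1 + p) / 2) x
          * ‖f₀ x‖ ^ 2)
        + (819200 / p * (lam ^ 2 / e + 1) + 4 * ((p / 100) ^ 2 / 15))
          * (2 * ∫ x, Real.exp (phase p e t x) ^ 2 * pw e ((1 + p) / 2) x * ∑ j, ‖f j x‖ ^ 2) := by
  have hp := h.p_pos
  have hp' := h.p_le
  have he := h.e_pos
  have he1 := h.one_le_e
  have hw1 : ∀ x : Space d, C₀ * pw 1 (-((1 + 3 * p) / 2)) x ≤ C₀ := fun x =>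
    mul_le_of_le_one_right hC₀ (pw_le_one zero_le_one (by linarith) x)
  have hw2 : ∀ x : Space d, (C₀ * pw 1 (-((1 + 3 * p) / 2)) x) ^ 2
      = C₀ ^ 2 * pw 1 (-(1 + 3 * p)) x := fun x => by
    rw [mul_pow, sq (pw 1 _ x), pw_mul zero_le_one]
    congr 2
    ring
  have s1 := norm_sourceTerm_sq_le hb hV U f₀ hw1 hdecay
  have s2 := sum_norm_sourceFlux_sq_le hb U f hdecay
  simp only [hw2] at s1 s2
  have hΦA : ∀ x : Space d, 0 < Real.exp (phase p e t x) ^ 2 * pw e ((1 + p) / 2) x := fun x =>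
    mul_pos (by positivity) (pw_pos he.le _ x)
  have hcont : Continuous fun x : Space d => Real.exp (phase p e t x) ^ 2 * pw e ((1 + p) / 2) x :=
    ((h.weight hd).exp_φ.1.continuous.pow 2).mul (continuous_pw h.e_pos.le _)
  have cw := continuous_pw (d := d) zero_le_one (-(1 + 3 * p))
  -- the weight in front of the perturbation terms is bounded
  have hbd : ∀ x : Space d, Real.exp (phase p e t x) ^ 2 * pw e ((1 + p) / 2) x
      * pw 1 (-(1 + 3 * p)) x ≤ Real.exp M ^ 2 * (e * 1) := fun x => by
    have a1 := h.perturbation_le x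
    have a2 : e ^ (-(5 / 16) : ℝ) ≤ 1 := Real.rpow_le_one_of_one_le_of_nonpos he1 (by norm_num)
    have a3 : pw t (-((1 + p) / 2)) x ≤ 1 := pw_le_one h.t_pos.le (by linarith) x
    have a4 := pw_pos h.t_pos.le (-((1 + p) / 2)) x
    have a5 : pw e ((1 + p) / 2) x * pw 1 (-(1 + 3 * p)) x ≤ e * 1 :=
      a1.trans (mul_le_mul_of_nonneg_left (mul_le_one₀ a2 a4.le a3) he.le)
    have a6 := pw_pos he.le ((1 + p) / 2) x
    have a7 := pw_pos zero_le_one (-(1 + 3 * p)) x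
    rw [mul_assoc]
    have := hM x
    gcongr
  have iP : ∀ {g : Space d → ℝ}, Integrable g volume → Integrable (fun x =>
      Real.exp (phase p e t x) ^ 2 * pw e ((1 + p) / 2) x * pw 1 (-(1 + 3 * p)) x * g x) volume :=
    fun {g} hg => hg.bdd_mul (c := Real.exp M ^ 2 * (e * 1))
      (hcont.mul cw).aestronglyMeasurable (Filter.Eventually.of_forall fun x => by
        rw [Real.norm_of_nonneg (mul_nonneg (hΦA x).le (pw_pos zero_le_one _ x).le)]
        exact hbd x)
  have iG := iP (integrable_gradNormSq U)
  have iN := iP (integrable_norm_sq (val d U))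
  have iB₀ := (hf₀.const_mul 3).fun_add
    ((iG.fun_add (iN.const_mul ((C₀ + 1) ^ 2))).const_mul (3 * C₀ ^ 2))
  have iB := (hf.const_mul 2).fun_add (iN.const_mul (2 * C₀ ^ 2))
  have p1 : ∀ᵐ x, Real.exp (phase p e t x) ^ 2 * pw e ((1 + p) / 2) x
      * ‖sourceTerm hb hV U f₀ x‖ ^ 2 ≤ 3 * (Real.exp (phase p e t x) ^ 2 * pw e ((1 + p) / 2) x
        * ‖f₀ x‖ ^ 2) + 3 * C₀ ^ 2 * (Real.exp (phase p e t x) ^ 2 * pw e ((1 + p) / 2) x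
          * pw 1 (-(1 + 3 * p)) x * gradNormSq U x + (C₀ + 1) ^ 2 *
          (Real.exp (phase p e t x) ^ 2 * pw e ((1 + p) / 2) x
          * pw 1 (-(1 + 3 * p)) x * ‖val d U x‖ ^ 2)) := by
    filter_upwards [s1] with x hx
    have := mul_le_mul_of_nonneg_left hx (hΦA x).le
    linarith
  have p2 : ∀ᵐ x, Real.exp (phase p e t x) ^ 2 * pw e ((1 + p) / 2) x
      * ∑ j, ‖sourceFlux hb U f j x‖ ^ 2 ≤ 2 * (Real.exp (phase p e t x) ^ 2
        * pw e ((1 + p) / 2) x * ∑ j, ‖f j x‖ ^ 2)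
        + 2 * C₀ ^ 2 * (Real.exp (phase p e t x) ^ 2 * pw e ((1 + p) / 2) x
          * pw 1 (-(1 + 3 * p)) x * ‖val d U x‖ ^ 2) := by
    filter_upwards [s2] with x hx
    have := mul_le_mul_of_nonneg_left hx (hΦA x).le
    linarith
  have iF₀ : Integrable (fun x => Real.exp (phase p e t x) ^ 2 * pw e ((1 + p) / 2) x
      * ‖sourceTerm hb hV U f₀ x‖ ^ 2) volume := by
    refine iB₀.mono' (hcont.aestronglyMeasurable.mul (integrable_norm_sq _).1) ?_
    filter_upwards [p1] with x hx
    rw [Real.norm_of_nonneg (mul_nonneg (hΦA x).le (sq_nonneg _))]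
    exact hx
  have iF : Integrable (fun x => Real.exp (phase p e t x) ^ 2 * pw e ((1 + p) / 2) x
      * ∑ j, ‖sourceFlux hb U f j x‖ ^ 2) volume := by
    refine iB.mono' (hcont.aestronglyMeasurable.mul
      (integrable_finsetSum Finset.univ fun j _ => integrable_norm_sq _).1) ?_
    filter_upwards [p2] with x hx
    rw [Real.norm_of_nonneg (mul_nonneg (hΦA x).le (by positivity))]
    exact hx
  have key := h.carleman_estimate_div hd hlam hM hε hε1 hz U (sourceTerm hb hV U f₀)
    (sourceFlux hb U f) (fun W => sum_inner_grad_eq hb hV hU W) iF₀ iF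
  have k1 := integral_mono_ae iF₀ iB₀ p1
  have k2 := integral_mono_ae iF iB p2
  rw [integral_add (hf₀.const_mul 3) ((iG.fun_add (iN.const_mul ((C₀ + 1) ^ 2))).const_mul _),
    integral_const_mul, integral_const_mul, integral_add iG (iN.const_mul _),
    integral_const_mul] at k1
  rw [integral_add (hf.const_mul 2) (iN.const_mul _), integral_const_mul,
    integral_const_mul] at k2
  set α := 100 / (p * e) with hα
  set β := 819200 / p * (lam ^ 2 / e + 1) + 4 * ((p / 100) ^ 2 / 15) with hβ
  have hα0 : 0 ≤ α := by positivity
  have hβ0 : 0 ≤ β := by positivity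
  -- the pointwise absorption
  have p3 : ∀ x, α * (3 * C₀ ^ 2 * (Real.exp (phase p e t x) ^ 2 * pw e ((1 + p) / 2) x
          * pw 1 (-(1 + 3 * p)) x * gradNormSq U x + (C₀ + 1) ^ 2 *
          (Real.exp (phase p e t x) ^ 2 * pw e ((1 + p) / 2) x
          * pw 1 (-(1 + 3 * p)) x * ‖val d U x‖ ^ 2)))
      + β * (2 * C₀ ^ 2 * (Real.exp (phase p e t x) ^ 2 * pw e ((1 + p) / 2) x
          * pw 1 (-(1 + 3 * p)) x * ‖val d U x‖ ^ 2))
      ≤ (p / 100) ^ 2 / 60 * energyDensity p e t lam U x := fun x => by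
    have a1 := h.perturbation_le x
    have a2 := h.perturbation_le' x
    have hQ := pw_pos h.t_pos.le (-((1 + p) / 2)) x
    have hH := pw_pos he.le (-p) x
    have hA := pw_pos he.le ((1 + p) / 2) x
    have hw := pw_pos zero_le_one (-(1 + 3 * p)) x
    have hΦ : 0 < Real.exp (phase p e t x) ^ 2 := by positivity
    have hD := gradNormSq_nonneg U x
    have hn := sq_nonneg ‖val d U x‖
    have hc0 : 0 < e ^ (-(5 / 16) : ℝ) := by positivity
    unfold energyDensity
    generalize Real.exp (phase p e t x) ^ 2 = Φ at *
    have hAw := (mul_pos hA hw).le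
    rw [mul_assoc Φ]
    generalize pw e ((1 + p) / 2) x * pw 1 (-(1 + 3 * p)) x = Aw at *
    generalize pw t (-((1 + p) / 2)) x = Q at *
    generalize pw e (-p) x = H at *
    generalize gradNormSq U x = D at *
    generalize ‖val d U x‖ ^ 2 = n at *
    generalize e ^ (-(5 / 16) : ℝ) = η at *
    have b4 := perturbation_coeff_le (C₀ := C₀) hp hp' he1 (sq_nonneg lam) hα hβ hAw hc0 hQ hH hD hn a1 a2
    have b5 := mul_le_mul_of_nonneg_right hlarge
      (show 0 ≤ Q * (D + (lam ^ 2 + e * H) * n) by positivity)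
    have b6 := mul_le_mul_of_nonneg_left (b4.trans b5) hΦ.le
    linarith
  have k3 := integral_mono ((((iG.fun_add (iN.const_mul ((C₀ + 1) ^ 2))).const_mul
    (3 * C₀ ^ 2)).const_mul α).fun_add ((iN.const_mul (2 * C₀ ^ 2)).const_mul β))
    ((h.integrable_energyDensity hd U).const_mul ((p / 100) ^ 2 / 60)) p3
  rw [integral_add (((iG.fun_add (iN.const_mul ((C₀ + 1) ^ 2))).const_mul
    (3 * C₀ ^ 2)).const_mul α) ((iN.const_mul (2 * C₀ ^ 2)).const_mul β)] at k3
  simp only [integral_const_mul] at k3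
  rw [integral_add iG (iN.const_mul _), integral_const_mul] at k3
  have k4 := mul_le_mul_of_nonneg_left k1 hα0
  have k5 := mul_le_mul_of_nonneg_left k2 hβ0
  have e1 : (p / 100) ^ 2 / 30 = 2 * ((p / 100) ^ 2 / 60) := by ring
  rw [e1] at key
  linarith

end WeightParams

/-! ### The contribution of the imaginary part -/

/-- The inner product of `L²` as a pairing of weighted spaces. -/
theorem norm_inner_le_weighted {d : ℕ} {r ζ : ℝ} (hr : 0 ≤ r) (hζ : 0 < ζ) (f g : L2 d)
    (hf : Integrable (fun x => pw 1 r x * ‖f x‖ ^ 2) volume) :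
    ‖⟪f, g⟫_ℂ‖ ≤ ζ * (∫ x, pw 1 (-r) x * ‖g x‖ ^ 2)
      + 1 / (4 * ζ) * ∫ x, pw 1 r x * ‖f x‖ ^ 2 := by
  have hg : Integrable (fun x => pw 1 (-r) x * ‖g x‖ ^ 2) volume :=
    integrable_mul_norm_sq (memLp_top_of_continuous (continuous_pw zero_le_one (-r)) 1 fun x => by
      rw [abs_of_pos (pw_pos zero_le_one _ x)]
      exact pw_le_one zero_le_one (by linarith) x) g
  rw [L2.inner_def, ← integral_const_mul, ← integral_const_mul,
    ← integral_add (hg.const_mul ζ) (hf.const_mul _)]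
  refine norm_integral_le_of_norm_le ((hg.const_mul ζ).fun_add (hf.const_mul _))
    (Filter.Eventually.of_forall fun x => ?_)
  refine (norm_inner_le_norm _ _).trans ?_
  have h1 : pw 1 r x * pw 1 (-r) x = 1 := by
    rw [pw_mul zero_le_one, add_neg_cancel, pw_zero]
  have h2 := pw_pos zero_le_one r x
  have h3 := pw_pos zero_le_one (-r) x
  have h4 : ζ * (pw 1 (-r) x * ‖g x‖ ^ 2) + 1 / (4 * ζ) * (pw 1 r x * ‖f x‖ ^ 2) - ‖f x‖ * ‖g x‖
      = ζ * pw 1 (-r) x * (‖g x‖ - 1 / (2 * ζ) * pw 1 r x * ‖f x‖) ^ 2 := by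
    field_simp
    linear_combination (16 * ‖f x‖ * ζ * ‖g x‖ - 4 * ‖f x‖ ^ 2 * pw 1 r x) * h1
  have h5 : 0 ≤ ζ * pw 1 (-r) x * (‖g x‖ - 1 / (2 * ζ) * pw 1 r x * ‖f x‖) ^ 2 := by positivity
  linarith

/-- The choice of the inner scale, for which the perturbation is absorbed. -/
theorem exists_inner_scale {K c : ℝ} (hc : 0 < c) : ∃ e : ℝ, 1 ≤ e ∧ K * e ^ (-(5 / 16) : ℝ) ≤ c := by
  have h : Filter.Tendsto (fun e : ℝ => K * e ^ (-(5 / 16) : ℝ)) Filter.atTop (nhds (K * 0)) :=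
    (tendsto_rpow_neg_atTop (by norm_num)).const_mul K
  rw [mul_zero] at h
  obtain ⟨e, h1, h2⟩ := ((Filter.eventually_ge_atTop (1 : ℝ)).and (h.eventually_le_const hc)).exists
  exact ⟨e, h1, h2⟩

/-- The choice of the outer scale, for which the errors far from the origin are dominated by the
energy. -/
theorem exists_outer_scale {p e δ : ℝ} (hp : 0 < p) (hδ : 0 < δ) : ∃ t : ℝ, 0 < t ∧ t ≤ 1 ∧
    e * t ≤ (δ ^ 2 / 100) ^ 2 ∧ e * (32 * t / e) ^ p ≤ δ ^ 2 := by
  have c1 : ContinuousAt (fun t : ℝ => e * t) 0 := by fun_prop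
  have c2 : ContinuousAt (fun t : ℝ => e * (32 * t / e) ^ p) 0 :=
    continuousAt_const.mul ((by fun_prop : ContinuousAt (fun t : ℝ => 32 * t / e) 0).rpow_const
      (Or.inr hp.le))
  have h1 : ∀ᶠ t in nhdsWithin (0 : ℝ) (Set.Ioi 0), e * t < (δ ^ 2 / 100) ^ 2 :=
    nhdsWithin_le_nhds (c1.eventually_lt_const (by simp; positivity))
  have h2 : ∀ᶠ t in nhdsWithin (0 : ℝ) (Set.Ioi 0), e * (32 * t / e) ^ p < δ ^ 2 :=
    nhdsWithin_le_nhds (c2.eventually_lt_const (by simp [Real.zero_rpow hp.ne']; positivity))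
  have h3 : ∀ᶠ t in nhdsWithin (0 : ℝ) (Set.Ioi 0), t < 1 :=
    nhdsWithin_le_nhds (eventually_lt_nhds one_pos)
  obtain ⟨t, ⟨⟨h4, h5⟩, h6⟩, h7⟩ := (((h1.and h2).and h3).and self_mem_nhdsWithin).exists
  exact ⟨t, h7, h6.le, h4.le, h5.le⟩

theorem WeightParams.mono {p e t δ lam : ℝ} (h : WeightParams p e t δ) (hδ : 0 ≤ δ)
    (hl : δ ≤ lam) : WeightParams p e t lam where
  p_pos := h.p_pos
  p_le := h.p_le
  one_le_e := h.one_le_e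
  t_pos := h.t_pos
  t_le := h.t_le
  mul_le := h.mul_le.trans (by gcongr)
  far_le := h.far_le.trans (by gcongr)

section

variable {d : ℕ} {b : Space d → Space d} {V : Space d → ℝ}

theorem sum_norm_sourceFlux_le (hb : ∀ j, MemLp (fun x => b x j) ⊤ (volume : Measure (Space d)))
    (U : sobolev d) (f : Fin d → L2 d) : ∑ j, ‖sourceFlux hb U f j‖ ^ 2
      ≤ 2 * ∑ j, ‖f j‖ ^ 2 + 2 * (∑ j, ‖mulOp (hb j)‖ ^ 2) * ‖val d U‖ ^ 2 := by
  rw [mul_assoc, Finset.sum_mul, Finset.mul_sum, Finset.mul_sum, ← Finset.sum_add_distrib]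
  refine Finset.sum_le_sum fun j _ => ?_
  have h1 := norm_add_le (f j) (Complex.I • mulOp (hb j) (val d U))
  rw [norm_smul, Complex.norm_I, one_mul] at h1
  have h2 := (mulOp (hb j)).le_opNorm (val d U)
  calc ‖sourceFlux hb U f j‖ ^ 2 ≤ (‖f j‖ + ‖mulOp (hb j)‖ * ‖val d U‖) ^ 2 := by
        have : ‖sourceFlux hb U f j‖ ≤ ‖f j‖ + ‖mulOp (hb j)‖ * ‖val d U‖ := by
          unfold sourceFlux; linarith
        gcongr
    _ ≤ _ := by nlinarith [sq_nonneg (‖f j‖ - ‖mulOp (hb j)‖ * ‖val d U‖)]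

/-- The contribution of `Im z` in the Carleman estimate is controlled by the pairing `⟨(P - z)u, u⟩`,
because its imaginary part is `|Im z| ‖u‖²`. -/
theorem imaginary_part_le (hb : ∀ j, MemLp (fun x => b x j) ⊤ (volume : Measure (Space d)))
    (hV : MemLp V ⊤ (volume : Measure (Space d))) {δ lam : ℝ} (hδ : 0 < δ) (hl : δ ≤ lam) {z : ℂ}
    (hre : z.re = lam ^ 2) (him : |z.im| ≤ 1) (U : sobolev d) (f : Fin d → L2 d) :
    |z.im| * (2 * (‖U‖ ^ 2 / lam + lam * ‖val d U‖ ^ 2)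
        + 16 * (∑ j, ‖sourceFlux hb U f j‖ ^ 2) / lam)
      ≤ (6 + 2 * (2 * ‖mulOp hV‖ + 2 * (∑ j, ‖mulOp (hb j)‖ ^ 2) + 3) / δ ^ 2
          + 32 * (∑ j, ‖mulOp (hb j)‖ ^ 2) / δ ^ 2) * (lam * ‖⟪formOp hb hV z U, U⟫_ℂ‖)
        + 32 / δ ^ 3 * (lam ^ 2 * ∑ j, ‖f j‖ ^ 2) := by
  have hlam : 0 < lam := hδ.trans_le hl
  have h1 := re_inner_formOp_self hb hV z U
  have h2 := im_inner_formOp_self hb hV z U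
  set w := ⟪formOp hb hV z U, U⟫_ℂ
  have h3 := Complex.abs_re_le_norm w
  have h4 := Complex.abs_im_le_norm w
  have h5 := sum_norm_grad_sq_le hb U
  have h6 := sobolev_norm_sq U
  have h7 := sum_norm_sourceFlux_le hb U f
  have h8 : |(⟪mulOp hV (val d U), val d U⟫_ℂ).re| ≤ ‖mulOp hV‖ * ‖val d U‖ ^ 2 := by
    refine (Complex.abs_re_le_norm _).trans ((norm_inner_le_norm _ _).trans ?_)
    have := (mulOp hV).le_opNorm (val d U)
    calc _ ≤ ‖mulOp hV‖ * ‖val d U‖ * ‖val d U‖ := by gcongr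
      _ = _ := by ring
  rw [h2, abs_mul, abs_of_nonneg (sq_nonneg ‖val d U‖)] at h4
  rw [hre] at h1
  have hB : 0 ≤ ∑ j, ‖mulOp (hb j)‖ ^ 2 := by positivity
  have hv : 0 ≤ ‖mulOp hV‖ := norm_nonneg _
  have hf : 0 ≤ ∑ j, ‖f j‖ ^ 2 := by positivity
  have hw : 0 ≤ ‖w‖ := norm_nonneg _
  have hε : 0 ≤ |z.im| := abs_nonneg _
  have hn : 0 ≤ ‖val d U‖ ^ 2 := sq_nonneg _
  have h9 := (abs_le.1 h3).2
  have h10 := (abs_le.1 h8).1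
  generalize ∑ j, ‖mulOp (hb j)‖ ^ 2 = B at *
  generalize ‖mulOp hV‖ = v at *
  generalize ∑ j, ‖f j‖ ^ 2 = N at *
  generalize ∑ j, ‖sourceFlux hb U f j‖ ^ 2 = G at *
  generalize ‖val d U‖ ^ 2 = n at *
  generalize ‖w‖ = W at *
  generalize |z.im| = ε at *
  generalize ‖U‖ ^ 2 = Un at *
  have g1 : Un ≤ 2 * W + (2 * lam ^ 2 + 2 * v + 2 * B + 1) * n := by linarith
  have g2 : ε * Un ≤ (2 * lam ^ 2 + (2 * v + 2 * B + 3)) * W := by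
    have a1 := mul_le_mul_of_nonneg_left g1 hε
    have a2 := mul_le_mul_of_nonneg_left h4 (show 0 ≤ 2 * lam ^ 2 + 2 * v + 2 * B + 1 by positivity)
    have a3 := mul_le_mul_of_nonneg_right him hw
    linarith
  have g3 : ε * G ≤ 2 * N + 2 * B * W := by
    have a1 := mul_le_mul_of_nonneg_left h7 hε
    have a2 := mul_le_mul_of_nonneg_left h4 hB
    have a3 := mul_le_mul_of_nonneg_right him hf
    linarith
  have q1 : 1 / lam ≤ lam / δ ^ 2 := by
    rw [div_le_div_iff₀ hlam (by positivity)]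
    nlinarith
  have q2 : 1 / lam ≤ lam ^ 2 / δ ^ 3 := by
    rw [div_le_div_iff₀ hlam (by positivity)]
    have : δ ^ 3 ≤ lam ^ 3 := by gcongr
    linarith
  have r1 : ε * (Un / lam) ≤ 2 * lam * W + (2 * v + 2 * B + 3) / δ ^ 2 * (lam * W) := by
    have a1 : ε * (Un / lam) = ε * Un * (1 / lam) := by ring
    have a2 := mul_le_mul_of_nonneg_right g2 (show 0 ≤ 1 / lam by positivity)
    have a3 := mul_le_mul_of_nonneg_left q1 (show 0 ≤ (2 * v + 2 * B + 3) * W by positivity)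
    have a4 : 2 * lam ^ 2 * W * (1 / lam) = 2 * lam * W := by field_simp
    have a5 : (2 * v + 2 * B + 3) * W * (lam / δ ^ 2)
        = (2 * v + 2 * B + 3) / δ ^ 2 * (lam * W) := by ring
    rw [a1]
    linarith
  have r2 : ε * (lam * n) ≤ lam * W := by
    have := mul_le_mul_of_nonneg_left h4 hlam.le
    linarith
  have r3 : ε * (16 * G / lam) ≤ 32 / δ ^ 3 * (lam ^ 2 * N) + 32 * B / δ ^ 2 * (lam * W) := by
    have a1 : ε * (16 * G / lam) = 16 * (ε * G) * (1 / lam) := by ring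
    have a2 := mul_le_mul_of_nonneg_right g3 (show 0 ≤ 1 / lam by positivity)
    have a3 := mul_le_mul_of_nonneg_left q1 (show 0 ≤ 2 * B * W by positivity)
    have a4 := mul_le_mul_of_nonneg_left q2 (show 0 ≤ 2 * N by positivity)
    have a5 : 2 * B * W * (lam / δ ^ 2) * 16 = 32 * B / δ ^ 2 * (lam * W) := by ring
    have a6 : 2 * N * (lam ^ 2 / δ ^ 3) * 16 = 32 / δ ^ 3 * (lam ^ 2 * N) := by ring
    rw [a1]
    linarith
  have e2 : 2 * (2 * v + 2 * B + 3) / δ ^ 2 = 2 * ((2 * v + 2 * B + 3) / δ ^ 2) := by ring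
  rw [e2]
  linarith

end

/-! ### The weighted a priori estimate -/

section

variable {d : ℕ} {b : Space d → Space d} {V : Space d → ℝ}

theorem integrable_pw_mul_norm_sq {r : ℝ} (hr : r ≤ 0) (g : L2 d) :
    Integrable (fun x => pw 1 r x * ‖g x‖ ^ 2) volume :=
  integrable_mul_norm_sq (memLp_top_of_continuous (continuous_pw zero_le_one r) 1 fun x => by
    rw [abs_of_pos (pw_pos zero_le_one _ x)]
    exact pw_le_one zero_le_one hr x) g

theorem integral_pw_mul_energy {r : ℝ} (hr : r ≤ 0) (c : ℝ) (U : sobolev d) :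
    ∫ x, pw 1 r x * (gradNormSq U x + c * ‖val d U x‖ ^ 2)
      = (∑ j, ∫ x, pw 1 r x * ‖grad j U x‖ ^ 2) + c * ∫ x, pw 1 r x * ‖val d U x‖ ^ 2 := by
  have i1 := fun j => integrable_pw_mul_norm_sq hr (grad j U)
  have i2 := integrable_pw_mul_norm_sq hr (val d U)
  rw [← integral_const_mul, ← integral_finsetSum Finset.univ fun j _ => i1 j,
    ← integral_add (integrable_finsetSum Finset.univ fun j _ => i1 j) (i2.const_mul c)]
  refine integral_congr_ae (Filter.Eventually.of_forall fun x => ?_)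
  simp only [gradNormSq, mul_add, Finset.mul_sum]
  ring

/-- The pairing of a solution with its data is bounded by the product of the weighted norms. -/
theorem norm_pairing_le {r ζ lam : ℝ} (hr : 0 ≤ r) (hζ : 0 < ζ) (hlam : 0 < lam) (U : sobolev d)
    (f₀ : L2 d) (f : Fin d → L2 d) (hf₀ : Integrable (fun x => pw 1 r x * ‖f₀ x‖ ^ 2) volume)
    (hf : ∀ j, Integrable (fun x => pw 1 r x * ‖f j x‖ ^ 2) volume) :
    lam * ‖⟪f₀, val d U⟫_ℂ + ∑ j, ⟪f j, grad j U⟫_ℂ‖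
      ≤ ζ * (∫ x, pw 1 (-r) x * (gradNormSq U x + lam ^ 2 * ‖val d U x‖ ^ 2))
        + 1 / (4 * ζ) * ((∫ x, pw 1 r x * ‖f₀ x‖ ^ 2)
          + lam ^ 2 * ∑ j, ∫ x, pw 1 r x * ‖f j x‖ ^ 2) := by
  have h1 := norm_inner_le_weighted hr (mul_pos hζ hlam) f₀ (val d U) hf₀
  have h2 := Finset.sum_le_sum fun j (_ : j ∈ Finset.univ) =>
    norm_inner_le_weighted hr (div_pos hζ hlam) (f j) (grad j U) (hf j)
  rw [Finset.sum_add_distrib, ← Finset.mul_sum, ← Finset.mul_sum] at h2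
  have h3 := (norm_add_le ⟪f₀, val d U⟫_ℂ (∑ j, ⟪f j, grad j U⟫_ℂ)).trans
    (add_le_add h1 ((norm_sum_le _ _).trans h2))
  rw [integral_pw_mul_energy (by linarith) (lam ^ 2) U]
  refine (mul_le_mul_of_nonneg_left h3 hlam.le).trans (le_of_eq ?_)
  field_simp
  ring

/-- The weighted a priori estimate for `(P - z) u = f₀ - div f`, uniform in `λ = (Re z)^{1/2} ≥ δ`
and in `|Im z| ≤ 1`. -/
theorem exists_apriori_estimate (hd : 3 ≤ d) {p δ C₀ : ℝ} (hp : 0 < p) (hp' : p ≤ 1 / 8)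
    (hδ : 0 < δ) (hC₀ : 0 ≤ C₀) (hb : ∀ j, MemLp (fun x => b x j) ⊤ (volume : Measure (Space d)))
    (hV : MemLp V ⊤ (volume : Measure (Space d)))
    (hdecay : ∀ᵐ x, |V x| + ‖b x‖ ≤ C₀ * pw 1 (-((1 + 3 * p) / 2)) x) :
    ∃ C : ℝ, 0 < C ∧ ∀ (lam : ℝ) (z : ℂ) (U : sobolev d) (f₀ : L2 d) (f : Fin d → L2 d),
      δ ≤ lam → z.re = lam ^ 2 → |z.im| ≤ 1 →
      (∀ W, ⟪formOp hb hV z U, W⟫_ℂ = ⟪f₀, val d W⟫_ℂ + ∑ j, ⟪f j, grad j W⟫_ℂ) →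
      Integrable (fun x => pw 1 ((1 + p) / 2) x * ‖f₀ x‖ ^ 2) volume →
      (∀ j, Integrable (fun x => pw 1 ((1 + p) / 2) x * ‖f j x‖ ^ 2) volume) →
      ∫ x, pw 1 (-((1 + p) / 2)) x * (gradNormSq U x + lam ^ 2 * ‖val d U x‖ ^ 2)
        ≤ C * ((∫ x, pw 1 ((1 + p) / 2) x * ‖f₀ x‖ ^ 2)
          + lam ^ 2 * ∑ j, ∫ x, pw 1 ((1 + p) / 2) x * ‖f j x‖ ^ 2) := by
  set D : ℝ := (p / 100) ^ 2 / 60 with hD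
  have hD0 : 0 < D := by positivity
  obtain ⟨e, he1, hlarge⟩ := exists_inner_scale
    (K := C₀ ^ 2 * ((300 * ((C₀ + 1) ^ 2 + 1) + 1638400) / p + 8)) hD0
  obtain ⟨t, ht, ht1, hmul, hfar⟩ := exists_outer_scale (e := e) hp hδ
  have h0 : WeightParams p e t δ := ⟨hp, hp', he1, ht, ht1, hmul, hfar⟩
  have he := h0.e_pos
  obtain ⟨M, hM⟩ := exists_phase_le d hp he1 ht ht1
  set K : ℝ := Real.exp M ^ 2 * (2 * d * (2 / t) ^ 2 + 2 * (2 / t * e + d) ^ 2 + 1) with hK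
  have hK0 : 0 < K := by positivity
  set L : ℝ := 6 + 2 * (2 * ‖mulOp hV‖ + 2 * (∑ j, ‖mulOp (hb j)‖ ^ 2) + 3) / δ ^ 2
    + 32 * (∑ j, ‖mulOp (hb j)‖ ^ 2) / δ ^ 2 with hL
  have hL0 : 0 < L := by positivity
  set E : ℝ := Real.exp M ^ 2 * e ^ ((1 + p) / 2) with hE
  have hE0 : 0 < E := by positivity
  set B : ℝ := 819200 / p * (1 + 1 / δ ^ 2) + 4 * ((p / 100) ^ 2 / 15) / δ ^ 2 with hB
  have hB0 : 0 < B := by positivity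
  -- half of the left hand side absorbs the energy which comes from pairing the data with the solution
  set ζ : ℝ := D / (2 * K * L) with hζ
  have hζ0 : 0 < ζ := by positivity
  refine ⟨2 / D * (K * L * (1 / (4 * ζ)) + 32 * K / δ ^ 3 + 300 / (p * e) * E + 2 * B * E),
    by positivity, fun lam z U f₀ f hl hre him hU hf₀ hf => ?_⟩
  have h := h0.mono hδ.le hl
  have hlam : 0 < lam := hδ.trans_le hl
  have hz : ‖z - (lam : ℂ) ^ 2‖ ≤ |z.im| := by
    have : z - (lam : ℂ) ^ 2 = (z.im : ℂ) * Complex.I := by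
      apply Complex.ext <;> simp [hre, ← Complex.ofReal_pow]
    rw [this, norm_mul, Complex.norm_I, mul_one, Complex.norm_real, Real.norm_eq_abs]
  have hcont : Continuous fun x : Space d => Real.exp (phase p e t x) ^ 2 * pw e ((1 + p) / 2) x :=
    ((h.weight hd).exp_φ.1.continuous.pow 2).mul (continuous_pw he.le _)
  have hw0 : ∀ x : Space d, 0 ≤ Real.exp (phase p e t x) ^ 2 * pw e ((1 + p) / 2) x := fun x =>
    mul_nonneg (by positivity) (pw_pos he.le _ x).le
  have hw : ∀ x : Space d, Real.exp (phase p e t x) ^ 2 * pw e ((1 + p) / 2) x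
      ≤ E * pw 1 ((1 + p) / 2) x := fun x => by
    have a1 := pw_le_rpow_mul_pw he1 (show 0 ≤ (1 + p) / 2 by linarith) x
    have a2 := hM x
    have a3 := pw_pos he.le ((1 + p) / 2) x
    rw [hE, mul_assoc]
    gcongr
  have hI : ∀ {g : Space d → ℝ}, (∀ x, 0 ≤ g x) → AEStronglyMeasurable g volume →
      Integrable (fun x => pw 1 ((1 + p) / 2) x * g x) volume →
      Integrable (fun x => Real.exp (phase p e t x) ^ 2 * pw e ((1 + p) / 2) x * g x) volume ∧
      ∫ x, Real.exp (phase p e t x) ^ 2 * pw e ((1 + p) / 2) x * g x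
        ≤ E * ∫ x, pw 1 ((1 + p) / 2) x * g x := fun {g} hg hgm hgi => by
    have a1 : ∀ x, Real.exp (phase p e t x) ^ 2 * pw e ((1 + p) / 2) x * g x
        ≤ E * (pw 1 ((1 + p) / 2) x * g x) := fun x => by
      rw [← mul_assoc]
      exact mul_le_mul_of_nonneg_right (hw x) (hg x)
    have a2 : Integrable (fun x => Real.exp (phase p e t x) ^ 2 * pw e ((1 + p) / 2) x * g x)
        volume := by
      refine (hgi.const_mul E).mono' (hcont.aestronglyMeasurable.mul hgm)
        (Filter.Eventually.of_forall fun x => ?_)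
      rw [Real.norm_of_nonneg (mul_nonneg (hw0 x) (hg x))]
      exact a1 x
    refine ⟨a2, ?_⟩
    rw [← integral_const_mul]
    exact integral_mono a2 (hgi.const_mul E) a1
  have hsum : (fun x => pw 1 ((1 + p) / 2) x * ∑ j, ‖f j x‖ ^ 2)
      = fun x => ∑ j, pw 1 ((1 + p) / 2) x * ‖f j x‖ ^ 2 := by
    funext x
    rw [Finset.mul_sum]
  obtain ⟨j0, k0⟩ := hI (fun x => sq_nonneg ‖f₀ x‖) (integrable_norm_sq f₀).1 hf₀
  obtain ⟨j1, k1⟩ := hI (g := fun x => ∑ j, ‖f j x‖ ^ 2) (fun x => by positivity)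
    (integrable_finsetSum Finset.univ fun j _ => integrable_norm_sq (f j)).1
    (by rw [hsum]; exact integrable_finsetSum Finset.univ fun j _ => hf j)
  rw [hsum, integral_finsetSum Finset.univ fun j _ => hf j] at k1
  have c1 := h.carleman_estimate_magnetic hd hlam hM hC₀ hb hV hdecay hlarge (abs_nonneg z.im) him hz
    U f₀ f hU j0 j1
  have c2 := imaginary_part_le hb hV hδ hl hre him U f
  have c3 := norm_pairing_le (show 0 ≤ (1 + p) / 2 by linarith) hζ0 hlam U f₀ f hf₀ hf
  rw [← hU U] at c3
  have c4 : ∫ x, pw 1 (-((1 + p) / 2)) x * (gradNormSq U x + lam ^ 2 * ‖val d U x‖ ^ 2)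
      ≤ ∫ x, WeightParams.energyDensity p e t lam U x := by
    refine integral_mono_of_nonneg (Filter.Eventually.of_forall fun x => ?_)
      (h.integrable_energyDensity hd U) (Filter.Eventually.of_forall fun x => ?_)
    · have := gradNormSq_nonneg U x
      have := pw_pos zero_le_one (-((1 + p) / 2)) x
      simp only [Pi.zero_apply]
      positivity
    · have a1 := gradNormSq_nonneg U x
      have a2 := h.pw_one_le_Q x
      have a3 := pw_pos zero_le_one (-((1 + p) / 2)) x
      have a4 := pw_pos he.le (-p) x
      have a5 : 1 ≤ Real.exp (phase p e t x) ^ 2 :=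
        one_le_pow₀ (Real.one_le_exp (phase_nonneg hp.le he.le ht.le x))
      have a6 : 0 ≤ e * pw e (-p) x * ‖val d U x‖ ^ 2 := by positivity
      simp only [WeightParams.energyDensity]
      calc pw 1 (-((1 + p) / 2)) x * (gradNormSq U x + lam ^ 2 * ‖val d U x‖ ^ 2)
          ≤ pw t (-((1 + p) / 2)) x
            * (gradNormSq U x + (lam ^ 2 + e * pw e (-p) x) * ‖val d U x‖ ^ 2) :=
            mul_le_mul a2 (by linarith) (by positivity) (a3.le.trans a2)
        _ ≤ _ := le_mul_of_one_le_left (mul_nonneg (a3.le.trans a2) (by positivity)) a5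
  have c5 : ∑ j, ‖f j‖ ^ 2 ≤ ∑ j, ∫ x, pw 1 ((1 + p) / 2) x * ‖f j x‖ ^ 2 := by
    refine Finset.sum_le_sum fun j _ => ?_
    rw [← integral_norm_sq]
    refine integral_mono (integrable_norm_sq (f j)) (hf j) fun x => ?_
    have : pw 1 0 x ≤ pw 1 ((1 + p) / 2) x := pw_le_pw zero_le_one (by linarith) x
    rw [pw_zero] at this
    exact le_mul_of_one_le_left (sq_nonneg _) this
  have c6 : 819200 / p * (lam ^ 2 / e + 1) + 4 * ((p / 100) ^ 2 / 15) ≤ B * lam ^ 2 := by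
    have a1 : (1 : ℝ) ≤ 1 / δ ^ 2 * lam ^ 2 := by
      rw [one_div, inv_mul_eq_div, one_le_div (by positivity)]
      gcongr
    have a2 : lam ^ 2 / e ≤ lam ^ 2 := div_le_self (sq_nonneg _) he1
    have a3 : 819200 / p * (lam ^ 2 / e + 1) ≤ 819200 / p * (lam ^ 2 + 1 / δ ^ 2 * lam ^ 2) := by
      gcongr
    have a4 := mul_le_mul_of_nonneg_left a1 (show 0 ≤ 4 * ((p / 100) ^ 2 / 15) by positivity)
    rw [hB]
    refine (add_le_add a3 (mul_one (4 * ((p / 100) ^ 2 / 15)) ▸ a4)).trans (le_of_eq ?_)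
    ring
  have hN0 : 0 ≤ ∫ x, pw 1 ((1 + p) / 2) x * ‖f₀ x‖ ^ 2 :=
    integral_nonneg fun x => mul_nonneg (pw_pos zero_le_one _ x).le (sq_nonneg _)
  have hN1 : 0 ≤ ∑ j, ∫ x, pw 1 ((1 + p) / 2) x * ‖f j x‖ ^ 2 :=
    Finset.sum_nonneg fun j _ =>
      integral_nonneg fun x => mul_nonneg (pw_pos zero_le_one _ x).le (sq_nonneg _)
  have hI1 : 0 ≤ ∫ x, Real.exp (phase p e t x) ^ 2 * pw e ((1 + p) / 2) x * ∑ j, ‖f j x‖ ^ 2 :=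
    integral_nonneg fun x => mul_nonneg (hw0 x) (by positivity)
  rw [← hD] at c1
  rw [← hL] at c2
  rw [mul_assoc K] at c1
  generalize |z.im| * (2 * (‖U‖ ^ 2 / lam + lam * ‖val d U‖ ^ 2)
    + 16 * (∑ j, ‖sourceFlux hb U f j‖ ^ 2) / lam) = X at *
  generalize ∫ x, pw 1 (-((1 + p) / 2)) x * (gradNormSq U x + lam ^ 2 * ‖val d U x‖ ^ 2) = S at *
  generalize ∫ x, WeightParams.energyDensity p e t lam U x = Y at *
  generalize ∫ x, pw 1 ((1 + p) / 2) x * ‖f₀ x‖ ^ 2 = N0 at *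
  generalize ∑ j, ∫ x, pw 1 ((1 + p) / 2) x * ‖f j x‖ ^ 2 = N1 at *
  generalize ∫ x, Real.exp (phase p e t x) ^ 2 * pw e ((1 + p) / 2) x * ‖f₀ x‖ ^ 2 = I0 at *
  generalize ∫ x, Real.exp (phase p e t x) ^ 2 * pw e ((1 + p) / 2) x * ∑ j, ‖f j x‖ ^ 2 = I1 at *
  generalize lam * ‖⟪formOp hb hV z U, U⟫_ℂ‖ = w at *
  generalize ∑ j, ‖f j‖ ^ 2 = n at *
  have b1 := mul_le_mul_of_nonneg_left c2 hK0.le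
  have b2 := mul_le_mul_of_nonneg_left c3 (mul_pos hK0 hL0).le
  have b3 : K * L * (ζ * S) = D / 2 * S := by rw [hζ]; field_simp
  have b4 := mul_le_mul_of_nonneg_left k0 (show 0 ≤ 300 / (p * e) by positivity)
  have b5 := mul_le_mul c6 k1 hI1 (by positivity)
  have b6 := mul_le_mul_of_nonneg_left c4 hD0.le
  have b7 := mul_le_mul_of_nonneg_left (mul_le_mul_of_nonneg_left c5 (sq_nonneg lam))
    (show 0 ≤ 32 * K / δ ^ 3 by positivity)
  have b8 : K * (32 / δ ^ 3 * (lam ^ 2 * n)) = 32 * K / δ ^ 3 * (lam ^ 2 * n) := by ring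
  have b9 : 100 / (p * e) * (3 * I0) = 300 / (p * e) * I0 := by ring
  have g1 : 0 ≤ 32 * K / δ ^ 3 * N0 := by positivity
  have g2 : 0 ≤ 300 / (p * e) * E * (lam ^ 2 * N1) := by positivity
  have g3 : 0 ≤ 2 * B * E * N0 := by positivity
  have key : D / 2 * S ≤ (K * L * (1 / (4 * ζ)) + 32 * K / δ ^ 3 + 300 / (p * e) * E + 2 * B * E)
      * (N0 + lam ^ 2 * N1) := by
    rw [b9] at c1
    rw [mul_add K, b8] at b1
    linarith
  calc S = 2 / D * (D / 2 * S) := by field_simp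
    _ ≤ 2 / D * _ := mul_le_mul_of_nonneg_left key (by positivity)
    _ = _ := by ring

end

/-! ### The weighted resolvent -/

theorem japaneseBracket_rpow {d : ℕ} (x : Space d) (r : ℝ) :
    japaneseBracket x ^ r = pw 1 (r / 2) x := by
  unfold japaneseBracket pw
  rw [Real.sqrt_eq_rpow, ← Real.rpow_mul (by positivity), one_mul, add_comm, one_div_mul_eq_div]

theorem eq_zero_or_eq_single_of_sum_le_one {d : ℕ} {α : Fin d → ℕ} (h : ∑ j, α j ≤ 1) :
    α = 0 ∨ ∃ i, α = Pi.single i 1 := by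
  by_cases h0 : α = 0
  · exact Or.inl h0
  obtain ⟨i, hi⟩ := Function.ne_iff.1 h0
  refine Or.inr ⟨i, funext fun j => ?_⟩
  rw [Pi.zero_apply] at hi
  have h1 := Finset.add_sum_erase Finset.univ α (Finset.mem_univ i)
  by_cases hj : j = i
  · subst hj
    rw [Pi.single_eq_same]
    omega
  · have h2 := Finset.single_le_sum (f := α) (fun _ _ => Nat.zero_le _)
      (Finset.mem_erase.2 ⟨hj, Finset.mem_univ j⟩)
    rw [Pi.single_eq_of_ne hj]
    omega

/-- The derivative `∂^α` of order at most one on `H¹`, bounded by the weighted energy at frequency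
`λ`. -/
theorem exists_derivative_operator {d : ℕ} {α : Fin d → ℕ} (hα : ∑ j, α j ≤ 1) :
    ∃ D : sobolev d →L[ℂ] L2 d, (∀ U, IsWeakDeriv α (val d U) (D U)) ∧
      ∀ (r lam : ℝ) (U : sobolev d), r ≤ 0 →
        (lam ^ (1 - ∑ j, α j)) ^ 2 * ∫ x, pw 1 r x * ‖D U x‖ ^ 2
          ≤ ∫ x, pw 1 r x * (gradNormSq U x + lam ^ 2 * ‖val d U x‖ ^ 2) := by
  have h0 : ∀ (r : ℝ) (g : L2 d), 0 ≤ ∫ x, pw 1 r x * ‖g x‖ ^ 2 := fun r g =>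
    integral_nonneg fun x => mul_nonneg (pw_pos zero_le_one _ x).le (sq_nonneg _)
  rcases eq_zero_or_eq_single_of_sum_le_one hα with rfl | ⟨i, rfl⟩
  · refine ⟨val d, fun U => isWeakDeriv_zero_iff.2 rfl, fun r lam U hr => ?_⟩
    rw [integral_pw_mul_energy hr]
    simpa using Finset.sum_nonneg fun j _ => h0 r (grad j U)
  · refine ⟨grad i, fun U => isWeakGrad_sobolev U i, fun r lam U hr => ?_⟩
    rw [integral_pw_mul_energy hr]
    have h1 := Finset.single_le_sum (fun j _ => h0 r (grad j U)) (Finset.mem_univ i)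
    have h2 := mul_nonneg (sq_nonneg lam) (h0 r (val d U))
    simp only [Finset.sum_pi_single', Finset.mem_univ, if_true, tsub_self, pow_zero, one_pow, one_mul]
    linarith

/-- The functional `W ↦ ⟨∂^β g, W⟩` on `H¹`, for `g ∈ L²` and `|β| ≤ 1`, in divergence form. -/
theorem exists_data_operator {d : ℕ} {β : Fin d → ℕ} (hβ : ∑ j, β j ≤ 1) :
    ∃ Λ : L2 d →L[ℂ] sobolev d,
      (∀ g h, IsWeakDeriv β g h → ContinuousLinearMap.adjoint (val d) h = Λ g) ∧
      ∀ (r : ℝ) (g : L2 d), Integrable (fun x => pw 1 r x * ‖g x‖ ^ 2) volume →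
        ∃ (f₀ : L2 d) (f : Fin d → L2 d),
          (∀ W, ⟪Λ g, W⟫_ℂ = ⟪f₀, val d W⟫_ℂ + ∑ j, ⟪f j, grad j W⟫_ℂ) ∧
          Integrable (fun x => pw 1 r x * ‖f₀ x‖ ^ 2) volume ∧
          (∀ j, Integrable (fun x => pw 1 r x * ‖f j x‖ ^ 2) volume) ∧
          ∀ lam : ℝ, (∫ x, pw 1 r x * ‖f₀ x‖ ^ 2) + lam ^ 2 * ∑ j, ∫ x, pw 1 r x * ‖f j x‖ ^ 2
            = (lam ^ (∑ j, β j)) ^ 2 * ∫ x, pw 1 r x * ‖g x‖ ^ 2 := by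
  have h0 : ∀ r : ℝ, (fun x => pw 1 r x * ‖(0 : L2 d) x‖ ^ 2) =ᵐ[volume] 0 := fun r =>
    Filter.Eventually.of_forall fun x => by simp
  have i0 : ∀ r : ℝ, Integrable (fun x => pw 1 r x * ‖(0 : L2 d) x‖ ^ 2) volume := fun r =>
    (integrable_congr (h0 r)).2 (integrable_zero _ _ _)
  have j0 : ∀ r : ℝ, ∫ x, pw 1 r x * ‖(0 : L2 d) x‖ ^ 2 = 0 := fun r => by
    rw [integral_congr_ae (h0 r)]
    simp
  rcases eq_zero_or_eq_single_of_sum_le_one hβ with rfl | ⟨i, rfl⟩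
  · refine ⟨ContinuousLinearMap.adjoint (val d), fun g h hgh => by
      rw [isWeakDeriv_zero_iff.1 hgh], fun r g hg => ⟨g, 0, fun W => ?_, hg, fun _ => i0 r,
        fun lam => ?_⟩⟩
    · simp [ContinuousLinearMap.adjoint_inner_left]
    · simp only [Pi.zero_apply, j0]
      simp
  · have h1 : ∀ (r : ℝ) (g : L2 d), (fun x => pw 1 r x * ‖(-g : L2 d) x‖ ^ 2)
        =ᵐ[volume] fun x => pw 1 r x * ‖g x‖ ^ 2 := fun r g => by
      filter_upwards [Lp.coeFn_neg g] with x hx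
      rw [hx, Pi.neg_apply, norm_neg]
    refine ⟨-ContinuousLinearMap.adjoint (grad i), fun g h hgh => ?_, fun r g hg =>
      ⟨0, Pi.single i (-g), fun W => ?_, i0 r, fun j => ?_, fun lam => ?_⟩⟩
    · refine ext_inner_right ℂ fun W => ?_
      rw [neg_apply, inner_neg_left, ContinuousLinearMap.adjoint_inner_left,
        ContinuousLinearMap.adjoint_inner_left, inner_weakDeriv hgh]
    · rw [neg_apply, inner_neg_left, ContinuousLinearMap.adjoint_inner_left,
        Finset.sum_eq_single i (fun j _ hj => by rw [Pi.single_eq_of_ne hj, inner_zero_left])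
          (fun h => absurd (Finset.mem_univ i) h), Pi.single_eq_same, inner_neg_left,
        inner_zero_left, zero_add]
    · by_cases hj : j = i
      · subst hj
        rw [Pi.single_eq_same]
        exact (integrable_congr (h1 r g)).2 hg
      · rw [Pi.single_eq_of_ne hj]
        exact i0 r
    · rw [Finset.sum_eq_single i (fun j _ hj => by rw [Pi.single_eq_of_ne hj, j0])
          (fun h => absurd (Finset.mem_univ i) h), Pi.single_eq_same, j0,
        integral_congr_ae (h1 r g)]
      simp

section

variable {d : ℕ} {b : Space d → Space d} {V : Space d → ℝ}

/-- Off the real axis the resolvent is obtained by inverting the operator of the form on `H¹`. -/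
theorem exists_isResolvent (hb : ∀ j, MemLp (fun x => b x j) ⊤ (volume : Measure (Space d)))
    (hV : MemLp V ⊤ (volume : Measure (Space d))) {z : ℂ} (hz : z.im ≠ 0) :
    ∃ B : sobolev d →L[ℂ] sobolev d, (∀ U, formOp hb hV z (B U) = U) ∧
      IsResolvent (operatorGraph b V) z (val d ∘L B ∘L ContinuousLinearMap.adjoint (val d)) := by
  obtain ⟨c, hc, hcoer⟩ := formOp_coercive hb hV hz
  obtain ⟨B, hB, hB'⟩ := (formOp hb hV z).exists_inverse_of_coercive hc hcoer
  have hgraph : ∀ (U : sobolev d) (f : L2 d),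
      formOp hb hV z U = ContinuousLinearMap.adjoint (val d) f ↔ ∀ W : sobolev d,
        form b V (val d U) (fun j => grad j U) (val d W) (fun j => grad j W)
          = ⟪f + z • val d U, val d W⟫_ℂ := fun U f => by
    constructor
    · intro h W
      have h1 := inner_formOp hb hV z U W
      rw [h, ContinuousLinearMap.adjoint_inner_left] at h1
      rw [form_eq_inner hb hV, inner_add_left, h1]
      ring
    · intro h
      refine ext_inner_right ℂ fun W => ?_
      have h1 := h W
      rw [form_eq_inner hb hV, inner_add_left] at h1
      rw [inner_formOp, ContinuousLinearMap.adjoint_inner_left, h1]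
      ring
  refine ⟨B, hB, fun f => ?_, fun u f => ?_⟩
  · have h := (hgraph _ f).1 (hB (ContinuousLinearMap.adjoint (val d) f))
    refine ⟨_, isWeakGrad_sobolev (B (ContinuousLinearMap.adjoint (val d) f)), fun v Gv hv => ?_⟩
    obtain ⟨W, rfl, hW⟩ := exists_sobolev_of_isWeakGrad hv
    obtain rfl : (fun j => grad j W) = Gv := funext hW
    exact h W
  · rintro ⟨Gu, hu, h⟩
    obtain ⟨U, hU, hG⟩ := exists_sobolev_of_isWeakGrad hu
    obtain rfl : (fun j => grad j U) = Gu := funext hG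
    obtain rfl : val d U = u := hU
    have h1 := (hgraph U (f - z • val d U)).2 fun W => by
      rw [sub_add_cancel]
      exact h _ _ (isWeakGrad_sobolev W)
    have h2 := hB' U
    rw [h1] at h2
    exact congrArg (val d) h2

/-- Boundedness of the weighted resolvent follows from an a priori estimate in weighted spaces. -/
theorem exists_isWeightedResolvent {r s lam C : ℝ} (hr : 0 ≤ r) (hrs : r ≤ s) (hlam : 0 < lam)
    (hC : 0 ≤ C) {A B : sobolev d →L[ℂ] sobolev d} (hB : ∀ U, A (B U) = U)
    (hA : ∀ (U : sobolev d) (f₀ : L2 d) (f : Fin d → L2 d),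
      (∀ W, ⟪A U, W⟫_ℂ = ⟪f₀, val d W⟫_ℂ + ∑ j, ⟪f j, grad j W⟫_ℂ) →
      Integrable (fun x => pw 1 r x * ‖f₀ x‖ ^ 2) volume →
      (∀ j, Integrable (fun x => pw 1 r x * ‖f j x‖ ^ 2) volume) →
      ∫ x, pw 1 (-r) x * (gradNormSq U x + lam ^ 2 * ‖val d U x‖ ^ 2)
        ≤ C * ((∫ x, pw 1 r x * ‖f₀ x‖ ^ 2) + lam ^ 2 * ∑ j, ∫ x, pw 1 r x * ‖f j x‖ ^ 2))
    {α β : Fin d → ℕ} (hα : ∑ j, α j ≤ 1) (hβ : ∑ j, β j ≤ 1) :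
    ∃ T : L2 d →L[ℂ] L2 d,
      IsWeightedResolvent s (val d ∘L B ∘L ContinuousLinearMap.adjoint (val d)) α β T ∧
      ‖T‖ ≤ Real.sqrt C * lam ^ ((((∑ j, α j) + (∑ j, β j) : ℕ) : ℤ) - 1) := by
  obtain ⟨D, hD, hD'⟩ := exists_derivative_operator hα
  obtain ⟨Λ, hΛ, hΛ'⟩ := exists_data_operator hβ
  have hs : 0 ≤ s := hr.trans hrs
  have hm : MemLp (pw 1 (-s / 2)) ⊤ (volume : Measure (Space d)) :=
    memLp_top_of_continuous (continuous_pw zero_le_one _) 1 fun x => by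
      rw [abs_of_pos (pw_pos zero_le_one _ x)]
      exact pw_le_one zero_le_one (by linarith) x
  have hsq : ∀ g : L2 d, ∀ᵐ x, ‖mulOp hm g x‖ ^ 2 = pw 1 (-s) x * ‖g x‖ ^ 2 := fun g => by
    filter_upwards [mulOp_coeFn hm g] with x hx
    rw [hx, norm_mul, Complex.norm_real, mul_pow, Real.norm_eq_abs, sq_abs, sq (pw _ _ _),
      pw_mul zero_le_one, add_halves]
  refine ⟨mulOp hm ∘L D ∘L B ∘L Λ ∘L mulOp hm, fun f g h hg hh => ?_, ?_⟩
  · obtain rfl : mulOp hm f = g := by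
      refine Lp.ext ?_
      filter_upwards [mulOp_coeFn hm f, hg] with x h1 h2
      rw [h1, h2, japaneseBracket_rpow]
    refine ⟨D (B (Λ (mulOp hm f))), ?_, ?_⟩
    · rw [← hΛ _ _ hh]
      exact hD _
    · filter_upwards [mulOp_coeFn hm (D (B (Λ (mulOp hm f))))] with x hx
      rw [japaneseBracket_rpow]
      exact hx
  · refine ContinuousLinearMap.opNorm_le_bound _ (by positivity) fun f => ?_
    simp only [ContinuousLinearMap.comp_apply]
    set g := mulOp hm f with hg
    set k := D (B (Λ g)) with hk
    have b1 : ∀ᵐ x, pw 1 r x * ‖g x‖ ^ 2 ≤ ‖f x‖ ^ 2 := by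
      filter_upwards [hsq f] with x hx
      rw [hx, ← mul_assoc, pw_mul zero_le_one]
      exact mul_le_of_le_one_left (sq_nonneg _) (pw_le_one zero_le_one (by linarith) x)
    have b2 : Integrable (fun x => pw 1 r x * ‖g x‖ ^ 2) volume := by
      refine (integrable_norm_sq f).mono' ((continuous_pw zero_le_one r).aestronglyMeasurable.mul
        (integrable_norm_sq g).1) ?_
      filter_upwards [b1] with x hx
      rwa [Real.norm_of_nonneg (mul_nonneg (pw_pos zero_le_one _ x).le (sq_nonneg _))]
    have b3 : ∫ x, pw 1 r x * ‖g x‖ ^ 2 ≤ ‖f‖ ^ 2 := by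
      rw [← integral_norm_sq]
      exact integral_mono_ae b2 (integrable_norm_sq f) b1
    have b4 : ‖mulOp hm k‖ ^ 2 ≤ ∫ x, pw 1 (-r) x * ‖k x‖ ^ 2 := by
      rw [← integral_norm_sq]
      refine integral_mono_ae (integrable_norm_sq _) (integrable_pw_mul_norm_sq (by linarith) k) ?_
      filter_upwards [hsq k] with x hx
      rw [hx]
      exact mul_le_mul_of_nonneg_right (pw_le_pw zero_le_one (by linarith) x) (sq_nonneg _)
    obtain ⟨f₀, F, c1, c2, c3, c4⟩ := hΛ' r g b2
    have b5 := hA (B (Λ g)) f₀ F (fun W => by rw [hB]; exact c1 W) c2 c3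
    have b6 := hD' (-r) lam (B (Λ g)) (by linarith)
    rw [c4] at b5
    have hL : 0 < lam ^ (1 - ∑ j, α j) := by positivity
    have b7 : (lam ^ (1 - ∑ j, α j) * ‖mulOp hm k‖) ^ 2
        ≤ (Real.sqrt C * lam ^ (∑ j, β j) * ‖f‖) ^ 2 := by
      rw [mul_pow, mul_pow, mul_pow, Real.sq_sqrt hC]
      calc _ ≤ (lam ^ (1 - ∑ j, α j)) ^ 2 * ∫ x, pw 1 (-r) x * ‖k x‖ ^ 2 := by gcongr
        _ ≤ _ := b6.trans b5
        _ ≤ C * ((lam ^ (∑ j, β j)) ^ 2 * ‖f‖ ^ 2) := by gcongr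
        _ = _ := by ring
    have b8 := abs_le_of_sq_le_sq' b7 (by positivity)
    have e1 : lam ^ ((((∑ j, α j) + (∑ j, β j) : ℕ) : ℤ) - 1)
        = (lam ^ (1 - ∑ j, α j))⁻¹ * lam ^ (∑ j, β j) := by
      rw [← zpow_natCast, ← zpow_natCast, ← zpow_neg, ← zpow_add₀ hlam.ne', Nat.cast_sub hα]
      congr 1
      push_cast
      ring
    rw [e1]
    calc ‖mulOp hm k‖ = (lam ^ (1 - ∑ j, α j))⁻¹ * (lam ^ (1 - ∑ j, α j) * ‖mulOp hm k‖) := by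
          field_simp
      _ ≤ (lam ^ (1 - ∑ j, α j))⁻¹ * (Real.sqrt C * lam ^ (∑ j, β j) * ‖f‖) := by
          exact mul_le_mul_of_nonneg_left b8.2 (by positivity)
      _ = _ := by ring

end

theorem theorem3p1 (d : ℕ) (hd : 3 ≤ d)
    (b : Space d → Space d) (V : Space d → ℝ)
    (hb : MemLp b ⊤ (volume : Measure (Space d)))
    (hV : MemLp V ⊤ (volume : Measure (Space d)))
    (C₀ ρ : ℝ) (hC₀ : 0 < C₀) (hρ : 1 < ρ)
    (hdecay : ∀ᵐ x : Space d, |V x| + ‖b x‖ ≤ C₀ * japaneseBracket x ^ (-ρ))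
    (δ : ℝ) (hδ : 0 < δ) (s : ℝ) (hs : 1 / 2 < s) :
    ∃ C : ℝ, 0 < C ∧
      ∀ (lam ε σ : ℝ), δ ≤ lam → 0 < ε → ε < 1 → (σ = 1 ∨ σ = -1) →
        ∃ R : L2 d →L[ℂ] L2 d,
          IsResolvent (operatorGraph b V) ((lam : ℂ) ^ 2 - σ * (Complex.I * ε)) R ∧
          ∀ α β : Fin d → ℕ, ∑ j, α j ≤ 1 → ∑ j, β j ≤ 1 →
            ∃ T : L2 d →L[ℂ] L2 d, IsWeightedResolvent s R α β T ∧
              ‖T‖ ≤ C * lam ^ ((((∑ j, α j) + (∑ j, β j) : ℕ) : ℤ) - 1) := by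
  have hb' : ∀ j, MemLp (fun x => b x j) ⊤ (volume : Measure (Space d)) := fun j =>
    hb.of_le ((EuclideanSpace.proj (𝕜 := ℝ) j).continuous.comp_aestronglyMeasurable hb.1)
      (Filter.Eventually.of_forall fun x => PiLp.norm_apply_le (b x) j)
  -- all weights are compared with powers whose exponents depend on one small parameter
  set p : ℝ := min (1 / 8) (min ((ρ - 1) / 3) (2 * s - 1)) with hp
  have hp0 : 0 < p := lt_min (by norm_num) (lt_min (by linarith) (by linarith))
  have hp1 : p ≤ 1 / 8 := min_le_left _ _
  have hp2 : p ≤ (ρ - 1) / 3 := (min_le_right _ _).trans (min_le_left _ _)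
  have hp3 : p ≤ 2 * s - 1 := (min_le_right _ _).trans (min_le_right _ _)
  have hdecay' : ∀ᵐ x, |V x| + ‖b x‖ ≤ C₀ * pw 1 (-((1 + 3 * p) / 2)) x := by
    filter_upwards [hdecay] with x hx
    rw [japaneseBracket_rpow] at hx
    refine hx.trans (mul_le_mul_of_nonneg_left (pw_le_pw zero_le_one (by linarith) x) hC₀.le)
  obtain ⟨C, hC, hest⟩ := exists_apriori_estimate hd hp0 hp1 hδ hC₀.le hb' hV hdecay'
  refine ⟨Real.sqrt C, Real.sqrt_pos.2 hC, fun lam ε σ hl hε hε1 hσ => ?_⟩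
  set z : ℂ := (lam : ℂ) ^ 2 - σ * (Complex.I * ε) with hz
  have hre : z.re = lam ^ 2 := by simp [hz, ← Complex.ofReal_pow]
  have him : z.im = -(σ * ε) := by simp [hz, ← Complex.ofReal_pow]
  have habs : |z.im| = ε := by
    rcases hσ with rfl | rfl <;> simp [him, abs_of_pos hε]
  have hz0 : z.im ≠ 0 := abs_pos.1 (by rw [habs]; exact hε)
  obtain ⟨B, hB, hR⟩ := exists_isResolvent hb' hV hz0
  exact ⟨_, hR, fun α β hα hβ => exists_isWeightedResolvent (by linarith) (by linarith)
    (hδ.trans_le hl) hC.le hB (fun U f₀ f => hest lam z U f₀ f hl hre (by linarith)) hα hβ⟩
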